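/- Let $a,D,n_0,\Delta n,\lambda>0$ with $a<D$ (waveguide radius, spacing, background index, index contrast, wavelength), and put $k=2\pi n_0/\lambda$. Let $\beta_0$ satisfy $0<\beta_0<k\Delta n/n_0$, and put $\Lambda=\sqrt{2k^2\Delta n/n_0-2k\beta_0}$ and $\Gamma=\sqrt{2k\beta_0}$. Assume that $\beta_0$ belongs to a fundamental guided mode of a single waveguide: $J_0>0$ on $[0,\Lambda a]$ and $$\frac{\Lambda J_1(\Lambda a)}{J_0(\Lambda a)}=\frac{\Gamma K_1(\Gamma a)}{K_0(\Gamma a)},$$ where $J_n$ is the Bessel function of the first kind and $K_n$ the modified Bessel function of the second kind. Let $\phi(r)=AJ_0(\Lambda r)$ for $r\le a$ and $\phi(r)=BK_0(\Gamma r)$ for $r>a$, where $B=AJ_0(\Lambda a)/K_0(\Gamma a)$ and $A>0$ is such that $\iint_{\mathbb R^2}\phi(\sqrt{x^2+y^2})^2\,dx\,dy=1$. For $m\in\mathbb Z$ let $\phi_m(x,y)=\phi\big(\sqrt{(x-mD)^2+y^2}\big)$, and for integers $\xi\ge0$ let $S_\xi=\iint_{\mathbb R^2}\phi_0\,\phi_\xi\,dx\,dy$.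 (i) The integrals defining $S_\xi$ converge, $\sum_{\xi}S_\xi$ converges, and $(\mathcal S\mathbf c)_n=\sum_{m\in\mathbb Z}S_{|n-m|}c_m$ defines a bounded operator $\mathcal S$ on $\ell^2(\mathbb Z;\mathbb C)$. Moreover $\mathcal S=I+\mathcal R$, where $(\mathcal R\mathbf c)_n=\sum_{m\ne n}S_{|n-m|}c_m$ defines a bounded operator with $\|\mathcal R\|\le 2\sum_{\xi\ge1}S_\xi$, and $\mathcal S$ is invertible with bounded inverse. (ii) For the parameters $a=3.32\,\mu\mathrm m$, $D=20\,\mu\mathrm m$, $n_0=1.45$, $\Delta n=8\cdot10^{-4}$, $\lambda=0.8\,\mu\mathrm m$ one has moreover $2\sum_{\xi\ge1}S_\xi<1$; more precisely $\big|2\sum_{\xi\ge1}S_\xi-0.3951\big|<5\cdot10^{-5}$. -/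

import Mathlib

open MeasureTheory

noncomputable section

/-- The Bessel function of the first kind `J_n`, by its power series. -/
def besselJ (n : ℕ) (x : ℝ) : ℝ :=
  ∑' j : ℕ, (-1) ^ j / ((j.factorial : ℝ) * ((j + n).factorial : ℝ)) * (x / 2) ^ (2 * j + n)

/-- The modified Bessel function of the second kind `K_n` at `x > 0`, by its integral
representation. -/
def besselK (n : ℕ) (x : ℝ) : ℝ :=
  ∫ t in Set.Ioi (0 : ℝ), Real.exp (-x * Real.cosh t) * Real.cosh (n * t)

/-- The physical parameters of an infinite horizontal array of identical cylindrical waveguides. -/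
structure WaveguideArray where
  /-- radius of each waveguide -/
  a : ℝ
  /-- horizontal spacing of the axes of neighbouring waveguides -/
  D : ℝ
  /-- background refractive index -/
  n₀ : ℝ
  /-- refractive index contrast -/
  Δn : ℝ
  /-- wavelength of the light in vacuum -/
  wl : ℝ
  a_pos : 0 < a
  a_lt_D : a < D
  n₀_pos : 0 < n₀
  Δn_pos : 0 < Δn
  wl_pos : 0 < wl

namespace WaveguideArray

variable (W : WaveguideArray)

/-- The background wavenumber `k = 2π n₀ / wl`. -/
def k : ℝ := 2 * Real.pi * W.n₀ / W.wl

/-- The transverse wavenumber inside the core, for the longitudinal shift `β`. -/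
def Lam (β : ℝ) : ℝ := √(2 * W.k ^ 2 * W.Δn / W.n₀ - 2 * W.k * β)

/-- The transverse decay rate in the cladding, for the longitudinal shift `β`. -/
def Gam (β : ℝ) : ℝ := √(2 * W.k * β)

/-- `β` is the longitudinal wavenumber shift of a fundamental guided mode of a single waveguide:
both transverse wavenumbers are positive, `Λ a` lies below the first zero of `J₀`, and the
characteristic equation `Λ J₁(Λa) / J₀(Λa) = Γ K₁(Γa) / K₀(Γa)` holds. -/
structure IsFundamental (β : ℝ) : Prop where
  pos : 0 < β
  lt : β < W.k * W.Δn / W.n₀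
  besselJ_pos : ∀ x : ℝ, 0 ≤ x → x ≤ W.Lam β * W.a → 0 < besselJ 0 x
  characteristic :
    W.Lam β * besselJ 1 (W.Lam β * W.a) / besselJ 0 (W.Lam β * W.a) =
      W.Gam β * besselK 1 (W.Gam β * W.a) / besselK 0 (W.Gam β * W.a)

/-- The radial profile of the fundamental mode before normalization (`A = 1`). The ratio
`B / A = J₀(Λa) / K₀(Γa)` makes it continuous at `r = a`. -/
def rawProfile (β r : ℝ) : ℝ :=
  if r ≤ W.a then besselJ 0 (W.Lam β * r)
  else besselJ 0 (W.Lam β * W.a) / besselK 0 (W.Gam β * W.a) * besselK 0 (W.Gam β * r)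

/-- The normalizing amplitude `A > 0`, so that the mode has unit norm in `L²(ℝ²)`. -/
def amplitude (β : ℝ) : ℝ :=
  (√(∫ p : ℝ × ℝ, W.rawProfile β (√(p.1 ^ 2 + p.2 ^ 2)) ^ 2))⁻¹

/-- The normalized transverse mode `φ_m` of the `m`-th waveguide, centred at `(m D, 0)`. -/
def mode (β : ℝ) (m : ℤ) (p : ℝ × ℝ) : ℝ :=
  W.amplitude β * W.rawProfile β (√((p.1 - m * W.D) ^ 2 + p.2 ^ 2))

/-- The overlap integral `S_ξ = ∬ φ₀ φ_ξ`. -/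
def S (β : ℝ) (ξ : ℕ) : ℝ :=
  ∫ p : ℝ × ℝ, W.mode β 0 p * W.mode β (ξ : ℤ) p

/-- The experimental parameters, lengths in micrometres: `a = 3.32`, `D = 20`, `n₀ = 1.45`,
`Δn = 8 · 10⁻⁴`, wavelength `0.8`. -/
def experiment : WaveguideArray where
  a := 3.32
  D := 20
  n₀ := 1.45
  Δn := 8 / 10 ^ 4
  wl := 0.8
  a_pos := by norm_num
  a_lt_D := by norm_num
  n₀_pos := by norm_num
  Δn_pos := by norm_num
  wl_pos := by norm_num

end WaveguideArray

/-- The Hilbert space `ℓ²(ℤ; ℂ)`. -/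
abbrev EllTwo : Type := lp (fun _ : ℤ => ℂ) 2

end

/-! ### The entire functions behind the Bessel functions -/

/-! The general statement rests on decay and coercivity. In the cladding the profile is a multiple
of K₀(Γr), so it decays like exp(-Γr) (`exists_rawProfile_le`). Hence the overlaps are finite and
bounded by a geometric sequence in ξ. The operator ℛ is an absolutely convergent sum of weighted
shifts (`exists_convolution`), which gives the norm bound, and normalization gives S₀ = 1, hence 𝒮 =
1 + ℛ.

No smallness of the overlaps is assumed, so invertibility does not come from a Neumann series; it
comes from a strictly positive lower bound on the quadratic form. The key fact is the mean value
formula `integral_besselK_circle`: over a circle of radius r < d about the origin, K₀(g·|p - (d,0)|)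
has mean I₀(gr)K₀(gd). A radial function supported in a small disc inside one core and orthogonal to
I₀(Γr) is therefore orthogonal to the tail of every other mode. Let ψ be the component of φ on that
disc orthogonal to I₀(Γr). It is nonzero, because J₀(Λr) decreases there while I₀(Γr) increases
strictly, and its translates satisfy ⟨ψₙ, φₘ⟩ = ⟨ψₙ, ψₘ⟩ = P δₙₘ with P > 0. The Gram matrix of the
functions A(φₙ - ψₙ) is then S - A²P·I. It is positive semidefinite, so 𝒮 ≥ A²P, and a coercive
bounded operator is invertible (`exists_dual`, `exists_gram`, `isUnit_of_quadratic_lower_bound`).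

The numerical statement uses a closed form for the overlaps (`S_eq`). Writing φ as cK₀(Γr) plus a
defect supported in the core, the mean value formula reduces every two-centre integral to a radial
one with an explicit antiderivative. The Wronskian of I₀, K₀ and the characteristic equation remove
all values of J. Both sides of the characteristic equation are monotone, which confines ΓD to
[2.71329, 2.71331]. K₀ and K₁ are enclosed by power series: K₀ = (c - log x)I₀ + P(x²/4), with c
pinned down by the smallness of K₀(14), and K₁ recovered from the Wronskian. Four overlaps are
enclosed explicitly and the rest are bounded by a geometric series. -/

theorem hasDerivAt_of_eq {f g : ℝ → ℝ} {f' g' x : ℝ} (h : HasDerivAt f f' x)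
    (hf : ∀ y, g y = f y) (hg : g' = f') : HasDerivAt g g' x := by
  rw [hg, funext hf]
  exact h

theorem summable_mul_pow_of_abs_le_div_factorial {c : ℕ → ℝ} {M : ℝ}
    (hc : ∀ j, |c j| ≤ M / (j.factorial : ℝ)) (z : ℝ) : Summable fun j => c j * z ^ j := by
  refine Summable.of_norm_bounded ((Real.summable_pow_div_factorial |z|).mul_left M) fun j => ?_
  rw [norm_mul, Real.norm_eq_abs, norm_pow, Real.norm_eq_abs]
  calc |c j| * |z| ^ j ≤ M / (j.factorial : ℝ) * |z| ^ j := by gcongr; exact hc j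
    _ = _ := by ring

/-- Termwise differentiation: on the ball of radius R = |z| + 1 the derived terms are dominated by M
j R^(j-1)/j!, which is summable. -/
theorem hasDerivAt_tsum_mul_pow {c : ℕ → ℝ} {M : ℝ}
    (hc : ∀ j, |c j| ≤ M / (j.factorial : ℝ)) (z : ℝ) :
    HasDerivAt (fun z => ∑' j, c j * z ^ j) (∑' j : ℕ, ((j : ℝ) + 1) * c (j + 1) * z ^ j) z := by
  have hM : 0 ≤ M := by simpa using (abs_nonneg _).trans (hc 0)
  set R : ℝ := |z| + 1
  have hR : 0 ≤ R := by positivity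
  have hz : z ∈ Metric.ball (0 : ℝ) R := by simp [R]
  let u : ℕ → ℝ := fun j => M * (j * R ^ (j - 1) / (j.factorial : ℝ))
  have hu : Summable u := by
    refine Summable.mul_left M ?_
    rw [← summable_nat_add_iff 1]
    refine (Real.summable_pow_div_factorial R).congr fun j => ?_
    rw [Nat.factorial_succ]
    push_cast
    field_simp
  have key := hasDerivAt_tsum_of_isPreconnected (g := fun j z => c j * z ^ j)
    (g' := fun j z => c j * (j * z ^ (j - 1))) hu Metric.isOpen_ball
    (convex_ball (0 : ℝ) R).isPreconnected
    (fun j y _ => (hasDerivAt_pow j y).const_mul (c j)) (fun j y hy => ?_) hz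
    (summable_mul_pow_of_abs_le_div_factorial hc z) hz
  · refine hasDerivAt_of_eq key (fun _ => rfl) ?_
    symm
    rw [Summable.tsum_eq_zero_add]
    · simp only [Nat.cast_zero, zero_mul, mul_zero, zero_add, Nat.cast_add, Nat.cast_one,
        Nat.add_sub_cancel]
      exact tsum_congr fun j => by ring
    · refine Summable.of_norm_bounded hu fun j => ?_
      rw [norm_mul, norm_mul, norm_pow, Real.norm_eq_abs, Real.norm_eq_abs, Real.norm_eq_abs,
        Nat.abs_cast]
      calc |c j| * (j * |z| ^ (j - 1)) ≤ M / (j.factorial : ℝ) * (j * R ^ (j - 1)) := by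
            gcongr
            · exact hc j
            · simp [R]
        _ = _ := by simp only [u]; ring
  · have hy' : |y| ≤ R := by simpa using (Metric.mem_ball.1 hy).le
    rw [norm_mul, norm_mul, norm_pow, Real.norm_eq_abs, Real.norm_eq_abs, Real.norm_eq_abs,
      Nat.abs_cast]
    calc |c j| * (j * |y| ^ (j - 1)) ≤ M / (j.factorial : ℝ) * (j * R ^ (j - 1)) := by
          gcongr
          exact hc j
      _ = _ := by simp only [u]; ring

/-- The entire function `E n z = ∑ z ^ j / (j! (j + n)!)`, in terms of which
`J_n x = (x / 2) ^ n * E n (- x ^ 2 / 4)` and `I_n x = (x / 2) ^ n * E n (x ^ 2 / 4)`. -/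
noncomputable def besselE (n : ℕ) (z : ℝ) : ℝ :=
  ∑' j : ℕ, 1 / ((j.factorial : ℝ) * ((j + n).factorial : ℝ)) * z ^ j

theorem abs_besselE_coeff_le (n j : ℕ) :
    |1 / ((j.factorial : ℝ) * ((j + n).factorial : ℝ))| ≤ 1 / (j.factorial : ℝ) := by
  have h1 : (1 : ℝ) ≤ ((j + n).factorial : ℝ) := by exact_mod_cast Nat.succ_le_of_lt (Nat.factorial_pos _)
  have h2 : (0 : ℝ) < (j.factorial : ℝ) := by exact_mod_cast Nat.factorial_pos _
  rw [abs_of_nonneg (by positivity)]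
  gcongr
  nlinarith

theorem summable_besselE (n : ℕ) (z : ℝ) :
    Summable fun j : ℕ => 1 / ((j.factorial : ℝ) * ((j + n).factorial : ℝ)) * z ^ j :=
  summable_mul_pow_of_abs_le_div_factorial (abs_besselE_coeff_le n) z

theorem hasDerivAt_besselE (n : ℕ) (z : ℝ) : HasDerivAt (besselE n) (besselE (n + 1) z) z := by
  refine hasDerivAt_of_eq (hasDerivAt_tsum_mul_pow (abs_besselE_coeff_le n) z) (fun _ => rfl) ?_
  refine tsum_congr fun j => ?_
  rw [show j + 1 + n = j + (n + 1) by ring, Nat.factorial_succ j]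
  push_cast
  field_simp

theorem continuous_besselE (n : ℕ) : Continuous (besselE n) :=
  continuous_iff_continuousAt.2 fun z => (hasDerivAt_besselE n z).continuousAt

/-- This coefficient identity yields (z E₁)' = E₀. Together with E₀' = E₁ it is Bessel's equation as
a first-order system, the source of all derivative formulas for I and J. -/
theorem besselE_zero_eq (z : ℝ) : besselE 0 z = besselE 1 z + z * besselE 2 z := by
  unfold besselE
  rw [← tsum_mul_left, Summable.tsum_eq_zero_add (summable_besselE 0 z),
    Summable.tsum_eq_zero_add (summable_besselE 1 z), add_assoc]
  refine congrArg₂ (· + ·) (by simp) ?_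
  rw [← Summable.tsum_add]
  · refine tsum_congr fun j => ?_
    rw [show j + 1 + 0 = j + 1 by ring, show j + 1 + 1 = j + 2 by ring, Nat.factorial_succ (j + 1),
      Nat.factorial_succ j]
    push_cast
    field_simp
    ring
  · exact (summable_nat_add_iff (f := fun j : ℕ =>
      1 / ((j.factorial : ℝ) * ((j + 1).factorial : ℝ)) * z ^ j) 1).2 (summable_besselE 1 z)
  · exact (summable_besselE 2 z).mul_left z

theorem hasDerivAt_mul_besselE_one (z : ℝ) :
    HasDerivAt (fun z => z * besselE 1 z) (besselE 0 z) z := by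
  refine hasDerivAt_of_eq ((hasDerivAt_id z).mul (hasDerivAt_besselE 1 z)) (fun _ => rfl) ?_
  rw [besselE_zero_eq]
  simp

theorem besselE_at_zero : besselE 0 0 = 1 := by
  unfold besselE
  rw [tsum_eq_single 0 (fun j hj => by simp [hj])]
  simp

theorem besselE_pos (n : ℕ) {z : ℝ} (hz : 0 ≤ z) : 0 < besselE n z :=
  (summable_besselE n z).tsum_pos (fun j => by positivity) 0 (by simp; positivity)

theorem besselJ_eq (n : ℕ) (x : ℝ) : besselJ n x = (x / 2) ^ n * besselE n (-(x ^ 2 / 4)) := by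
  unfold besselJ besselE
  rw [← tsum_mul_left]
  refine tsum_congr fun j => ?_
  rw [show -(x ^ 2 / 4) = (-1) * (x / 2) ^ 2 by ring, mul_pow, ← pow_mul, pow_add]
  field_simp

/-- The modified Bessel function of the first kind `I_n`. -/
noncomputable def besselI (n : ℕ) (x : ℝ) : ℝ := (x / 2) ^ n * besselE n (x ^ 2 / 4)

theorem hasDerivAt_besselI_zero (x : ℝ) : HasDerivAt (besselI 0) (besselI 1 x) x := by
  have h : HasDerivAt (fun x : ℝ => x ^ 2 / 4) (x / 2) x := by
    refine ((hasDerivAt_pow 2 x).div_const 4).congr_deriv ?_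
    ring
  refine hasDerivAt_of_eq ((hasDerivAt_besselE 0 (x ^ 2 / 4)).comp x h) (fun y => ?_) ?_
  · simp [besselI]
  · simp [besselI]; ring

theorem hasDerivAt_mul_besselI_one (x : ℝ) :
    HasDerivAt (fun x => x * besselI 1 x) (x * besselI 0 x) x := by
  have h : HasDerivAt (fun x : ℝ => x ^ 2 / 4) (x / 2) x := by
    refine ((hasDerivAt_pow 2 x).div_const 4).congr_deriv ?_
    ring
  refine hasDerivAt_of_eq (((hasDerivAt_mul_besselE_one (x ^ 2 / 4)).comp x h).const_mul 2) (fun y => ?_) ?_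
  · simp [besselI]; ring
  · simp [besselI]; ring

theorem hasDerivAt_besselJ_zero (x : ℝ) : HasDerivAt (besselJ 0) (-besselJ 1 x) x := by
  have h : HasDerivAt (fun x : ℝ => -(x ^ 2 / 4)) (-(x / 2)) x := by
    refine ((hasDerivAt_pow 2 x).div_const 4).neg.congr_deriv ?_
    ring
  refine hasDerivAt_of_eq ((hasDerivAt_besselE 0 (-(x ^ 2 / 4))).comp x h) (fun y => ?_) ?_
  · simp [besselJ_eq]
  · simp [besselJ_eq]; ring

theorem hasDerivAt_mul_besselJ_one (x : ℝ) :
    HasDerivAt (fun x => x * besselJ 1 x) (x * besselJ 0 x) x := by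
  have h : HasDerivAt (fun x : ℝ => -(x ^ 2 / 4)) (-(x / 2)) x := by
    refine ((hasDerivAt_pow 2 x).div_const 4).neg.congr_deriv ?_
    ring
  refine hasDerivAt_of_eq (((hasDerivAt_mul_besselE_one (-(x ^ 2 / 4))).comp x h).const_mul (-2)) (fun y => ?_) ?_
  · simp [besselJ_eq]; ring
  · simp [besselJ_eq]; ring

theorem continuous_besselI (n : ℕ) : Continuous (besselI n) := by
  unfold besselI
  have := continuous_besselE n
  fun_prop

theorem continuous_besselJ (n : ℕ) : Continuous (besselJ n) := by
  have := continuous_besselE n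
  rw [show besselJ n = fun x => (x / 2) ^ n * besselE n (-(x ^ 2 / 4)) from funext (besselJ_eq n)]
  fun_prop

theorem besselI_zero_at_zero : besselI 0 0 = 1 := by simp [besselI, besselE_at_zero]

theorem besselI_one_at_zero : besselI 1 0 = 0 := by simp [besselI]

theorem besselI_zero_pos (x : ℝ) : 0 < besselI 0 x := by
  simpa [besselI] using besselE_pos 0 (by positivity : 0 ≤ x ^ 2 / 4)

theorem besselI_pos (n : ℕ) {x : ℝ} (hx : 0 < x) : 0 < besselI n x := by
  have := besselE_pos n (by positivity : 0 ≤ x ^ 2 / 4)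
  unfold besselI
  positivity

/-- The power series `∑ H_j z ^ j / j! ^ 2` entering the expansion of `K₀` at the origin. -/
noncomputable def besselP (z : ℝ) : ℝ :=
  ∑' j : ℕ, (harmonic j : ℝ) / ((j.factorial : ℝ) * (j.factorial : ℝ)) * z ^ j

/-- The derivative of `besselP`. -/
noncomputable def besselQ (z : ℝ) : ℝ :=
  ∑' j : ℕ, (harmonic (j + 1) : ℝ) / ((j.factorial : ℝ) * ((j + 1).factorial : ℝ)) * z ^ j

theorem harmonic_nonneg' (j : ℕ) : (0 : ℝ) ≤ (harmonic j : ℝ) := by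
  have : (0 : ℚ) ≤ harmonic j := Finset.sum_nonneg fun i _ => by positivity
  exact_mod_cast this

theorem harmonic_le_self (j : ℕ) : (harmonic j : ℝ) ≤ j := by
  induction j with
  | zero => simp
  | succ n ih =>
    rw [harmonic_succ]
    push_cast
    have : ((n : ℝ) + 1)⁻¹ ≤ 1 := inv_le_one_of_one_le₀ (by linarith [Nat.cast_nonneg (α := ℝ) n])
    linarith

theorem harmonic_le_factorial (j : ℕ) : (harmonic j : ℝ) ≤ (j.factorial : ℝ) :=
  (harmonic_le_self j).trans (by exact_mod_cast Nat.self_le_factorial j)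

theorem abs_besselP_coeff_le (j : ℕ) :
    |(harmonic j : ℝ) / ((j.factorial : ℝ) * (j.factorial : ℝ))| ≤ 1 / (j.factorial : ℝ) := by
  have h2 : (0 : ℝ) < (j.factorial : ℝ) := by exact_mod_cast Nat.factorial_pos _
  have := harmonic_nonneg' j
  rw [abs_of_nonneg (by positivity), div_le_div_iff₀ (by positivity) h2]
  nlinarith [harmonic_le_factorial j, mul_pos h2 h2]

theorem abs_besselQ_coeff_le (j : ℕ) :
    |(harmonic (j + 1) : ℝ) / ((j.factorial : ℝ) * ((j + 1).factorial : ℝ))|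
      ≤ 1 / (j.factorial : ℝ) := by
  have h2 : (0 : ℝ) < (j.factorial : ℝ) := by exact_mod_cast Nat.factorial_pos _
  have h3 : (0 : ℝ) < ((j + 1).factorial : ℝ) := by exact_mod_cast Nat.factorial_pos _
  have := harmonic_nonneg' (j + 1)
  rw [abs_of_nonneg (by positivity), div_le_div_iff₀ (by positivity) h2]
  nlinarith [harmonic_le_factorial (j + 1), mul_pos h2 h3]

theorem summable_besselP (z : ℝ) : Summable fun j : ℕ =>
    (harmonic j : ℝ) / ((j.factorial : ℝ) * (j.factorial : ℝ)) * z ^ j :=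
  summable_mul_pow_of_abs_le_div_factorial abs_besselP_coeff_le z

theorem hasDerivAt_besselP (z : ℝ) : HasDerivAt besselP (besselQ z) z := by
  refine hasDerivAt_of_eq (hasDerivAt_tsum_mul_pow abs_besselP_coeff_le z) (fun _ => rfl) ?_
  refine tsum_congr fun j => ?_
  rw [Nat.factorial_succ j]
  push_cast
  field_simp

/-- The inhomogeneous term E₁ comes from H_{j+1} = H_j + 1/(j+1). It is what later cancels against
the logarithm in the expansion of K₀. -/
theorem hasDerivAt_mul_besselQ (z : ℝ) :
    HasDerivAt (fun z => z * besselQ z) (besselP z + besselE 1 z) z := by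
  refine hasDerivAt_of_eq ((hasDerivAt_id z).mul (hasDerivAt_tsum_mul_pow abs_besselQ_coeff_le z))
    (fun _ => rfl) ?_
  change _ = 1 * besselQ z + z * _
  unfold besselP besselE besselQ
  have hQ := summable_mul_pow_of_abs_le_div_factorial abs_besselQ_coeff_le z
  rw [one_mul, ← tsum_mul_left, ← (summable_besselP z).tsum_add (summable_besselE 1 z),
    Summable.tsum_eq_zero_add ((summable_besselP z).add (summable_besselE 1 z)),
    hQ.tsum_eq_zero_add]
  conv_rhs => rw [add_assoc]
  refine congrArg₂ (· + ·) (by simp) ?_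
  rw [← Summable.tsum_add]
  · refine tsum_congr fun j => ?_
    rw [harmonic_succ (j + 1), show j + 1 + 1 = j + 2 by ring, Nat.factorial_succ (j + 1),
      Nat.factorial_succ j]
    push_cast
    have : (j : ℝ) + 1 + 1 ≠ 0 := by positivity
    field_simp
    ring
  · exact (summable_nat_add_iff (f := fun j : ℕ =>
      (harmonic (j + 1) : ℝ) / ((j.factorial : ℝ) * ((j + 1).factorial : ℝ)) * z ^ j) 1).2 hQ
  · refine Summable.mul_left z (Summable.of_norm_bounded (Real.summable_pow_div_factorial |z|) fun j => ?_)
    have h := harmonic_nonneg' (j + 1 + 1)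
    have h' := harmonic_le_factorial (j + 1 + 1)
    have h2 : (0 : ℝ) < (j.factorial : ℝ) := by exact_mod_cast Nat.factorial_pos _
    have h3 : (0 : ℝ) < ((j + 1 + 1).factorial : ℝ) := by exact_mod_cast Nat.factorial_pos _
    rw [norm_mul, norm_pow, Real.norm_eq_abs, Real.norm_eq_abs, abs_of_nonneg (by positivity),
      mul_div_assoc', div_mul_eq_mul_div, Nat.factorial_succ j, div_le_div_iff₀ (by positivity) h2]
    push_cast
    have : 0 ≤ |z| ^ j * ((j : ℝ) + 1) * j.factorial := by positivity
    nlinarith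

/-! ### The modified Bessel functions of the second kind -/

-- Half of the exponent absorbs the power through yⁿ ≤ n! exp y with y = (x/2) cosh t. The other
-- half decays because t ≤ cosh t.
open Set Filter Topology in
theorem exp_neg_mul_cosh_mul_pow_le (n : ℕ) {x t : ℝ} (hx : 0 < x) (ht : 0 ≤ t) :
    Real.exp (-x * Real.cosh t) * Real.cosh t ^ n ≤
      n.factorial * (2 / x) ^ n * Real.exp (-(x / 2) * t) := by
  have h1 : t ≤ Real.cosh t := by
    have := Real.one_le_cosh t
    have h2 : t ≤ Real.sinh t := by simpa using ht
    nlinarith [Real.cosh_sq t, Real.sinh_lt_cosh t]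
  have hc : 0 < Real.cosh t := Real.cosh_pos t
  have h3 := Real.pow_div_factorial_le_exp (x / 2 * Real.cosh t) (by positivity) n
  have h4 : Real.cosh t ^ n ≤ n.factorial * (2 / x) ^ n * Real.exp (x / 2 * Real.cosh t) := by
    rw [div_le_iff₀ (by positivity)] at h3
    calc Real.cosh t ^ n = (2 / x) ^ n * (x / 2 * Real.cosh t) ^ n := by
          rw [← mul_pow]; congr 1; field_simp
      _ ≤ (2 / x) ^ n * (Real.exp (x / 2 * Real.cosh t) * n.factorial) := by gcongr
      _ = _ := by ring
  calc Real.exp (-x * Real.cosh t) * Real.cosh t ^ n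
      ≤ Real.exp (-x * Real.cosh t) * (n.factorial * (2 / x) ^ n * Real.exp (x / 2 * Real.cosh t)) := by
        gcongr
    _ = n.factorial * (2 / x) ^ n * Real.exp (-(x / 2) * Real.cosh t) := by
        rw [mul_comm, mul_assoc, ← Real.exp_add]; congr 2; ring
    _ ≤ _ := by
        gcongr ?_ * Real.exp ?_
        nlinarith

theorem integrableOn_exp_neg_mul_cosh_mul_pow (n : ℕ) {x : ℝ} (hx : 0 < x) :
    IntegrableOn (fun t => Real.exp (-x * Real.cosh t) * Real.cosh t ^ n) (Set.Ioi 0) := by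
  refine Integrable.mono' ((exp_neg_integrableOn_Ioi 0 (by positivity : 0 < x / 2)).const_mul
    (n.factorial * (2 / x) ^ n)) (by fun_prop) ?_
  refine (ae_restrict_iff' measurableSet_Ioi).2 (.of_forall fun t ht => ?_)
  rw [Real.norm_of_nonneg (by have := Real.cosh_pos t; positivity)]
  exact exp_neg_mul_cosh_mul_pow_le n hx (Set.mem_Ioi.1 ht).le

/-- The integrals `∫ exp (- x cosh t) (cosh t) ^ n`, iterated derivatives of `K₀` up to sign. -/
noncomputable def coshMoment (n : ℕ) (x : ℝ) : ℝ :=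
  ∫ t in Set.Ioi (0 : ℝ), Real.exp (-x * Real.cosh t) * Real.cosh t ^ n

theorem besselK_zero_eq : besselK 0 = coshMoment 0 := by
  ext x; simp [besselK, coshMoment]

theorem besselK_one_eq : besselK 1 = coshMoment 1 := by
  ext x; simp [besselK, coshMoment]

theorem coshMoment_pos (n : ℕ) {x : ℝ} (hx : 0 < x) : 0 < coshMoment n x := by
  have hpos : ∀ t, 0 < Real.exp (-x * Real.cosh t) * Real.cosh t ^ n := fun t => by
    have := Real.cosh_pos t; positivity
  unfold coshMoment
  rw [setIntegral_pos_iff_support_of_nonneg_ae (.of_forall fun t => (hpos t).le)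
    (integrableOn_exp_neg_mul_cosh_mul_pow n hx)]
  have : Function.support (fun t => Real.exp (-x * Real.cosh t) * Real.cosh t ^ n) = Set.univ :=
    Set.eq_univ_of_forall fun t => (hpos t).ne'
  rw [this]; simp

theorem hasDerivAt_coshMoment (n : ℕ) {x : ℝ} (hx : 0 < x) :
    HasDerivAt (coshMoment n) (-coshMoment (n + 1) x) x := by
  have hs : Metric.ball x (x / 2) ∈ nhds x := Metric.ball_mem_nhds x (by positivity)
  have hb : ∀ y ∈ Metric.ball x (x / 2), x / 2 < y := fun y hy => by
    have := abs_lt.1 (Metric.mem_ball.1 hy); linarith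
  have := (hasDerivAt_integral_of_dominated_loc_of_deriv_le (μ := volume.restrict (Set.Ioi (0 : ℝ)))
    (F := fun x t => Real.exp (-x * Real.cosh t) * Real.cosh t ^ n)
    (F' := fun x t => -(Real.exp (-x * Real.cosh t) * Real.cosh t ^ (n + 1)))
    (bound := fun t => Real.exp (-(x / 2) * Real.cosh t) * Real.cosh t ^ (n + 1))
    hs (.of_forall fun y => by fun_prop) (integrableOn_exp_neg_mul_cosh_mul_pow n hx) (by fun_prop)
    (.of_forall fun t y hy => ?_) (integrableOn_exp_neg_mul_cosh_mul_pow (n + 1) (half_pos hx))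
    (.of_forall fun t y hy => ?_)).2
  · rw [integral_neg] at this
    exact this
  · have hc := Real.cosh_pos t
    rw [norm_neg, Real.norm_of_nonneg (by positivity)]
    have := hb y hy
    gcongr
  · have h : HasDerivAt (fun y => -y * Real.cosh t) (-1 * Real.cosh t) y :=
      (hasDerivAt_id y).neg.mul_const _
    refine hasDerivAt_of_eq (h.exp.mul_const (Real.cosh t ^ n)) (fun _ => rfl) ?_
    ring

open Set Filter Topology in
theorem tendsto_sinh_mul_exp_neg_mul_cosh {x : ℝ} (hx : 0 < x) :
    Tendsto (fun t => Real.sinh t * Real.exp (-x * Real.cosh t)) atTop (𝓝 0) := by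
  have h1 : Tendsto (fun t => Nat.factorial 1 * (2 / x) ^ 1 * Real.exp (-(x / 2) * t)) atTop (𝓝 0) := by
    rw [show (0 : ℝ) = Nat.factorial 1 * (2 / x) ^ 1 * 0 by ring]
    refine Tendsto.const_mul _ (Real.tendsto_exp_atBot.comp ?_)
    exact tendsto_id.const_mul_atTop_of_neg (by linarith : -(x / 2) < 0)
  refine squeeze_zero' ?_ ?_ h1
  · filter_upwards [eventually_ge_atTop 0] with t ht
    have := Real.sinh_nonneg_iff.2 ht
    positivity
  · filter_upwards [eventually_ge_atTop 0] with t ht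
    refine le_trans ?_ (exp_neg_mul_cosh_mul_pow_le 1 hx ht)
    rw [pow_one, mul_comm]
    gcongr
    exact (Real.sinh_lt_cosh t).le

theorem hasDerivAt_exp_neg_mul_cosh (x t : ℝ) :
    HasDerivAt (fun t => Real.exp (-x * Real.cosh t))
      (Real.exp (-x * Real.cosh t) * (-x * Real.sinh t)) t :=
  ((Real.hasDerivAt_cosh t).const_mul (-x)).exp

/-- Integrate the derivative of sinh t · exp(-x cosh t), which vanishes at both ends. This
recurrence turns the second moment in K₁' into K₀ and K₁/x. -/
theorem coshMoment_one_eq {x : ℝ} (hx : 0 < x) :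
    coshMoment 1 x = x * (coshMoment 2 x - coshMoment 0 x) := by
  have hi := fun n => integrableOn_exp_neg_mul_cosh_mul_pow n hx
  have hs : IntegrableOn (fun t => x * (Real.exp (-x * Real.cosh t) * Real.cosh t ^ 2
      - Real.exp (-x * Real.cosh t) * Real.cosh t ^ 0)) (Set.Ioi 0) :=
    ((hi 2).sub (hi 0)).const_mul x
  have h := integral_Ioi_of_hasDerivAt_of_tendsto' (a := 0)
    (f := fun t => Real.sinh t * Real.exp (-x * Real.cosh t))
    (f' := fun t => Real.exp (-x * Real.cosh t) * Real.cosh t ^ 1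
      - x * (Real.exp (-x * Real.cosh t) * Real.cosh t ^ 2 - Real.exp (-x * Real.cosh t) * Real.cosh t ^ 0))
    (fun t _ => ?_) ((hi 1).sub hs)
    (tendsto_sinh_mul_exp_neg_mul_cosh hx)
  · rw [integral_sub (hi 1) hs, integral_const_mul,
      integral_sub (hi 2) (hi 0)] at h
    simp only [Real.sinh_zero, zero_mul, sub_zero] at h
    unfold coshMoment
    linarith
  · refine hasDerivAt_of_eq ((Real.hasDerivAt_sinh t).mul (hasDerivAt_exp_neg_mul_cosh x t))
      (fun _ => rfl) ?_
    linear_combination (-(x * Real.exp (-x * Real.cosh t))) * Real.cosh_sq t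

theorem hasDerivAt_besselK_zero {x : ℝ} (hx : 0 < x) :
    HasDerivAt (besselK 0) (-besselK 1 x) x := by
  rw [besselK_zero_eq, besselK_one_eq]
  exact hasDerivAt_coshMoment 0 hx

theorem hasDerivAt_besselK_one {x : ℝ} (hx : 0 < x) :
    HasDerivAt (besselK 1) (-besselK 0 x - besselK 1 x / x) x := by
  have h := hasDerivAt_coshMoment 1 hx
  rw [besselK_zero_eq, besselK_one_eq]
  refine h.congr_deriv ?_
  have := coshMoment_one_eq hx
  field_simp
  linarith

theorem hasDerivAt_mul_besselK_one {x : ℝ} (hx : 0 < x) :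
    HasDerivAt (fun x => x * besselK 1 x) (-(x * besselK 0 x)) x := by
  refine hasDerivAt_of_eq ((hasDerivAt_id x).mul (hasDerivAt_besselK_one hx)) (fun _ => rfl) ?_
  simp only [id]
  field_simp
  ring

theorem besselK_zero_pos {x : ℝ} (hx : 0 < x) : 0 < besselK 0 x := by
  rw [besselK_zero_eq]; exact coshMoment_pos 0 hx

theorem besselK_one_pos {x : ℝ} (hx : 0 < x) : 0 < besselK 1 x := by
  rw [besselK_one_eq]; exact coshMoment_pos 1 hx

theorem besselK_zero_lt_one {x : ℝ} (hx : 0 < x) : besselK 0 x < besselK 1 x := by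
  have hi := fun n => integrableOn_exp_neg_mul_cosh_mul_pow n hx
  rw [← sub_pos, besselK_zero_eq, besselK_one_eq]
  unfold coshMoment
  have hs : IntegrableOn (fun t => Real.exp (-x * Real.cosh t) * Real.cosh t ^ 1
      - Real.exp (-x * Real.cosh t) * Real.cosh t ^ 0) (Set.Ioi 0) := (hi 1).sub (hi 0)
  rw [← integral_sub (hi 1) (hi 0),
    setIntegral_pos_iff_support_of_nonneg_ae (.of_forall fun t => ?_) hs]
  · refine lt_of_lt_of_le ?_ (measure_mono (s := Set.Ioi (0 : ℝ)) fun t ht => ⟨?_, ht⟩)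
    · simp
    · have : 1 < Real.cosh t := Real.one_lt_cosh.2 (ne_of_gt (Set.mem_Ioi.1 ht))
      have h := Real.exp_pos (-x * Real.cosh t)
      have : 0 < Real.exp (-x * Real.cosh t) * Real.cosh t ^ 1
        - Real.exp (-x * Real.cosh t) * Real.cosh t ^ 0 := by
        nlinarith
      exact this.ne'
  · have := Real.one_le_cosh t
    have h := Real.exp_pos (-x * Real.cosh t)
    simp only [Pi.zero_apply]
    nlinarith

/-- Since cosh t ≥ 1, the factor exp(-h cosh t) is at most exp(-h). All exponential decay of modes
and overlaps goes back to this. -/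
theorem coshMoment_add_le (n : ℕ) {x h : ℝ} (hx : 0 < x) (hh : 0 ≤ h) :
    coshMoment n (x + h) ≤ Real.exp (-h) * coshMoment n x := by
  unfold coshMoment
  rw [← integral_const_mul]
  refine integral_mono (integrableOn_exp_neg_mul_cosh_mul_pow n (by linarith))
    ((integrableOn_exp_neg_mul_cosh_mul_pow n hx).const_mul _) fun t => ?_
  have hc := Real.one_le_cosh t
  simp only
  rw [← mul_assoc, ← Real.exp_add]
  gcongr
  nlinarith

theorem coshMoment_antitone (n : ℕ) {x y : ℝ} (hx : 0 < x) (hxy : x ≤ y) :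
    coshMoment n y ≤ coshMoment n x := by
  have h := coshMoment_add_le n hx (sub_nonneg.2 hxy)
  have h1 : Real.exp (-(y - x)) ≤ 1 := Real.exp_le_one_iff.2 (by linarith)
  have := coshMoment_pos n hx
  rw [add_sub_cancel] at h
  nlinarith

theorem besselK_zero_antitone {x y : ℝ} (hx : 0 < x) (hxy : x ≤ y) :
    besselK 0 y ≤ besselK 0 x := by
  rw [besselK_zero_eq]; exact coshMoment_antitone 0 hx hxy

theorem besselK_one_antitone {x y : ℝ} (hx : 0 < x) (hxy : x ≤ y) :
    besselK 1 y ≤ besselK 1 x := by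
  rw [besselK_one_eq]; exact coshMoment_antitone 1 hx hxy

theorem besselK_zero_add_le {x h : ℝ} (hx : 0 < x) (hh : 0 ≤ h) :
    besselK 0 (x + h) ≤ Real.exp (-h) * besselK 0 x := by
  rw [besselK_zero_eq]; exact coshMoment_add_le 0 hx hh

theorem besselK_one_add_le {x h : ℝ} (hx : 0 < x) (hh : 0 ≤ h) :
    besselK 1 (x + h) ≤ Real.exp (-h) * besselK 1 x := by
  rw [besselK_one_eq]; exact coshMoment_add_le 1 hx hh

open Filter in
theorem tendsto_cosh_atTop : Tendsto Real.cosh atTop atTop := by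
  refine tendsto_atTop_mono (fun t => ?_) (Real.tendsto_exp_atTop.atTop_div_const two_pos)
  rw [Real.cosh_eq]
  have := Real.exp_pos (-t)
  linarith

-- With sinh in place of cosh the integrand of x K₁(x) is exact. As 0 ≤ cosh t - sinh t = exp(-t),
-- the replacement costs at most x, which gives x K₁(x) → 1 at the origin.
open Set Filter Topology in
theorem integral_sinh_mul_exp_neg_mul_cosh {x : ℝ} (hx : 0 < x) :
    IntegrableOn (fun t => Real.exp (-x * Real.cosh t) * (x * Real.sinh t)) (Ioi 0) ∧
    ∫ t in Ioi (0 : ℝ), Real.exp (-x * Real.cosh t) * (x * Real.sinh t) = Real.exp (-x) := by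
  have h0 : IntegrableOn (fun t => Real.exp (-x * Real.cosh t) * (x * Real.sinh t)) (Ioi 0) := by
    refine Integrable.mono' ((integrableOn_exp_neg_mul_cosh_mul_pow 1 hx).const_mul x)
      (by fun_prop) ?_
    refine (ae_restrict_iff' measurableSet_Ioi).2 (.of_forall fun t ht => ?_)
    have hs := Real.sinh_nonneg_iff.2 (Set.mem_Ioi.1 ht).le
    rw [Real.norm_of_nonneg (by positivity), pow_one, mul_left_comm]
    gcongr
    exact (Real.sinh_lt_cosh t).le
  refine ⟨h0, ?_⟩
  have ht : Tendsto (fun t => -Real.exp (-x * Real.cosh t)) atTop (𝓝 0) := by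
    rw [← neg_zero]
    refine Tendsto.neg (Real.tendsto_exp_atBot.comp ?_)
    exact tendsto_cosh_atTop.const_mul_atTop_of_neg (by linarith : -x < 0)
  have h := integral_Ioi_of_hasDerivAt_of_tendsto' (a := 0)
    (f := fun t => -Real.exp (-x * Real.cosh t)) 
    (f' := fun t => Real.exp (-x * Real.cosh t) * (x * Real.sinh t))
    (fun t _ => ?_) h0 ht
  · rw [h]; simp
  · refine hasDerivAt_of_eq (hasDerivAt_exp_neg_mul_cosh x t).neg (fun _ => rfl) ?_
    ring

theorem exp_neg_le_mul_besselK_one {x : ℝ} (hx : 0 < x) : Real.exp (-x) ≤ x * besselK 1 x := by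
  obtain ⟨h0, h1⟩ := integral_sinh_mul_exp_neg_mul_cosh hx
  rw [← h1, besselK_one_eq, coshMoment, ← integral_const_mul]
  refine integral_mono h0 ((integrableOn_exp_neg_mul_cosh_mul_pow 1 hx).const_mul x) fun t => ?_
  simp only
  rw [pow_one, mul_left_comm]
  gcongr
  exact (Real.sinh_lt_cosh t).le

theorem mul_besselK_one_le {x : ℝ} (hx : 0 < x) : x * besselK 1 x ≤ Real.exp (-x) + x := by
  obtain ⟨h0, h1⟩ := integral_sinh_mul_exp_neg_mul_cosh hx
  have h2 : IntegrableOn (fun t => x * Real.exp (-t)) (Set.Ioi 0) := by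
    simpa [IntegrableOn] using (exp_neg_integrableOn_Ioi 0 one_pos).const_mul x
  have h3 : ∫ t in Set.Ioi (0 : ℝ), x * Real.exp (-t) = x := by
    rw [integral_const_mul, integral_exp_neg_Ioi]; simp
  rw [← h1]
  conv_rhs => arg 2; rw [← h3]
  rw [besselK_one_eq, coshMoment, ← integral_const_mul, ← integral_add h0 h2]
  refine integral_mono ((integrableOn_exp_neg_mul_cosh_mul_pow 1 hx).const_mul x) (h0.add h2)
    fun t => ?_
  simp only
  have h4 : Real.cosh t = Real.sinh t + Real.exp (-t) := by
    rw [Real.cosh_eq, Real.sinh_eq]; ring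
  have h5 : Real.exp (-x * Real.cosh t) ≤ 1 :=
    Real.exp_le_one_iff.2 (by nlinarith [Real.cosh_pos t])
  have h6 : 0 ≤ x * Real.exp (-t) := by positivity
  have h7 : Real.exp (-x * Real.cosh t) * (x * Real.exp (-t)) ≤ x * Real.exp (-t) :=
    mul_le_of_le_one_left h6 h5
  calc x * (Real.exp (-x * Real.cosh t) * Real.cosh t ^ 1)
      = Real.exp (-x * Real.cosh t) * (x * Real.sinh t)
        + Real.exp (-x * Real.cosh t) * (x * Real.exp (-t)) := by
        rw [pow_one]; nth_rewrite 2 [h4]; ring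
    _ ≤ _ := by linarith

open Filter Topology in
theorem tendsto_mul_besselK_one : Tendsto (fun x => x * besselK 1 x) (𝓝[>] 0) (𝓝 1) := by
  have h1 : Tendsto (fun x : ℝ => Real.exp (-x)) (𝓝[>] 0) (𝓝 1) := by
    have : Continuous fun x : ℝ => Real.exp (-x) := by fun_prop
    simpa using this.continuousWithinAt (s := Set.Ioi 0) (x := 0) |>.tendsto
  have h2 : Tendsto (fun x : ℝ => Real.exp (-x) + x) (𝓝[>] 0) (𝓝 1) := by
    have : Continuous fun x : ℝ => Real.exp (-x) + x := by fun_prop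
    simpa using this.continuousWithinAt (s := Set.Ioi 0) (x := 0) |>.tendsto
  refine tendsto_of_tendsto_of_tendsto_of_le_of_le' h1 h2 ?_ ?_
  · filter_upwards [self_mem_nhdsWithin] with x hx using exp_neg_le_mul_besselK_one hx
  · filter_upwards [self_mem_nhdsWithin] with x hx using mul_besselK_one_le hx

-- The crude comparison K₀ < K₁ is enough to see x² K₀(x) → 0; no logarithmic asymptotics are
-- required.
theorem mul_besselK_zero_le {x : ℝ} (hx : 0 < x) : x * besselK 0 x ≤ Real.exp (-x) + x :=
  (mul_le_mul_of_nonneg_left (besselK_zero_lt_one hx).le hx.le).trans (mul_besselK_one_le hx)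

open Filter Topology in
theorem tendsto_mul_sq_besselK_zero : Tendsto (fun x => x ^ 2 * besselK 0 x) (𝓝[>] 0) (𝓝 0) := by
  have h2 : Tendsto (fun x : ℝ => x * (Real.exp (-x) + x)) (𝓝[>] 0) (𝓝 0) := by
    have : Continuous fun x : ℝ => x * (Real.exp (-x) + x) := by fun_prop
    simpa using this.continuousWithinAt (s := Set.Ioi 0) (x := 0) |>.tendsto
  refine squeeze_zero' ?_ ?_ h2
  · filter_upwards [self_mem_nhdsWithin] with x hx
    have := besselK_zero_pos hx
    positivity
  · filter_upwards [self_mem_nhdsWithin] with x hx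
    have := mul_besselK_zero_le hx
    rw [pow_two, mul_assoc]
    exact mul_le_mul_of_nonneg_left this (le_of_lt hx)

/-! ### The Wronskian and the expansion of `K₀` at the origin -/

theorem eq_of_hasDerivAt_zero_of_pos {f : ℝ → ℝ} (hf : ∀ x, 0 < x → HasDerivAt f 0 x) {x y : ℝ}
    (hx : 0 < x) (hy : 0 < y) : f x = f y :=
  isOpen_Ioi.is_const_of_deriv_eq_zero (convex_Ioi (0 : ℝ)).isPreconnected
    (fun z hz => (hf z hz).differentiableAt.differentiableWithinAt)
    (fun z hz => (hf z hz).deriv) hx hy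

-- The left side times x has zero derivative on the half line, so it is constant. Its limit at 0+ is
-- I₀(0) · lim x K₁(x) = 1, because x I₁ K₀ is a bounded factor times x² K₀.
open Filter Topology in
theorem besselI_mul_besselK_add {x : ℝ} (hx : 0 < x) :
    besselI 0 x * besselK 1 x + besselI 1 x * besselK 0 x = 1 / x := by
  set f : ℝ → ℝ := fun x => besselI 0 x * (x * besselK 1 x) + x * besselI 1 x * besselK 0 x with hf
  have hd : ∀ x, 0 < x → HasDerivAt f 0 x := fun x hx => by
    refine hasDerivAt_of_eq (((hasDerivAt_besselI_zero x).mul (hasDerivAt_mul_besselK_one hx)).add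
      ((hasDerivAt_mul_besselI_one x).mul (hasDerivAt_besselK_zero hx))) (fun _ => rfl) ?_
    ring
  have h1 : Tendsto (besselI 0) (𝓝[>] 0) (𝓝 1) := by
    simpa [besselI_zero_at_zero] using
      ((continuous_besselI 0).continuousWithinAt (s := Set.Ioi 0) (x := 0)).tendsto
  have h2 : Tendsto (fun x => besselE 1 (x ^ 2 / 4) / 2) (𝓝[>] 0) (𝓝 (besselE 1 (0 ^ 2 / 4) / 2)) := by
    have : Continuous fun x : ℝ => besselE 1 (x ^ 2 / 4) / 2 := by
      have := continuous_besselE 1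
      fun_prop
    exact (this.continuousWithinAt (s := Set.Ioi 0) (x := 0)).tendsto
  have h3 : Tendsto f (𝓝[>] 0) (𝓝 1) := by
    have := (h1.mul tendsto_mul_besselK_one).add (h2.mul tendsto_mul_sq_besselK_zero)
    simp only [mul_one, mul_zero, add_zero] at this
    refine this.congr fun x => ?_
    simp only [hf, besselI]
    ring
  have h4 : Tendsto f (𝓝[>] 0) (𝓝 (f x)) := by
    refine tendsto_const_nhds.congr' ?_
    filter_upwards [self_mem_nhdsWithin] with y hy using eq_of_hasDerivAt_zero_of_pos hd hx hy
  have h5 := tendsto_nhds_unique h4 h3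
  rw [eq_div_iff hx.ne', ← h5]
  simp only [hf]
  ring

/-- The power series analogue of the Wronskian, between E₀ and P: the derivative cancels by the
first-order systems, and the value at 0 is 1. -/
theorem besselE_wronskian (z : ℝ) :
    besselE 0 z ^ 2 + 2 * (z * besselE 1 z) * besselP z - 2 * (z * besselQ z) * besselE 0 z = 1 := by
  have hd : ∀ z, HasDerivAt (fun z => besselE 0 z ^ 2 + 2 * (z * besselE 1 z) * besselP z
      - 2 * (z * besselQ z) * besselE 0 z) 0 z := fun z => by
    have h0 := hasDerivAt_besselE 0 z
    have h1 := (hasDerivAt_mul_besselE_one z).const_mul 2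
    have h2 := (hasDerivAt_mul_besselQ z).const_mul 2
    refine hasDerivAt_of_eq (((h0.pow 2).add (h1.mul (hasDerivAt_besselP z))).sub (h2.mul h0))
      (fun _ => rfl) ?_
    simp
    ring
  have := is_const_of_deriv_eq_zero (fun z => (hd z).differentiableAt) (fun z => (hd z).deriv) z 0
  simpa [besselE_at_zero] using this

/-- `K₀ x = (c - log x) I₀ x + P (x ^ 2 / 4)` with a constant `c`. -/
theorem exists_besselK_zero_eq : ∃ c : ℝ, ∀ x, 0 < x →
    besselK 0 x = (c - Real.log x) * besselI 0 x + besselP (x ^ 2 / 4) := by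
  -- By the two Wronskian identities (K₀ - P)/I₀ has derivative -1/x, so adding log x makes it
  -- constant.
  set f : ℝ → ℝ := fun x => (besselK 0 x - besselP (x ^ 2 / 4)) / besselI 0 x + Real.log x with hf
  have hd : ∀ x, 0 < x → HasDerivAt f 0 x := fun x hx => by
    have hs : HasDerivAt (fun x : ℝ => x ^ 2 / 4) (x / 2) x := by
      refine ((hasDerivAt_pow 2 x).div_const 4).congr_deriv ?_
      ring
    have hP : HasDerivAt (fun x => besselP (x ^ 2 / 4)) (besselQ (x ^ 2 / 4) * (x / 2)) x :=
      HasDerivAt.comp (h₂ := besselP) x (hasDerivAt_besselP _) hs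
    refine hasDerivAt_of_eq ((((hasDerivAt_besselK_zero hx).sub hP).div (hasDerivAt_besselI_zero x)
      (besselI_zero_pos x).ne').add (Real.hasDerivAt_log hx.ne')) (fun _ => rfl) ?_
    have h1 := besselI_mul_besselK_add hx
    have h2 := besselE_wronskian (x ^ 2 / 4)
    have h3 := besselI_zero_pos x
    have h4 : besselI 0 x = besselE 0 (x ^ 2 / 4) := by simp [besselI]
    have h5 : besselI 1 x = x / 2 * besselE 1 (x ^ 2 / 4) := by simp [besselI]
    rw [← h4] at h2
    rw [h5] at h1 ⊢
    field_simp at h1 h2 ⊢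
    simp only [Pi.sub_apply]
    linear_combination h1 - h2 / 2
  refine ⟨f 1, fun x hx => ?_⟩
  rw [← eq_of_hasDerivAt_zero_of_pos hd hx one_pos]
  have := besselI_zero_pos x
  simp only [hf]
  field_simp
  ring

/-! ### Circular means of `K₀` -/

theorem hasDerivAt_intervalIntegral_of_continuousOn {F F' : ℝ → ℝ → ℝ} {U : Set ℝ} (hU : IsOpen U)
    (hF : ∀ r ∈ U, ∀ θ, HasDerivAt (fun r => F r θ) (F' r θ) r)
    (hF' : ContinuousOn (Function.uncurry F') (U ×ˢ Set.univ))
    (hFc : ∀ r ∈ U, Continuous (F r)) {a b r₀ : ℝ} (hr₀ : r₀ ∈ U) :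
    HasDerivAt (fun r => ∫ θ in a..b, F r θ) (∫ θ in a..b, F' r₀ θ) r₀ := by
  obtain ⟨ε, hε, hεU⟩ := Metric.nhds_basis_closedBall.mem_iff.1 (hU.mem_nhds hr₀)
  have hK : IsCompact (Metric.closedBall r₀ ε ×ˢ Set.uIcc a b) :=
    (isCompact_closedBall r₀ ε).prod isCompact_uIcc
  obtain ⟨M, hM⟩ := hK.exists_bound_of_continuousOn
    (hF'.mono (Set.prod_mono hεU (Set.subset_univ _)))
  have hF'c : Continuous (F' r₀) := by
    rw [← continuousOn_univ]
    exact hF'.comp (f := fun θ => (r₀, θ)) (by fun_prop) fun θ _ => ⟨hr₀, Set.mem_univ _⟩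
  refine (intervalIntegral.hasDerivAt_integral_of_dominated_loc_of_deriv_le
    (bound := fun _ => M) (Metric.closedBall_mem_nhds r₀ hε) ?_ ((hFc r₀ hr₀).intervalIntegrable _ _)
    hF'c.aestronglyMeasurable ?_ (by simp) ?_).2
  · filter_upwards [hU.mem_nhds hr₀] with r hr using (hFc r hr).aestronglyMeasurable
  · exact .of_forall fun θ hθ r hr => hM (r, θ) ⟨hr, Set.uIoc_subset_uIcc hθ⟩
  · exact .of_forall fun θ _ r hr => hF r (hεU hr) θ

/-- `K₀ (√q)` as a function of `q`. -/
noncomputable def besselKSqrt (q : ℝ) : ℝ := besselK 0 (√q)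

/-- `K₁ (√q) / √q` as a function of `q`. -/
noncomputable def besselKSqrtOne (q : ℝ) : ℝ := besselK 1 (√q) / √q

theorem hasDerivAt_besselKSqrt {q : ℝ} (hq : 0 < q) :
    HasDerivAt besselKSqrt (-besselKSqrtOne q / 2) q := by
  have hs : 0 < √q := Real.sqrt_pos.2 hq
  refine hasDerivAt_of_eq (HasDerivAt.comp (h₂ := besselK 0) q (hasDerivAt_besselK_zero hs)
    (Real.hasDerivAt_sqrt hq.ne')) (fun _ => rfl) ?_
  unfold besselKSqrtOne
  field_simp

theorem hasDerivAt_besselKSqrtOne {q : ℝ} (hq : 0 < q) :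
    HasDerivAt besselKSqrtOne (-(besselKSqrt q / 2 + besselKSqrtOne q) / q) q := by
  have hs : 0 < √q := Real.sqrt_pos.2 hq
  have h2 : √q ^ 2 = q := Real.sq_sqrt hq.le
  refine hasDerivAt_of_eq ((HasDerivAt.comp (h₂ := besselK 1) q (hasDerivAt_besselK_one hs)
    (Real.hasDerivAt_sqrt hq.ne')).div (Real.hasDerivAt_sqrt hq.ne') hs.ne') (fun _ => rfl) ?_
  unfold besselKSqrtOne besselKSqrt
  simp only [Function.comp]
  generalize √q = s at *
  subst h2
  field_simp
  ring

/-- The squared distance from the origin-centred circle of radius `r`, at angle `θ`, to a point at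
distance `d` from the origin. -/
noncomputable def circleDistSq (d r θ : ℝ) : ℝ := d ^ 2 + r ^ 2 - 2 * d * r * Real.cos θ

theorem circleDistSq_ge (d r θ : ℝ) : (d - r) ^ 2 ≤ circleDistSq d r θ ∨
    (d + r) ^ 2 ≤ circleDistSq d r θ := by
  unfold circleDistSq
  have h1 := Real.cos_le_one θ
  have h2 := Real.neg_one_le_cos θ
  rcases le_total 0 (d * r) with h | h
  · left; nlinarith
  · right; nlinarith

theorem circleDistSq_pos {d r : ℝ} (hr : r ∈ Set.Ioo (-d) d) (θ : ℝ) : 0 < circleDistSq d r θ := by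
  rcases circleDistSq_ge d r θ with h | h
  · exact lt_of_lt_of_le (by have := hr.2; exact pow_pos (by linarith) 2) h
  · exact lt_of_lt_of_le (by have := hr.1; exact pow_pos (by linarith) 2) h

theorem hasDerivAt_circleDistSq (d r θ : ℝ) :
    HasDerivAt (fun r => circleDistSq d r θ) (2 * (r - d * Real.cos θ)) r := by
  have h1 : HasDerivAt (fun r : ℝ => 2 * d * r * Real.cos θ) (2 * d * Real.cos θ) r := by
    refine hasDerivAt_of_eq ((hasDerivAt_id r).const_mul (2 * d * Real.cos θ)) (fun y => ?_) ?_
    · simp only [id]; ring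
    · ring
  refine hasDerivAt_of_eq ((((hasDerivAt_pow 2 r).const_add (d ^ 2))).sub h1) (fun _ => rfl) ?_
  simp; ring

theorem hasDerivAt_circleDistSq_angle (d r θ : ℝ) :
    HasDerivAt (fun θ => circleDistSq d r θ) (2 * d * r * Real.sin θ) θ := by
  refine hasDerivAt_of_eq (((Real.hasDerivAt_cos θ).const_mul (2 * d * r)).const_sub (d ^ 2 + r ^ 2))
    (fun _ => rfl) ?_
  ring

theorem continuousOn_besselKSqrt : ContinuousOn besselKSqrt (Set.Ioi 0) := fun _ hq =>
  (hasDerivAt_besselKSqrt hq).continuousAt.continuousWithinAt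

theorem continuousOn_besselKSqrtOne : ContinuousOn besselKSqrtOne (Set.Ioi 0) := fun _ hq =>
  (hasDerivAt_besselKSqrtOne hq).continuousAt.continuousWithinAt

theorem continuousOn_circleDistSq (d : ℝ) :
    ContinuousOn (fun p : ℝ × ℝ => circleDistSq d p.1 p.2) (Set.Ioo (-d) d ×ˢ Set.univ) := by
  unfold circleDistSq
  fun_prop

/-- The circular mean m(r) inherits the modified Bessel equation (r m')' = r m from K₀ and is
regular at r = 0, so it equals m(0) I₀(r), and m(0) = 2πK₀(d). In the proof M = -m' and N = -r m'.
Working with K₀(√q) as a function of the squared distance q avoids differentiating the distance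
itself. -/
theorem integral_besselKSqrt_circleDistSq {d r : ℝ} (hr : r ∈ Set.Ioo (-d) d) :
    ∫ θ in -Real.pi..Real.pi, besselKSqrt (circleDistSq d r θ) =
      2 * Real.pi * (besselI 0 r * besselK 0 d) := by
  have hd : 0 < d := by have := hr.1.trans hr.2; linarith
  -- The interval is symmetric so that r = 0 is an interior point; regularity of the mean at the
  -- origin is then automatic.
  set U := Set.Ioo (-d) d
  have hU : IsOpen U := isOpen_Ioo
  have h0 : (0 : ℝ) ∈ U := ⟨by linarith, hd⟩
  have hQ : ∀ r ∈ U, ∀ θ, 0 < circleDistSq d r θ := fun r hr => circleDistSq_pos hr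
  have hQc := continuousOn_circleDistSq d
  have hmaps : Set.MapsTo (fun p : ℝ × ℝ => circleDistSq d p.1 p.2) (U ×ˢ Set.univ) (Set.Ioi 0) :=
    fun p hp => hQ p.1 hp.1 p.2
  have hc0 : ContinuousOn (fun p : ℝ × ℝ => besselKSqrt (circleDistSq d p.1 p.2))
      (U ×ˢ Set.univ) := continuousOn_besselKSqrt.comp hQc hmaps
  have hc1 : ContinuousOn (fun p : ℝ × ℝ => besselKSqrtOne (circleDistSq d p.1 p.2))
      (U ×ˢ Set.univ) := continuousOn_besselKSqrtOne.comp hQc hmaps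
  have hslice : ∀ {G : ℝ × ℝ → ℝ}, ContinuousOn G (U ×ˢ Set.univ) → ∀ r ∈ U,
      Continuous fun θ => G (r, θ) := fun {G} hG r hr => by
    rw [← continuousOn_univ]
    exact hG.comp (f := fun θ => (r, θ)) (by fun_prop) fun θ _ => ⟨hr, Set.mem_univ _⟩
  have hne : ∀ p ∈ U ×ˢ (Set.univ : Set ℝ), circleDistSq d p.1 p.2 ≠ 0 :=
    fun p hp => (hQ p.1 hp.1 p.2).ne'
  set m : ℝ → ℝ := fun r => ∫ θ in -Real.pi..Real.pi, besselKSqrt (circleDistSq d r θ) with hm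
  set M : ℝ → ℝ := fun r => ∫ θ in -Real.pi..Real.pi,
    besselKSqrtOne (circleDistSq d r θ) * (r - d * Real.cos θ) with hMdef
  set N : ℝ → ℝ := fun r => ∫ θ in -Real.pi..Real.pi,
    besselKSqrtOne (circleDistSq d r θ) * (r ^ 2 - d * r * Real.cos θ) with hN
  have hNM : ∀ r, N r = r * M r := fun r => by
    simp only [hN, hMdef]
    rw [← intervalIntegral.integral_const_mul]
    congr 1; ext θ; ring
  have hm' : ∀ r ∈ U, HasDerivAt m (-M r) r := fun r hr => by
    refine (hasDerivAt_intervalIntegral_of_continuousOn hU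
      (F := fun r θ => besselKSqrt (circleDistSq d r θ))
      (F' := fun r θ => -(besselKSqrtOne (circleDistSq d r θ) * (r - d * Real.cos θ)))
      (fun r hr θ => ?_) ?_ (hslice hc0) hr).congr_deriv ?_
    · refine hasDerivAt_of_eq (HasDerivAt.comp (h₂ := besselKSqrt) r
        (hasDerivAt_besselKSqrt (hQ r hr θ)) (hasDerivAt_circleDistSq d r θ)) (fun _ => rfl) ?_
      ring
    · exact (hc1.mul (by fun_prop)).neg
    · rw [intervalIntegral.integral_neg]
  have hN' : ∀ r ∈ U, HasDerivAt N (-(r * m r)) r := fun r hr => by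
    set F' : ℝ → ℝ → ℝ := fun r θ =>
      -(besselKSqrt (circleDistSq d r θ) / 2 + besselKSqrtOne (circleDistSq d r θ))
        / circleDistSq d r θ * (2 * (r - d * Real.cos θ)) * (r ^ 2 - d * r * Real.cos θ)
      + besselKSqrtOne (circleDistSq d r θ) * (2 * r - d * Real.cos θ) with hF'
    have hF'c : ContinuousOn (Function.uncurry F') (U ×ˢ Set.univ) := by
      refine ContinuousOn.add (ContinuousOn.mul (ContinuousOn.mul (ContinuousOn.div
        (ContinuousOn.neg (ContinuousOn.add (hc0.div_const 2) hc1)) hQc hne) ?_) ?_) (hc1.mul ?_)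
      all_goals fun_prop
    refine (hasDerivAt_intervalIntegral_of_continuousOn hU
      (F := fun r θ => besselKSqrtOne (circleDistSq d r θ) * (r ^ 2 - d * r * Real.cos θ))
      (F' := F') (fun r hr θ => ?_) hF'c (fun r hr => ?_) hr).congr_deriv ?_
    · have h1 : HasDerivAt (fun r => r ^ 2 - d * r * Real.cos θ) (2 * r - d * Real.cos θ) r := by
        have h2 : HasDerivAt (fun r : ℝ => d * r * Real.cos θ) (d * Real.cos θ) r := by
          refine hasDerivAt_of_eq ((hasDerivAt_id r).const_mul (d * Real.cos θ)) (fun y => ?_) ?_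
          · simp only [id]; ring
          · ring
        refine hasDerivAt_of_eq ((hasDerivAt_pow 2 r).sub h2) (fun _ => rfl) ?_
        simp
      exact (HasDerivAt.comp (h₂ := besselKSqrtOne) r (hasDerivAt_besselKSqrtOne (hQ r hr θ))
        (hasDerivAt_circleDistSq d r θ)).mul h1
    · exact (hslice hc1 r hr).mul (by fun_prop)
    -- G' is the θ-derivative of (K₁(√q)/√q) · d sin θ, so its integral over a full period vanishes.
    -- Adding it to F' makes the integrand equal to -r K₀(√q) pointwise.
    · set G' : ℝ → ℝ := fun θ =>
        -(besselKSqrt (circleDistSq d r θ) / 2 + besselKSqrtOne (circleDistSq d r θ))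
          / circleDistSq d r θ * (2 * d * r * Real.sin θ) * (d * Real.sin θ)
        + besselKSqrtOne (circleDistSq d r θ) * (d * Real.cos θ) with hG'
      have hcQ : Continuous fun θ => circleDistSq d r θ := hslice hQc r hr
      have hG'c : Continuous G' := by
        refine Continuous.add (Continuous.mul (Continuous.mul (Continuous.div (Continuous.neg
          (Continuous.add ((hslice hc0 r hr).div_const 2) (hslice hc1 r hr))) hcQ
          fun θ => (hQ r hr θ).ne') ?_) ?_) ((hslice hc1 r hr).mul ?_)
        all_goals fun_prop
      have hG : ∫ θ in -Real.pi..Real.pi, G' θ = 0 := by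
        rw [intervalIntegral.integral_eq_sub_of_hasDerivAt
          (f := fun θ => besselKSqrtOne (circleDistSq d r θ) * (d * Real.sin θ))
          (fun θ _ => ?_) (hG'c.intervalIntegrable _ _)]
        · simp
        · exact (HasDerivAt.comp (h₂ := besselKSqrtOne) θ (hasDerivAt_besselKSqrtOne (hQ r hr θ))
            (hasDerivAt_circleDistSq_angle d r θ)).mul ((Real.hasDerivAt_sin θ).const_mul d)
      have hF'r : Continuous fun θ => F' r θ := hslice hF'c r hr
      rw [← add_zero (∫ θ in -Real.pi..Real.pi, F' r θ), ← hG, ← intervalIntegral.integral_add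
        (hF'r.intervalIntegrable _ _) (hG'c.intervalIntegrable _ _), hm,
        ← intervalIntegral.integral_const_mul, ← intervalIntegral.integral_neg]
      congr 1; ext θ
      have h1 := (hQ r hr θ).ne'
      have h2 : (r - d * Real.cos θ) ^ 2 + (d * Real.sin θ) ^ 2 = circleDistSq d r θ := by
        unfold circleDistSq
        linear_combination d ^ 2 * Real.sin_sq_add_cos_sq θ
      simp only [hF', hG']
      field_simp
      linear_combination (-(besselKSqrt (circleDistSq d r θ)
        + 2 * besselKSqrtOne (circleDistSq d r θ)) * r) * h2
  -- Up to the factor -r this is the Wronskian of m and I₀. It vanishes at r = 0, hence everywhere,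
  -- so m/I₀ is constant.
  have hf' : ∀ r ∈ U, HasDerivAt (fun r => N r * besselI 0 r + m r * (r * besselI 1 r)) 0 r :=
    fun r hr => by
    refine hasDerivAt_of_eq (((hN' r hr).mul (hasDerivAt_besselI_zero r)).add
      ((hm' r hr).mul (hasDerivAt_mul_besselI_one r))) (fun _ => rfl) ?_
    rw [hNM]; ring
  have hf : ∀ r ∈ U, N r * besselI 0 r + m r * (r * besselI 1 r) = 0 := fun r hr => by
    have := hU.is_const_of_deriv_eq_zero (convex_Ioo (-d) d).isPreconnected
      (fun z hz => (hf' z hz).differentiableAt.differentiableWithinAt)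
      (fun z hz => (hf' z hz).deriv) hr h0
    simpa [hNM] using this
  have hg' : ∀ r ∈ U, HasDerivAt (fun r => m r / besselI 0 r) 0 r := fun r hr => by
    refine hasDerivAt_of_eq ((hm' r hr).div (hasDerivAt_besselI_zero r) (besselI_zero_pos r).ne')
      (fun _ => rfl) ?_
    have : M r * besselI 0 r + m r * besselI 1 r = 0 := by
      -- Dividing by r fails at the origin; there M vanishes because cos integrates to zero and
      -- I₁(0) = 0.
      rcases eq_or_ne r 0 with rfl | hr0
      · simp [hMdef, circleDistSq, besselI_one_at_zero]
      · have := hf r hr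
        rw [hNM] at this
        exact (mul_eq_zero.1 (by linear_combination this : r * _ = 0)).resolve_left hr0
    rw [eq_comm, div_eq_zero_iff]
    left; linear_combination -this
  have := hU.is_const_of_deriv_eq_zero (convex_Ioo (-d) d).isPreconnected
      (fun z hz => (hg' z hz).differentiableAt.differentiableWithinAt)
      (fun z hz => (hg' z hz).deriv) hr h0
  have hI := besselI_zero_pos r
  have hm0 : m 0 = 2 * Real.pi * besselK 0 d := by
    simp [hm, circleDistSq, besselKSqrt, Real.sqrt_sq hd.le]; ring_nf; simp
  simp only [besselI_zero_at_zero, div_one] at this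
  rw [div_eq_iff hI.ne', hm0] at this
  change m r = _
  rw [this]; ring

theorem integral_besselK_circle {g d r : ℝ} (hg : 0 < g) (hr : 0 ≤ r) (hrd : r < d) :
    ∫ θ in -Real.pi..Real.pi, besselK 0 (g * √(circleDistSq d r θ)) =
      2 * Real.pi * (besselI 0 (g * r) * besselK 0 (g * d)) := by
  have h : g * r ∈ Set.Ioo (-(g * d)) (g * d) :=
    ⟨by nlinarith [mul_pos hg (hr.trans_lt hrd)], by gcongr⟩
  rw [← integral_besselKSqrt_circleDistSq h]
  congr 1; ext θ
  rw [besselKSqrt, show circleDistSq (g * d) (g * r) θ = g ^ 2 * circleDistSq d r θ by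
    unfold circleDistSq; ring, Real.sqrt_mul (by positivity), Real.sqrt_sq hg.le]

/-! ### Integrals in polar coordinates -/

theorem integrable_iff_integrableOn_polarCoord {f : ℝ × ℝ → ℝ} (hf : Measurable f) :
    Integrable f ↔ IntegrableOn (fun p : ℝ × ℝ =>
      p.1 * f (p.1 * Real.cos p.2, p.1 * Real.sin p.2)) (Set.Ioi 0 ×ˢ Set.Ioo (-Real.pi) Real.pi) := by
  have hm : Measurable fun p : ℝ × ℝ => p.1 * f (p.1 * Real.cos p.2, p.1 * Real.sin p.2) :=
    measurable_fst.mul (hf.comp (by fun_prop))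
  rw [Integrable, IntegrableOn, Integrable, and_iff_right hf.aestronglyMeasurable,
    and_iff_right hm.aestronglyMeasurable, HasFiniteIntegral, HasFiniteIntegral,
    ← lintegral_comp_polarCoord_symm]
  have hs : MeasurableSet (Set.Ioi (0 : ℝ) ×ˢ Set.Ioo (-Real.pi) Real.pi) :=
    measurableSet_Ioi.prod measurableSet_Ioo
  have : ∫⁻ p in Set.Ioi (0 : ℝ) ×ˢ Set.Ioo (-Real.pi) Real.pi,
      ENNReal.ofReal p.1 • ‖f (polarCoord.symm p)‖ₑ = ∫⁻ p in Set.Ioi (0 : ℝ) ×ˢ Set.Ioo (-Real.pi) Real.pi,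
      ‖p.1 * f (p.1 * Real.cos p.2, p.1 * Real.sin p.2)‖ₑ := by
    refine setLIntegral_congr_fun hs fun p hp => ?_
    simp only [enorm_mul, smul_eq_mul, polarCoord_symm_apply]
    rw [Real.enorm_eq_ofReal (le_of_lt hp.1)]
  exact this ▸ Iff.rfl

/-- Nonnegativity of Φ makes the angular integral of |hΦ| equal to |h| m, so integrability in the
plane reduces to a one-dimensional test. The angular hypotheses are only almost everywhere in r, to
allow a circle that passes through a singularity of Φ. -/
theorem integrable_radial_mul {h m : ℝ → ℝ} {Φ : ℝ × ℝ → ℝ} (hh : Measurable h) (hΦ : Measurable Φ)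
    (hΦ0 : ∀ p, 0 ≤ Φ p)
    (hΦi : ∀ᵐ r ∂volume.restrict (Set.Ioi (0 : ℝ)), IntegrableOn
      (fun θ => Φ (r * Real.cos θ, r * Real.sin θ)) (Set.Ioo (-Real.pi) Real.pi))
    (hm : ∀ᵐ r ∂volume.restrict (Set.Ioi (0 : ℝ)),
      ∫ θ in Set.Ioo (-Real.pi) Real.pi, Φ (r * Real.cos θ, r * Real.sin θ) = m r)
    (hi : IntegrableOn (fun r => r * h r * m r) (Set.Ioi 0)) :
    Integrable (fun p : ℝ × ℝ => h (√(p.1 ^ 2 + p.2 ^ 2)) * Φ p) ∧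
      ∫ p : ℝ × ℝ, h (√(p.1 ^ 2 + p.2 ^ 2)) * Φ p = ∫ r in Set.Ioi 0, r * h r * m r := by
  have hrad : ∀ r > 0, ∀ θ, √((r * Real.cos θ) ^ 2 + (r * Real.sin θ) ^ 2) = r := fun r hr θ => by
    rw [show (r * Real.cos θ) ^ 2 + (r * Real.sin θ) ^ 2 = r ^ 2 by
      linear_combination r ^ 2 * Real.sin_sq_add_cos_sq θ, Real.sqrt_sq hr.le]
  set f : ℝ × ℝ → ℝ := fun p => h (√(p.1 ^ 2 + p.2 ^ 2)) * Φ p with hf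
  have hfm : Measurable f := (hh.comp (by fun_prop)).mul hΦ
  set G : ℝ × ℝ → ℝ := fun p => p.1 * f (p.1 * Real.cos p.2, p.1 * Real.sin p.2) with hG
  have hGm : Measurable G := measurable_fst.mul (hfm.comp (by fun_prop))
  have hG' : ∀ r > 0, ∀ θ, G (r, θ) = r * h r * Φ (r * Real.cos θ, r * Real.sin θ) :=
    fun r hr θ => by simp only [hG, hf, hrad r hr θ]; ring
  have hpos : ∀ᵐ r ∂volume.restrict (Set.Ioi (0 : ℝ)), 0 < r :=
    (ae_restrict_iff' measurableSet_Ioi).2 (.of_forall fun r hr => hr)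
  have hGi : IntegrableOn G (Set.Ioi 0 ×ˢ Set.Ioo (-Real.pi) Real.pi) := by
    rw [IntegrableOn, Measure.volume_eq_prod, ← Measure.prod_restrict,
      integrable_prod_iff hGm.aestronglyMeasurable]
    constructor
    · filter_upwards [hΦi, hpos] with r h1 h2
      simp_rw [hG' r h2]
      exact h1.const_mul _
    · refine hi.norm.congr ?_
      filter_upwards [hm, hpos] with r h1 h2
      simp_rw [hG' r h2, norm_mul _ (Φ _), Real.norm_of_nonneg (hΦ0 _)]
      rw [integral_const_mul, h1, norm_mul, ← h1,
        Real.norm_of_nonneg (integral_nonneg fun θ => hΦ0 _)]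
  refine ⟨(integrable_iff_integrableOn_polarCoord hfm).2 hGi, ?_⟩
  rw [← integral_comp_polarCoord_symm]
  have : ∫ p in polarCoord.target, p.1 • f (polarCoord.symm p) =
      ∫ p in Set.Ioi (0 : ℝ) ×ˢ Set.Ioo (-Real.pi) Real.pi, G p := rfl
  rw [this]
  rw [IntegrableOn, Measure.volume_eq_prod, ← Measure.prod_restrict] at hGi
  rw [Measure.volume_eq_prod, ← Measure.prod_restrict, integral_prod _ hGi]
  refine integral_congr_ae ?_
  filter_upwards [hm, hpos] with r h1 h2
  simp_rw [hG' r h2]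
  rw [integral_const_mul, h1]

theorem integrable_radial {h : ℝ → ℝ} (hh : Measurable h)
    (hi : IntegrableOn (fun r => r * h r) (Set.Ioi 0)) :
    Integrable (fun p : ℝ × ℝ => h (√(p.1 ^ 2 + p.2 ^ 2))) ∧
      ∫ p : ℝ × ℝ, h (√(p.1 ^ 2 + p.2 ^ 2)) = 2 * Real.pi * ∫ r in Set.Ioi 0, r * h r := by
  have h1 := integrable_radial_mul (m := fun _ => 2 * Real.pi) (Φ := fun _ => 1) hh
    measurable_const (fun _ => zero_le_one) (.of_forall fun r => by simp)
    (.of_forall fun r => by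
      rw [integral_const]
      simp only [smul_eq_mul, measureReal_restrict_apply_univ, Real.volume_real_Ioo, mul_one]
      rw [max_eq_left (by linarith [Real.pi_pos])]; ring) (hi.mul_const _)
  simp only [mul_one, integral_mul_const] at h1
  rw [mul_comm (2 * Real.pi)]
  exact h1

theorem measurable_besselK (n : ℕ) : Measurable (besselK n) := by
  have : StronglyMeasurable (Function.uncurry fun (x t : ℝ) =>
      Real.exp (-x * Real.cosh t) * Real.cosh (n * t)) := by
    apply Measurable.stronglyMeasurable
    fun_prop
  exact (this.integral_prod_right (ν := volume.restrict (Set.Ioi 0))).measurable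

theorem besselK_zero_nonneg (x : ℝ) : 0 ≤ besselK 0 x :=
  integral_nonneg fun t => by positivity

theorem continuousOn_besselK_zero : ContinuousOn (besselK 0) (Set.Ioi 0) := fun _ hx =>
  (hasDerivAt_besselK_zero hx).continuousAt.continuousWithinAt

theorem circleDistSq_comm (d r θ : ℝ) : circleDistSq d r θ = circleDistSq r d θ := by
  unfold circleDistSq; ring

theorem integral_besselK_circle_of_ne {g d r : ℝ} (hg : 0 < g) (hd : 0 ≤ d) (hr : 0 ≤ r)
    (hrd : r ≠ d) :
    ∫ θ in -Real.pi..Real.pi, besselK 0 (g * √(circleDistSq d r θ)) =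
      2 * Real.pi * (besselI 0 (g * min r d) * besselK 0 (g * max r d)) := by
  rcases hrd.lt_or_gt with h | h
  · rw [min_eq_left h.le, max_eq_right h.le, integral_besselK_circle hg hr h]
  · rw [min_eq_right h.le, max_eq_left h.le]
    simp_rw [circleDistSq_comm d r]
    rw [integral_besselK_circle hg hd h]

theorem continuous_besselK_circle {g d r : ℝ} (hg : 0 < g) (hd : 0 ≤ d) (hr : 0 ≤ r)
    (hrd : r ≠ d) : Continuous fun θ => besselK 0 (g * √(circleDistSq d r θ)) := by
  have hpos : ∀ θ, 0 < circleDistSq d r θ := fun θ => by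
    rcases hrd.lt_or_gt with h | h
    · exact circleDistSq_pos ⟨by linarith, h⟩ θ
    · rw [circleDistSq_comm]
      exact circleDistSq_pos ⟨by linarith, h⟩ θ
  have hc : Continuous fun θ => g * √(circleDistSq d r θ) := by
    unfold circleDistSq; fun_prop
  exact continuousOn_besselK_zero.comp_continuous hc fun θ =>
    mul_pos hg (Real.sqrt_pos.2 (hpos θ))

theorem integrable_radial_mul_besselK {h : ℝ → ℝ} {g d : ℝ} (hh : Measurable h) (hg : 0 < g)
    (hd : 0 ≤ d) (hi : IntegrableOn (fun r => r * h r *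
      (besselI 0 (g * min r d) * besselK 0 (g * max r d))) (Set.Ioi 0)) :
    Integrable (fun p : ℝ × ℝ =>
      h (√(p.1 ^ 2 + p.2 ^ 2)) * besselK 0 (g * √((p.1 - d) ^ 2 + p.2 ^ 2))) ∧
    ∫ p : ℝ × ℝ, h (√(p.1 ^ 2 + p.2 ^ 2)) * besselK 0 (g * √((p.1 - d) ^ 2 + p.2 ^ 2)) =
      2 * Real.pi * ∫ r in Set.Ioi 0, r * h r *
        (besselI 0 (g * min r d) * besselK 0 (g * max r d)) := by
  have hcirc : ∀ r θ, (r * Real.cos θ - d) ^ 2 + (r * Real.sin θ) ^ 2 = circleDistSq d r θ :=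
    fun r θ => by
      unfold circleDistSq
      linear_combination r ^ 2 * Real.sin_sq_add_cos_sq θ
  -- The circle r = d runs through the singularity of the shifted K₀; it is discarded as a null set.
  have hne : ∀ᵐ r ∂volume.restrict (Set.Ioi (0 : ℝ)), r ≠ d :=
    ae_restrict_of_ae (Measure.ae_ne volume d)
  have hpos : ∀ᵐ r ∂volume.restrict (Set.Ioi (0 : ℝ)), 0 < r :=
    (ae_restrict_iff' measurableSet_Ioi).2 (.of_forall fun r hr => hr)
  have hpi : -Real.pi ≤ Real.pi := by linarith [Real.pi_pos]
  have hK := measurable_besselK 0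
  have h1 := integrable_radial_mul
    (m := fun r => 2 * Real.pi * (besselI 0 (g * min r d) * besselK 0 (g * max r d)))
    (Φ := fun p => besselK 0 (g * √((p.1 - d) ^ 2 + p.2 ^ 2))) hh (hK.comp (by fun_prop))
    (fun p => besselK_zero_nonneg _) ?_ ?_ ?_
  · rw [← integral_const_mul]
    refine ⟨h1.1, h1.2.trans ?_⟩
    congr 1; ext r; ring
  · filter_upwards [hne, hpos] with r h1 h2
    simp only [hcirc]
    exact ((continuous_besselK_circle hg hd h2.le h1).integrableOn_Icc).mono_set
      Set.Ioo_subset_Icc_self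
  · filter_upwards [hne, hpos] with r h1 h2
    simp only [hcirc]
    rw [← integral_Ioc_eq_integral_Ioo, ← intervalIntegral.integral_of_le hpi,
      integral_besselK_circle_of_ne hg hd h2.le h1]
  · refine (hi.const_mul (2 * Real.pi)).congr (.of_forall fun r => ?_)
    ring

/-! ### Radial integrals of products of Bessel functions -/

theorem hasDerivAt_comp_const_mul {f : ℝ → ℝ} {f' g r : ℝ} (h : HasDerivAt f f' (g * r)) :
    HasDerivAt (fun r => f (g * r)) (g * f') r := by
  refine hasDerivAt_of_eq (HasDerivAt.comp (h₂ := f) r h ((hasDerivAt_id r).const_mul g))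
    (fun _ => rfl) ?_
  ring

-- The antiderivative in the variable x is (x² K₀ I₀ + x I₁ · x K₁)/2. Its terms are singular
-- products at the origin, where the value 0 is obtained as a limit; integrability then follows from
-- the positivity of the integrand.
open Filter Topology in
theorem integral_besselK_mul_besselI {g b : ℝ} (hg : 0 < g) (hb : 0 < b) :
    IntegrableOn (fun r => r * besselK 0 (g * r) * besselI 0 (g * r)) (Set.Ioc 0 b) ∧
    ∫ r in Set.Ioc 0 b, r * besselK 0 (g * r) * besselI 0 (g * r) =
      b ^ 2 / 2 * (besselI 0 (g * b) * besselK 0 (g * b) + besselI 1 (g * b) * besselK 1 (g * b)) := by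
  set F : ℝ → ℝ := fun x => (x ^ 2 * besselK 0 x * besselI 0 x + x * besselI 1 x * (x * besselK 1 x))
    / 2 with hF
  have hF' : ∀ x, 0 < x → HasDerivAt F (x * besselK 0 x * besselI 0 x) x := fun x hx => by
    refine hasDerivAt_of_eq (((((hasDerivAt_pow 2 x).mul (hasDerivAt_besselK_zero hx)).mul
      (hasDerivAt_besselI_zero x)).add ((hasDerivAt_mul_besselI_one x).mul
      (hasDerivAt_mul_besselK_one hx))).div_const 2) (fun _ => rfl) ?_
    simp only [Nat.cast_ofNat, Nat.add_one_sub_one, pow_one, Pi.mul_apply]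
    ring
  have hlim : Tendsto F (𝓝[>] 0) (𝓝 0) := by
    have h1 : ∀ n, Tendsto (besselI n) (𝓝[>] 0) (𝓝 (besselI n 0)) := fun n =>
      ((continuous_besselI n).continuousWithinAt (s := Set.Ioi 0) (x := 0)).tendsto
    have h2 : Tendsto (fun x => x * besselI 1 x) (𝓝[>] 0) (𝓝 (0 * besselI 1 0)) :=
      ((continuous_id.mul (continuous_besselI 1)).continuousWithinAt
        (s := Set.Ioi 0) (x := 0)).tendsto
    have := ((tendsto_mul_sq_besselK_zero.mul (h1 0)).add (h2.mul tendsto_mul_besselK_one)).div_const 2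
    simpa using this
  set G : ℝ → ℝ := fun r => F (g * r) / g ^ 2 with hG
  have hG' : ∀ r, 0 < r → HasDerivAt G (r * besselK 0 (g * r) * besselI 0 (g * r)) r := fun r hr => by
    refine hasDerivAt_of_eq ((hasDerivAt_comp_const_mul (hF' (g * r) (by positivity))).div_const
      (g ^ 2)) (fun _ => rfl) ?_
    field_simp
  have hG0 : G 0 = 0 := by simp [hG, hF]
  have hGlim : Tendsto G (𝓝[>] 0) (𝓝 0) := by
    have h1 : Tendsto (fun r => g * r) (𝓝[>] 0) (𝓝[>] 0) := by
      refine tendsto_nhdsWithin_iff.2 ⟨?_, ?_⟩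
      · have : Continuous fun r => g * r := by fun_prop
        simpa using (this.continuousWithinAt (s := Set.Ioi 0) (x := 0)).tendsto
      · filter_upwards [self_mem_nhdsWithin] with r hr using mul_pos hg hr
    simpa using (hlim.comp h1).div_const (g ^ 2)
  have hcont : ContinuousOn G (Set.Icc 0 b) := fun r hr => by
    rcases hr.1.eq_or_lt with rfl | h
    · refine ContinuousWithinAt.mono (t := Set.Ici 0) ?_ Set.Icc_subset_Ici_self
      rw [← continuousWithinAt_Ioi_iff_Ici, ContinuousWithinAt, hG0]
      exact hGlim
    · exact (hG' r h).continuousAt.continuousWithinAt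
  have hint := intervalIntegral.integrableOn_deriv_of_nonneg hcont (fun r hr => hG' r hr.1)
    (fun r hr => by
      have := besselK_zero_nonneg (g * r)
      have := besselI_zero_pos (g * r)
      have := hr.1
      positivity)
  refine ⟨hint, ?_⟩
  rw [← intervalIntegral.integral_of_le hb.le, intervalIntegral.integral_eq_sub_of_hasDerivAt_of_le
    hb.le hcont (fun r hr => hG' r hr.1) ((intervalIntegrable_iff_integrableOn_Ioc_of_le hb.le).2 hint),
    hG0]
  simp only [hG, hF]
  field_simp
  ring

open Filter Topology in
theorem tendsto_mul_coshMoment_atTop (n : ℕ) :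
    Tendsto (fun x => x * coshMoment n x) atTop (𝓝 0) := by
  have h1 : Tendsto (fun x : ℝ => x ^ 1 * Real.exp (-x) * (Real.exp 1 * coshMoment n 1)) atTop (𝓝 0) := by
    simpa using (Real.tendsto_pow_mul_exp_neg_atTop_nhds_zero 1).mul_const (Real.exp 1 * coshMoment n 1)
  refine squeeze_zero' ?_ ?_ h1
  · filter_upwards [eventually_gt_atTop 0] with x hx
    have := coshMoment_pos n hx
    positivity
  · filter_upwards [eventually_ge_atTop 1] with x hx
    have h := coshMoment_add_le n one_pos (sub_nonneg.2 hx)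
    rw [add_sub_cancel] at h
    calc x * coshMoment n x ≤ x * (Real.exp (-(x - 1)) * coshMoment n 1) := by gcongr
      _ = _ := by
        rw [show -(x - 1) = -x + 1 by ring, Real.exp_add]; ring

open Filter Topology in
theorem integral_besselK_sq {g b : ℝ} (hg : 0 < g) (hb : 0 < b) :
    IntegrableOn (fun r => r * besselK 0 (g * r) ^ 2) (Set.Ioi b) ∧
    ∫ r in Set.Ioi b, r * besselK 0 (g * r) ^ 2 =
      b ^ 2 / 2 * (besselK 1 (g * b) ^ 2 - besselK 0 (g * b) ^ 2) := by
  set F : ℝ → ℝ := fun x => (x ^ 2 * besselK 0 x ^ 2 - (x * besselK 1 x) ^ 2) / 2 with hF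
  have hF' : ∀ x, 0 < x → HasDerivAt F (x * besselK 0 x ^ 2) x := fun x hx => by
    refine hasDerivAt_of_eq ((((hasDerivAt_pow 2 x).mul ((hasDerivAt_besselK_zero hx).pow 2)).sub
      ((hasDerivAt_mul_besselK_one hx).pow 2)).div_const 2) (fun _ => rfl) ?_
    simp only [Nat.cast_ofNat, Nat.add_one_sub_one, pow_one, Pi.pow_apply]
    ring
  set G : ℝ → ℝ := fun r => F (g * r) / g ^ 2 with hG
  have hG' : ∀ r ∈ Set.Ici b, HasDerivAt G (r * besselK 0 (g * r) ^ 2) r := fun r hr => by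
    have hr : 0 < r := hb.trans_le hr
    refine hasDerivAt_of_eq ((hasDerivAt_comp_const_mul (hF' (g * r) (by positivity))).div_const
      (g ^ 2)) (fun _ => rfl) ?_
    field_simp
  have hFlim : Tendsto F atTop (𝓝 0) := by
    have h0 := tendsto_mul_coshMoment_atTop 0
    have h1 := tendsto_mul_coshMoment_atTop 1
    rw [← besselK_zero_eq] at h0
    rw [← besselK_one_eq] at h1
    have := ((h0.pow 2).sub (h1.pow 2)).div_const 2
    simp only [ne_eq, OfNat.ofNat_ne_zero, not_false_eq_true, zero_pow, sub_zero, zero_div] at this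
    refine this.congr fun x => ?_
    simp only [hF]; ring
  have hGlim : Tendsto G atTop (𝓝 0) := by
    simpa using (hFlim.comp (tendsto_id.const_mul_atTop hg)).div_const (g ^ 2)
  have hpos : ∀ r ∈ Set.Ioi b, 0 ≤ r * besselK 0 (g * r) ^ 2 := fun r hr => by
    have : 0 < r := hb.trans hr
    positivity
  refine ⟨integrableOn_Ioi_deriv_of_nonneg' hG' hpos hGlim, ?_⟩
  rw [integral_Ioi_of_hasDerivAt_of_nonneg' hG' hpos hGlim]
  simp only [hG, hF]
  field_simp
  ring

theorem integral_besselJ_sq {L b : ℝ} (hL : 0 < L) :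
    ∫ r in 0..b, r * besselJ 0 (L * r) ^ 2 =
      b ^ 2 / 2 * (besselJ 0 (L * b) ^ 2 + besselJ 1 (L * b) ^ 2) := by
  set F : ℝ → ℝ := fun x => (x ^ 2 * besselJ 0 x ^ 2 + (x * besselJ 1 x) ^ 2) / 2 with hF
  have hF' : ∀ x, HasDerivAt F (x * besselJ 0 x ^ 2) x := fun x => by
    refine hasDerivAt_of_eq ((((hasDerivAt_pow 2 x).mul ((hasDerivAt_besselJ_zero x).pow 2)).add
      ((hasDerivAt_mul_besselJ_one x).pow 2)).div_const 2) (fun _ => rfl) ?_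
    simp only [Nat.cast_ofNat, Nat.add_one_sub_one, pow_one, Pi.pow_apply]
    ring
  have hJ := continuous_besselJ 0
  rw [intervalIntegral.integral_eq_sub_of_hasDerivAt (f := fun r => F (L * r) / L ^ 2)
    (fun r _ => ?_) (Continuous.intervalIntegrable (by fun_prop) _ _)]
  · simp only [hF]
    field_simp
    ring
  · refine hasDerivAt_of_eq ((hasDerivAt_comp_const_mul (hF' (L * r))).div_const (L ^ 2))
      (fun _ => rfl) ?_
    field_simp

/-- J₀(Lr) and I₀(gr) are radial eigenfunctions of the Laplacian with eigenvalues -L² and g².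
Green's identity gives the integral as a boundary term divided by the difference L² + g². -/
theorem integral_besselJ_mul_besselI {L g b : ℝ} (hL : 0 < L) (hg : 0 < g) :
    ∫ r in 0..b, r * besselJ 0 (L * r) * besselI 0 (g * r) =
      (L * b * besselJ 1 (L * b) * besselI 0 (g * b) + g * b * besselI 1 (g * b) * besselJ 0 (L * b))
        / (L ^ 2 + g ^ 2) := by
  have hJ := continuous_besselJ 0
  have hI := continuous_besselI 0
  rw [intervalIntegral.integral_eq_sub_of_hasDerivAt (f := fun r =>
    (L * r * besselJ 1 (L * r) * besselI 0 (g * r) + g * r * besselI 1 (g * r) * besselJ 0 (L * r))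
        / (L ^ 2 + g ^ 2)) (fun r _ => ?_) (Continuous.intervalIntegrable (by fun_prop) _ _)]
  · simp
  · refine hasDerivAt_of_eq ((((hasDerivAt_comp_const_mul (hasDerivAt_mul_besselJ_one (L * r))).mul
      (hasDerivAt_comp_const_mul (hasDerivAt_besselI_zero (g * r)))).add
      ((hasDerivAt_comp_const_mul (hasDerivAt_mul_besselI_one (g * r))).mul
      (hasDerivAt_comp_const_mul (hasDerivAt_besselJ_zero (L * r))))).div_const (L ^ 2 + g ^ 2))
      (fun _ => rfl) ?_
    field_simp
    ring

/-- Splitting the radial integral at r = d, the terms with I₀K₀² cancel, and what remains is K₁(gd)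
times the Wronskian 1/(gd). -/
theorem integral_besselK_mul_besselK {g d : ℝ} (hg : 0 < g) (hd : 0 < d) :
    Integrable (fun p : ℝ × ℝ =>
      besselK 0 (g * √(p.1 ^ 2 + p.2 ^ 2)) * besselK 0 (g * √((p.1 - d) ^ 2 + p.2 ^ 2))) ∧
    ∫ p : ℝ × ℝ, besselK 0 (g * √(p.1 ^ 2 + p.2 ^ 2)) * besselK 0 (g * √((p.1 - d) ^ 2 + p.2 ^ 2)) =
      Real.pi * d / g * besselK 1 (g * d) := by
  set f : ℝ → ℝ := fun r => r * besselK 0 (g * r) *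
      (besselI 0 (g * min r d) * besselK 0 (g * max r d)) with hf
  obtain ⟨h1, h1'⟩ := integral_besselK_mul_besselI hg hd
  obtain ⟨h2, h2'⟩ := integral_besselK_sq hg hd
  have e1 : Set.EqOn (fun r => r * besselK 0 (g * r) * besselI 0 (g * r) * besselK 0 (g * d)) f
      (Set.Ioc 0 d) := fun r hr => by
    simp only [hf]
    rw [min_eq_left hr.2, max_eq_right hr.2]; ring
  have e2 : Set.EqOn (fun r => r * besselK 0 (g * r) ^ 2 * besselI 0 (g * d)) f (Set.Ioi d) :=
    fun r hr => by
    simp only [hf]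
    rw [min_eq_right (le_of_lt hr), max_eq_left (le_of_lt hr)]; ring
  have i1 : IntegrableOn f (Set.Ioc 0 d) :=
    IntegrableOn.congr_fun (h1.mul_const _) e1 measurableSet_Ioc
  have i2 : IntegrableOn f (Set.Ioi d) := IntegrableOn.congr_fun (h2.mul_const _) e2 measurableSet_Ioi
  have hu : Set.Ioi (0 : ℝ) = Set.Ioc 0 d ∪ Set.Ioi d := (Set.Ioc_union_Ioi_eq_Ioi hd.le).symm
  have i3 : IntegrableOn f (Set.Ioi 0) := by
    rw [hu]
    exact i1.union i2
  have hK := measurable_besselK 0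
  have h := integrable_radial_mul_besselK (h := fun r => besselK 0 (g * r)) (hK.comp (by fun_prop))
    hg hd.le i3
  refine ⟨h.1, h.2.trans ?_⟩
  change 2 * Real.pi * ∫ r in Set.Ioi 0, f r = _
  rw [hu, setIntegral_union (Set.Ioc_disjoint_Ioi le_rfl) measurableSet_Ioi i1 i2,
    ← setIntegral_congr_fun measurableSet_Ioc e1, ← setIntegral_congr_fun measurableSet_Ioi e2,
    integral_mul_const, integral_mul_const, h1', h2']
  have hW := besselI_mul_besselK_add (mul_pos hg hd)
  have : besselI 0 (g * d) * besselK 1 (g * d) + besselI 1 (g * d) * besselK 0 (g * d) = 1 / (g * d) := hW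
  have e : Real.pi * d / g = Real.pi * d ^ 2 * (1 / (g * d)) := by field_simp
  rw [e, ← this]
  ring

/-- Seen from a centre at distance d ≥ b, a radial source supported in r ≤ b acts only through its
I₀-moment. A vanishing moment makes the source invisible to all distant tails; a nonzero moment
gives the cross terms in the closed form of the overlaps. -/
theorem integral_indicator_radial_mul_besselK {h : ℝ → ℝ} {g d b : ℝ} (hh : Measurable h)
    (hg : 0 < g) (hb : 0 < b) (hbd : b ≤ d)
    (hi : IntegrableOn (fun r => r * h r * besselI 0 (g * r)) (Set.Ioc 0 b)) :
    Integrable (fun p : ℝ × ℝ => (Set.Iic b).indicator h (√(p.1 ^ 2 + p.2 ^ 2)) *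
      besselK 0 (g * √((p.1 - d) ^ 2 + p.2 ^ 2))) ∧
    ∫ p : ℝ × ℝ, (Set.Iic b).indicator h (√(p.1 ^ 2 + p.2 ^ 2)) *
      besselK 0 (g * √((p.1 - d) ^ 2 + p.2 ^ 2)) =
      2 * Real.pi * besselK 0 (g * d) * ∫ r in Set.Ioc 0 b, r * h r * besselI 0 (g * r) := by
  set f : ℝ → ℝ := fun r => r * (Set.Iic b).indicator h r *
      (besselI 0 (g * min r d) * besselK 0 (g * max r d)) with hf
  have e1 : Set.EqOn (fun r => r * h r * besselI 0 (g * r) * besselK 0 (g * d)) f (Set.Ioc 0 b) :=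
    fun r hr => by
    have hrd := hr.2.trans hbd
    simp only [hf]
    rw [min_eq_left hrd, max_eq_right hrd, Set.indicator_of_mem (Set.mem_Iic.2 hr.2)]; ring
  have e2 : Set.EqOn (fun _ => 0) f (Set.Ioi b) := fun r hr => by
    simp only [hf]
    rw [Set.indicator_of_notMem (by simpa using hr)]; ring
  have i1 : IntegrableOn f (Set.Ioc 0 b) :=
    IntegrableOn.congr_fun (hi.mul_const _) e1 measurableSet_Ioc
  have i2 : IntegrableOn f (Set.Ioi b) := IntegrableOn.congr_fun integrableOn_zero e2 measurableSet_Ioi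
  have hu : Set.Ioi (0 : ℝ) = Set.Ioc 0 b ∪ Set.Ioi b := (Set.Ioc_union_Ioi_eq_Ioi hb.le).symm
  have i3 : IntegrableOn f (Set.Ioi 0) := by
    rw [hu]
    exact i1.union i2
  have h := integrable_radial_mul_besselK (hh.indicator measurableSet_Iic) hg (hb.le.trans hbd) i3
  refine ⟨h.1, h.2.trans ?_⟩
  change 2 * Real.pi * ∫ r in Set.Ioi 0, f r = _
  rw [hu, setIntegral_union (Set.Ioc_disjoint_Ioi le_rfl) measurableSet_Ioi i1 i2,
    ← setIntegral_congr_fun measurableSet_Ioc e1, ← setIntegral_congr_fun measurableSet_Ioi e2,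
    integral_mul_const, integral_zero]
  ring

/-! ### Overlaps of exponentially decaying radial functions -/

theorem integrableOn_mul_exp_neg {c : ℝ} (hc : 0 < c) :
    IntegrableOn (fun r => r * Real.exp (-c * r)) (Set.Ioi 0) := by
  refine Integrable.mono' ((exp_neg_integrableOn_Ioi 0 (half_pos hc)).const_mul (2 / c))
    (by fun_prop) ?_
  refine (ae_restrict_iff' measurableSet_Ioi).2 (.of_forall fun r hr => ?_)
  have hr : 0 < r := hr
  have h1 := Real.add_one_le_exp (c / 2 * r)
  rw [Real.norm_of_nonneg (by positivity)]
  calc r * Real.exp (-c * r) = 2 / c * (c / 2 * r) * Real.exp (-c * r) := by field_simp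
    _ ≤ 2 / c * Real.exp (c / 2 * r) * Real.exp (-c * r) := by gcongr; linarith
    _ = _ := by rw [mul_assoc, ← Real.exp_add]; congr 2; ring

theorem integrable_exp_neg_radius {c : ℝ} (hc : 0 < c) :
    Integrable fun p : ℝ × ℝ => Real.exp (-c * √(p.1 ^ 2 + p.2 ^ 2)) :=
  (integrable_radial (h := fun r => Real.exp (-c * r)) (by fun_prop) (integrableOn_mul_exp_neg hc)).1

theorem integral_translate (F : ℝ × ℝ → ℝ) (s : ℝ) :
    ∫ p : ℝ × ℝ, F (p.1 - s, p.2) = ∫ p, F p := by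
  have := integral_sub_right_eq_self F (μ := (volume : Measure (ℝ × ℝ))) (s, 0)
  simpa [Prod.sub_def] using this

theorem integrable_translate {F : ℝ × ℝ → ℝ} (hF : Integrable F) (s : ℝ) :
    Integrable fun p : ℝ × ℝ => F (p.1 - s, p.2) := by
  simpa [Prod.sub_def] using hF.comp_sub_right (s, 0)

theorem abs_sub_le_radius_add (s t : ℝ) (p : ℝ × ℝ) :
    |s - t| ≤ √((p.1 - s) ^ 2 + p.2 ^ 2) + √((p.1 - t) ^ 2 + p.2 ^ 2) := by
  have h : ∀ s, |p.1 - s| ≤ √((p.1 - s) ^ 2 + p.2 ^ 2) := fun s =>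
    Real.abs_le_sqrt (by nlinarith [sq_nonneg p.2])
  have h1 := h s
  have h2 := h t
  have h3 : |s - t| ≤ |p.1 - s| + |p.1 - t| := by
    rw [abs_sub_comm p.1 s]
    exact (abs_sub_le s p.1 t)
  linarith

/-- Half of the decay rate is spent on the distance between the centres, through the triangle
inequality; the other half is kept so that the bound is integrable. -/
theorem abs_mul_le_of_exp_decay {f h : ℝ → ℝ} {g C C' : ℝ} (hg : 0 < g)
    (hf : ∀ r, 0 ≤ r → |f r| ≤ C * Real.exp (-g * r))
    (hh : ∀ r, 0 ≤ r → |h r| ≤ C' * Real.exp (-g * r)) (s t : ℝ) (p : ℝ × ℝ) :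
    ‖f (√((p.1 - s) ^ 2 + p.2 ^ 2)) * h (√((p.1 - t) ^ 2 + p.2 ^ 2))‖ ≤
      C * C' * Real.exp (-(g / 2) * |s - t|) * Real.exp (-(g / 2) * √((p.1 - s) ^ 2 + p.2 ^ 2)) := by
  set x := √((p.1 - s) ^ 2 + p.2 ^ 2)
  set y := √((p.1 - t) ^ 2 + p.2 ^ 2)
  have hx : 0 ≤ x := Real.sqrt_nonneg _
  have hy : 0 ≤ y := Real.sqrt_nonneg _
  have h1 := hf x hx
  have h2 := hh y hy
  have h3 : |s - t| ≤ x + y := abs_sub_le_radius_add s t p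
  have hC : 0 ≤ C := by simpa using (abs_nonneg _).trans (hf 0 le_rfl)
  have hC' : 0 ≤ C' := by simpa using (abs_nonneg _).trans (hh 0 le_rfl)
  rw [norm_mul, Real.norm_eq_abs, Real.norm_eq_abs]
  calc |f x| * |h y| ≤ (C * Real.exp (-g * x)) * (C' * Real.exp (-g * y)) := by gcongr
    _ = C * C' * Real.exp (-g * (x + y)) := by
      rw [mul_add, Real.exp_add]; ring
    _ ≤ C * C' * Real.exp (-(g / 2) * |s - t| + -(g / 2) * x) := by
      gcongr
      nlinarith
    _ = _ := by rw [Real.exp_add]; ring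

theorem integrable_mul_of_exp_decay {f h : ℝ → ℝ} {g C C' : ℝ} (hg : 0 < g) (hfm : Measurable f)
    (hhm : Measurable h) (hf : ∀ r, 0 ≤ r → |f r| ≤ C * Real.exp (-g * r))
    (hh : ∀ r, 0 ≤ r → |h r| ≤ C' * Real.exp (-g * r)) (s t : ℝ) :
    Integrable fun p : ℝ × ℝ =>
      f (√((p.1 - s) ^ 2 + p.2 ^ 2)) * h (√((p.1 - t) ^ 2 + p.2 ^ 2)) := by
  refine Integrable.mono' ((integrable_translate (integrable_exp_neg_radius (half_pos hg)) s).const_mul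
    (C * C' * Real.exp (-(g / 2) * |s - t|))) ?_
    (.of_forall fun p => abs_mul_le_of_exp_decay hg hf hh s t p)
  exact ((hfm.comp (by fun_prop)).mul (hhm.comp (by fun_prop))).aestronglyMeasurable

theorem integral_mul_le_of_exp_decay {f h : ℝ → ℝ} {g C C' : ℝ} (hg : 0 < g)
    (hf : ∀ r, 0 ≤ r → |f r| ≤ C * Real.exp (-g * r))
    (hh : ∀ r, 0 ≤ r → |h r| ≤ C' * Real.exp (-g * r)) (s t : ℝ) :
    ∫ p : ℝ × ℝ, f (√((p.1 - s) ^ 2 + p.2 ^ 2)) * h (√((p.1 - t) ^ 2 + p.2 ^ 2)) ≤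
      C * C' * (∫ p : ℝ × ℝ, Real.exp (-(g / 2) * √(p.1 ^ 2 + p.2 ^ 2))) *
        Real.exp (-(g / 2) * |s - t|) := by
  refine (Real.le_norm_self _).trans ((norm_integral_le_of_norm_le
    ((integrable_translate (integrable_exp_neg_radius (half_pos hg)) s).const_mul
    (C * C' * Real.exp (-(g / 2) * |s - t|)))
    (.of_forall fun p => abs_mul_le_of_exp_decay hg hf hh s t p)).trans_eq ?_)
  rw [integral_const_mul,
    integral_translate (fun p => Real.exp (-(g / 2) * √(p.1 ^ 2 + p.2 ^ 2))) s]
  ring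

/-- Translation together with the reflection p ↦ -p leaves only the distance between the centres.
This is why the Gram matrix depends on |n - m| alone. -/
theorem integral_radial_mul_translate (f h : ℝ → ℝ) (s t : ℝ) :
    ∫ p : ℝ × ℝ, f (√((p.1 - s) ^ 2 + p.2 ^ 2)) * h (√((p.1 - t) ^ 2 + p.2 ^ 2)) =
      ∫ p : ℝ × ℝ, f (√(p.1 ^ 2 + p.2 ^ 2)) * h (√((p.1 - |s - t|) ^ 2 + p.2 ^ 2)) := by
  have h1 : ∫ p : ℝ × ℝ, f (√((p.1 - s) ^ 2 + p.2 ^ 2)) * h (√((p.1 - t) ^ 2 + p.2 ^ 2)) =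
      ∫ p : ℝ × ℝ, f (√(p.1 ^ 2 + p.2 ^ 2)) * h (√((p.1 - (t - s)) ^ 2 + p.2 ^ 2)) := by
    rw [← integral_translate (fun p => f (√(p.1 ^ 2 + p.2 ^ 2)) *
      h (√((p.1 - (t - s)) ^ 2 + p.2 ^ 2))) s]
    congr 1; ext p; simp only; congr 4; ring
  rw [h1]
  rcases le_total s t with hst | hst
  · rw [abs_of_nonpos (by linarith), neg_sub]
  · rw [abs_of_nonneg (by linarith), ← integral_neg_eq_self (fun p : ℝ × ℝ =>
      f (√(p.1 ^ 2 + p.2 ^ 2)) * h (√((p.1 - (t - s)) ^ 2 + p.2 ^ 2))) volume]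
    congr 1; ext p
    simp only [Prod.fst_neg, Prod.snd_neg, neg_sq]
    congr 4
    ring

/-! ### Positivity, exponential decay and normalization of the mode; summability of the overlaps -/

namespace WaveguideArray

variable {W : WaveguideArray} {β : ℝ}

theorem k_pos (W : WaveguideArray) : 0 < W.k := by
  have := W.n₀_pos
  have := W.wl_pos
  unfold k
  positivity

namespace IsFundamental

theorem Gam_pos (h : W.IsFundamental β) : 0 < W.Gam β := by
  have := h.pos
  have := W.k_pos
  unfold Gam
  positivity

theorem Gam_sq (h : W.IsFundamental β) : W.Gam β ^ 2 = 2 * W.k * β :=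
  Real.sq_sqrt (by have := h.pos; have := W.k_pos; positivity)

theorem Lam_arg_pos (h : W.IsFundamental β) : 0 < 2 * W.k ^ 2 * W.Δn / W.n₀ - 2 * W.k * β := by
  have h1 := h.lt
  have h2 := W.k_pos
  have : 2 * W.k ^ 2 * W.Δn / W.n₀ - 2 * W.k * β = 2 * W.k * (W.k * W.Δn / W.n₀ - β) := by ring
  rw [this]
  exact mul_pos (by positivity) (by linarith)

theorem Lam_pos (h : W.IsFundamental β) : 0 < W.Lam β := Real.sqrt_pos.2 h.Lam_arg_pos

theorem Lam_sq_add_Gam_sq (h : W.IsFundamental β) :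
    W.Lam β ^ 2 + W.Gam β ^ 2 = 2 * W.k ^ 2 * W.Δn / W.n₀ := by
  rw [h.Gam_sq, Lam, Real.sq_sqrt h.Lam_arg_pos.le]
  ring

theorem besselJ_core_pos (h : W.IsFundamental β) {r : ℝ} (hr : 0 ≤ r) (hra : r ≤ W.a) :
    0 < besselJ 0 (W.Lam β * r) := by
  have := h.Lam_pos
  exact h.besselJ_pos _ (by positivity) (by gcongr)

theorem besselJ_edge_pos (h : W.IsFundamental β) : 0 < besselJ 0 (W.Lam β * W.a) :=
  h.besselJ_core_pos W.a_pos.le le_rfl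

theorem besselK_edge_pos (h : W.IsFundamental β) : 0 < besselK 0 (W.Gam β * W.a) :=
  besselK_zero_pos (mul_pos h.Gam_pos W.a_pos)

theorem rawProfile_pos (h : W.IsFundamental β) {r : ℝ} (hr : 0 ≤ r) : 0 < W.rawProfile β r := by
  unfold rawProfile
  split_ifs with hra
  · exact h.besselJ_core_pos hr hra
  · have := besselK_zero_pos (mul_pos h.Gam_pos (W.a_pos.trans (not_le.1 hra)))
    have := h.besselJ_edge_pos
    have := h.besselK_edge_pos
    positivity

/-- On the core the profile is continuous on a compact interval, and the factor exp(Γa) compensates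
the exponential there. In the cladding K₀(Γr) ≤ exp(-Γ(r - a)) K₀(Γa). -/
theorem exists_rawProfile_le (h : W.IsFundamental β) : ∃ C : ℝ, 0 < C ∧
    ∀ r, 0 ≤ r → |W.rawProfile β r| ≤ C * Real.exp (-W.Gam β * r) := by
  obtain ⟨M, hM⟩ := isCompact_Icc.exists_bound_of_continuousOn
    (((continuous_besselJ 0).comp (continuous_const_mul (W.Lam β))).continuousOn (s := Set.Icc 0 W.a))
  have hg := h.Gam_pos
  have hb : ∀ r, 0 ≤ r → r ≤ W.a → besselJ 0 (W.Lam β * r) ≤ M := fun r h0 h1 =>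
    (Real.le_norm_self _).trans (hM r ⟨h0, h1⟩)
  have hM0 : 0 < M := h.besselJ_edge_pos.trans_le (hb _ W.a_pos.le le_rfl)
  refine ⟨M * Real.exp (W.Gam β * W.a), by positivity, fun r hr => ?_⟩
  rw [abs_of_pos (h.rawProfile_pos hr), mul_assoc, ← Real.exp_add, rawProfile]
  split_ifs with hra
  · refine (hb r hr hra).trans (le_mul_of_one_le_right hM0.le (Real.one_le_exp ?_))
    nlinarith
  · have hra := not_le.1 hra
    have h1 := besselK_zero_add_le (mul_pos hg W.a_pos) (h := W.Gam β * (r - W.a))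
      (mul_nonneg hg.le (by linarith))
    rw [show W.Gam β * W.a + W.Gam β * (r - W.a) = W.Gam β * r by ring] at h1
    have h2 := h.besselJ_edge_pos
    have h3 := h.besselK_edge_pos
    calc _ ≤ besselJ 0 (W.Lam β * W.a) / besselK 0 (W.Gam β * W.a) *
        (Real.exp (-(W.Gam β * (r - W.a))) * besselK 0 (W.Gam β * W.a)) := by gcongr
      _ = besselJ 0 (W.Lam β * W.a) * Real.exp (W.Gam β * W.a + -W.Gam β * r) := by
        rw [show -(W.Gam β * (r - W.a)) = W.Gam β * W.a + -W.Gam β * r by ring]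
        rw [mul_comm (Real.exp _), div_mul_eq_mul_div, ← mul_assoc, mul_div_right_comm,
          mul_div_cancel_right₀ _ h3.ne']
      _ ≤ _ := by
        gcongr
        exact hb _ W.a_pos.le le_rfl

end IsFundamental

theorem measurable_rawProfile (W : WaveguideArray) (β : ℝ) : Measurable (W.rawProfile β) := by
  have h1 := (continuous_besselJ 0).measurable
  have h2 := measurable_besselK 0
  exact Measurable.ite measurableSet_Iic (h1.comp (by fun_prop))
    ((h2.comp (by fun_prop)).const_mul _)

/-- The squared norm of the unnormalized profile. -/
noncomputable def normSq (W : WaveguideArray) (β : ℝ) : ℝ :=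
  ∫ p : ℝ × ℝ, W.rawProfile β (√(p.1 ^ 2 + p.2 ^ 2)) ^ 2

namespace IsFundamental

theorem integrable_rawProfile_mul (h : W.IsFundamental β) (s t : ℝ) : Integrable fun p : ℝ × ℝ =>
    W.rawProfile β (√((p.1 - s) ^ 2 + p.2 ^ 2)) * W.rawProfile β (√((p.1 - t) ^ 2 + p.2 ^ 2)) := by
  obtain ⟨C, -, hC⟩ := h.exists_rawProfile_le
  have hm := W.measurable_rawProfile β
  exact integrable_mul_of_exp_decay h.Gam_pos hm hm hC hC s t

theorem normSq_pos (h : W.IsFundamental β) : 0 < W.normSq β := by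
  have hi := h.integrable_rawProfile_mul 0 0
  simp only [sub_zero, ← pow_two] at hi
  unfold normSq
  rw [integral_pos_iff_support_of_nonneg (fun p => by positivity) hi]
  have : Function.support (fun p : ℝ × ℝ => W.rawProfile β (√(p.1 ^ 2 + p.2 ^ 2)) ^ 2) = Set.univ :=
    Set.eq_univ_of_forall fun p => (pow_pos (h.rawProfile_pos (Real.sqrt_nonneg _)) 2).ne'
  rw [this]
  simp

theorem amplitude_pos (h : W.IsFundamental β) : 0 < W.amplitude β :=
  inv_pos.2 (Real.sqrt_pos.2 h.normSq_pos)

theorem amplitude_sq (h : W.IsFundamental β) : W.amplitude β ^ 2 = 1 / W.normSq β := by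
  change (√(W.normSq β))⁻¹ ^ 2 = _
  rw [inv_pow, Real.sq_sqrt h.normSq_pos.le, one_div]

theorem integrable_mode_mul (h : W.IsFundamental β) (n m : ℤ) :
    Integrable fun p : ℝ × ℝ => W.mode β n p * W.mode β m p := by
  refine ((h.integrable_rawProfile_mul (n * W.D) (m * W.D)).const_mul (W.amplitude β ^ 2)).congr
    (.of_forall fun p => ?_)
  simp only [mode]
  ring

end IsFundamental

theorem integral_mode_mul (W : WaveguideArray) (β : ℝ) (n m : ℤ) :
    ∫ p : ℝ × ℝ, W.mode β n p * W.mode β m p = W.amplitude β ^ 2 * ∫ p : ℝ × ℝ,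
      W.rawProfile β (√(p.1 ^ 2 + p.2 ^ 2)) *
        W.rawProfile β (√((p.1 - (n - m).natAbs * W.D) ^ 2 + p.2 ^ 2)) := by
  have h1 : ((n - m).natAbs : ℝ) * W.D = |n * W.D - m * W.D| := by
    have hD : 0 < W.D := W.a_pos.trans W.a_lt_D
    rw [Nat.cast_natAbs, ← sub_mul, abs_mul, abs_of_pos hD]
    push_cast
    rfl
  rw [h1, ← integral_radial_mul_translate, ← integral_const_mul]
  congr 1; ext p
  simp only [mode]
  ring

theorem integral_mode_mul_eq_S (W : WaveguideArray) (β : ℝ) (n m : ℤ) :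
    ∫ p : ℝ × ℝ, W.mode β n p * W.mode β m p = W.S β (n - m).natAbs := by
  rw [S, integral_mode_mul, integral_mode_mul]
  simp

namespace IsFundamental

theorem S_zero (h : W.IsFundamental β) : W.S β 0 = 1 := by
  have := W.integral_mode_mul β 0 0
  rw [integral_mode_mul_eq_S, h.amplitude_sq] at this
  simp only [sub_self, Int.natAbs_zero, CharP.cast_eq_zero, zero_mul, sub_zero, ← pow_two] at this
  rw [this]
  have := h.normSq_pos
  exact one_div_mul_cancel this.ne'

theorem S_nonneg (h : W.IsFundamental β) (ξ : ℕ) : 0 ≤ W.S β ξ := by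
  refine integral_nonneg fun p => ?_
  have := h.amplitude_pos
  have h1 : ∀ m : ℤ, 0 ≤ W.mode β m p := fun m =>
    mul_nonneg this.le (h.rawProfile_pos (Real.sqrt_nonneg _)).le
  exact mul_nonneg (h1 _) (h1 _)

/-- The exponential overlap bound with centres ξD apart gives a geometric majorant of ratio
exp(-ΓD/2). -/
theorem summable_S (h : W.IsFundamental β) : Summable fun ξ : ℕ => W.S β ξ := by
  obtain ⟨C, -, hC⟩ := h.exists_rawProfile_le
  have hg := h.Gam_pos
  have hD : 0 < W.D := W.a_pos.trans W.a_lt_D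
  have hq : Real.exp (-(W.Gam β / 2) * W.D) < 1 := by
    rw [Real.exp_lt_one_iff]
    nlinarith [mul_pos hg hD]
  refine Summable.of_nonneg_of_le h.S_nonneg (fun ξ => ?_)
    ((summable_geometric_of_lt_one (Real.exp_pos _).le hq).mul_left (W.amplitude β ^ 2 * (C * C *
      (∫ p : ℝ × ℝ, Real.exp (-(W.Gam β / 2) * √(p.1 ^ 2 + p.2 ^ 2))))))
  have h1 := integral_mul_le_of_exp_decay hg hC hC 0 (ξ * W.D)
  have h2 := W.integral_mode_mul β 0 ξ
  rw [integral_mode_mul_eq_S] at h2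
  simp only [zero_sub, Int.natAbs_neg, Int.natAbs_natCast, sub_zero, abs_neg] at h1 h2
  rw [abs_of_nonneg (by positivity)] at h1
  rw [h2, ← Real.exp_nat_mul, mul_assoc (W.amplitude β ^ 2)]
  refine mul_le_mul_of_nonneg_left (h1.trans_eq ?_) (by positivity)
  congr 2
  ring

end IsFundamental

end WaveguideArray

/-! ### A biorthogonal family, and coercivity of the Gram matrix -/

theorem strictMonoOn_besselI_zero : StrictMonoOn (besselI 0) (Set.Ici 0) := by
  refine strictMonoOn_of_deriv_pos (convex_Ici 0) (continuous_besselI 0).continuousOn fun x hx => ?_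
  rw [interior_Ici] at hx
  rw [(hasDerivAt_besselI_zero x).deriv]
  exact besselI_pos 1 hx

/-- As long as J₀ is positive, (x J₁)' = x J₀ makes x J₁ nondecreasing from its value 0 at the
origin. -/
theorem besselJ_one_nonneg {b : ℝ} (hb : ∀ x, 0 ≤ x → x ≤ b → 0 < besselJ 0 x) {x : ℝ} (hx : 0 < x)
    (hxb : x ≤ b) : 0 ≤ besselJ 1 x := by
  have h : MonotoneOn (fun x => x * besselJ 1 x) (Set.Icc 0 b) := by
    refine monotoneOn_of_deriv_nonneg (convex_Icc 0 b)
      (continuous_id.mul (continuous_besselJ 1)).continuousOn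
      (fun y _ => (hasDerivAt_mul_besselJ_one y).differentiableAt.differentiableWithinAt)
      fun y hy => ?_
    rw [interior_Icc] at hy
    rw [(hasDerivAt_mul_besselJ_one y).deriv]
    exact mul_nonneg hy.1.le (hb y hy.1.le hy.2.le).le
  have := h ⟨le_rfl, hx.le.trans hxb⟩ ⟨hx.le, hxb⟩ hx.le
  simp only [zero_mul] at this
  exact nonneg_of_mul_nonneg_right this hx

theorem antitoneOn_besselJ_zero {b : ℝ} (hb : ∀ x, 0 ≤ x → x ≤ b → 0 < besselJ 0 x) :
    AntitoneOn (besselJ 0) (Set.Icc 0 b) := by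
  refine antitoneOn_of_deriv_nonpos (convex_Icc 0 b) (continuous_besselJ 0).continuousOn
    (fun y _ => (hasDerivAt_besselJ_zero y).differentiableAt.differentiableWithinAt) fun y hy => ?_
  rw [interior_Icc] at hy
  rw [(hasDerivAt_besselJ_zero y).deriv, Left.neg_nonpos_iff]
  exact besselJ_one_nonneg hb hy.1 hy.2.le

theorem integrable_indicator_radial {h : ℝ → ℝ} {b : ℝ} (hh : Continuous h) (hb : 0 < b) :
    Integrable (fun p : ℝ × ℝ => (Set.Iic b).indicator h (√(p.1 ^ 2 + p.2 ^ 2))) ∧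
    ∫ p : ℝ × ℝ, (Set.Iic b).indicator h (√(p.1 ^ 2 + p.2 ^ 2)) =
      2 * Real.pi * ∫ r in 0..b, r * h r := by
  have e : (fun r => r * (Set.Iic b).indicator h r) = (Set.Iic b).indicator fun r => r * h r := by
    ext r
    by_cases hr : r ∈ Set.Iic b <;> simp [hr]
  have hi : IntegrableOn (fun r => r * h r) (Set.Ioc 0 b) :=
    ((continuous_id.mul hh).integrableOn_Icc).mono_set Set.Ioc_subset_Icc_self
  have h1 := integrable_radial (h := (Set.Iic b).indicator h) (hh.measurable.indicator measurableSet_Iic)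
    (by
      rw [e]
      rw [IntegrableOn, integrable_indicator_iff measurableSet_Iic, IntegrableOn,
        Measure.restrict_restrict measurableSet_Iic, Set.inter_comm, Set.Ioi_inter_Iic]
      exact hi)
  refine ⟨h1.1, h1.2.trans ?_⟩
  rw [e, setIntegral_indicator measurableSet_Iic, Set.Ioi_inter_Iic,
    intervalIntegral.integral_of_le hb.le]

namespace WaveguideArray

variable {W : WaveguideArray} {β : ℝ}

/-- There is a radial `ψ`, supported near the centre of a single core, which annihilates the tails
of all the other modes. -/
theorem IsFundamental.exists_dual (h : W.IsFundamental β) : ∃ (ψ : ℝ → ℝ) (C P : ℝ),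
    Measurable ψ ∧ (∀ r, 0 ≤ r → |ψ r| ≤ C * Real.exp (-W.Gam β * r)) ∧ 0 < P ∧
    ∫ p : ℝ × ℝ, ψ (√(p.1 ^ 2 + p.2 ^ 2)) * W.rawProfile β (√(p.1 ^ 2 + p.2 ^ 2)) = P ∧
    ∫ p : ℝ × ℝ, ψ (√(p.1 ^ 2 + p.2 ^ 2)) * ψ (√(p.1 ^ 2 + p.2 ^ 2)) = P ∧
    ∀ d, W.D ≤ d →
      ∫ p : ℝ × ℝ, ψ (√(p.1 ^ 2 + p.2 ^ 2)) * W.rawProfile β (√((p.1 - d) ^ 2 + p.2 ^ 2)) = 0 ∧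
      ∫ p : ℝ × ℝ, ψ (√(p.1 ^ 2 + p.2 ^ 2)) * ψ (√((p.1 - d) ^ 2 + p.2 ^ 2)) = 0 := by
  have ha := W.a_pos
  have haD := W.a_lt_D
  have hg := h.Gam_pos
  have hL := h.Lam_pos
  -- The disc of radius b lies inside the core, so φ is J₀(Λr) on it. Since 2b < D - a, its points
  -- are further than both a and b from every other centre: they see only the tails of the other
  -- modes, and the discs are disjoint.
  obtain ⟨b, hb, hba, hbD⟩ : ∃ b, 0 < b ∧ b < W.a ∧ 2 * b < W.D - W.a := by
    refine ⟨min W.a (W.D - W.a) / 3, ?_, ?_, ?_⟩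
    · have : 0 < min W.a (W.D - W.a) := lt_min ha (by linarith)
      positivity
    · have := min_le_left W.a (W.D - W.a); linarith
    · have := min_le_right W.a (W.D - W.a); linarith
  have hJc := continuous_besselJ 0
  have hIc := continuous_besselI 0
  set X : ℝ := ∫ r in 0..b, r * (besselI 0 (W.Gam β * r) * besselI 0 (W.Gam β * r)) with hX
  have hXpos : 0 < X := by
    refine intervalIntegral.intervalIntegral_pos_of_pos_on
      (Continuous.intervalIntegrable (by fun_prop) _ _) (fun r hr => ?_) hb
    have := besselI_zero_pos (W.Gam β * r)
    have := hr.1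
    positivity
  -- The projection coefficient in L²(r dr) on (0, b), chosen so that f = J₀(Λr) - τ I₀(Γr) is
  -- orthogonal to I₀(Γr). Consequently ⟨f, J₀⟩ = ⟨f, f⟩.
  set τ : ℝ := (∫ r in 0..b, r * (besselJ 0 (W.Lam β * r) * besselI 0 (W.Gam β * r))) / X with hτ
  have hτpos : 0 < τ := by
    refine div_pos (intervalIntegral.intervalIntegral_pos_of_pos_on
      (Continuous.intervalIntegrable (by fun_prop) _ _) (fun r hr => ?_) hb) hXpos
    have := besselI_zero_pos (W.Gam β * r)
    have := h.besselJ_core_pos hr.1.le (hr.2.le.trans hba.le)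
    have := hr.1
    positivity
  set f : ℝ → ℝ := fun r => besselJ 0 (W.Lam β * r) - τ * besselI 0 (W.Gam β * r) with hf
  have hfc : Continuous f := by fun_prop
  have hfI : ∫ r in 0..b, r * (f r * besselI 0 (W.Gam β * r)) = 0 := by
    have : ∀ r, r * (f r * besselI 0 (W.Gam β * r)) =
        r * (besselJ 0 (W.Lam β * r) * besselI 0 (W.Gam β * r)) -
        τ * (r * (besselI 0 (W.Gam β * r) * besselI 0 (W.Gam β * r))) := fun r => by
      simp only [hf]; ring
    simp_rw [this]
    rw [intervalIntegral.integral_sub (Continuous.intervalIntegrable (by fun_prop) _ _)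
      (Continuous.intervalIntegrable (by fun_prop) _ _), intervalIntegral.integral_const_mul, ← hX, hτ,
      div_mul_cancel₀ _ hXpos.ne', sub_self]
  have hfJ : ∫ r in 0..b, r * (f r * besselJ 0 (W.Lam β * r)) = ∫ r in 0..b, r * (f r * f r) := by
    have : ∀ r, r * (f r * besselJ 0 (W.Lam β * r)) =
        r * (f r * f r) + τ * (r * (f r * besselI 0 (W.Gam β * r))) := fun r => by
      simp only [hf]; ring
    simp_rw [this]
    rw [intervalIntegral.integral_add (Continuous.intervalIntegrable (by fun_prop) _ _)
      (Continuous.intervalIntegrable (by fun_prop) _ _), intervalIntegral.integral_const_mul, hfI]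
    ring
  -- J₀(Λr) is nonincreasing whereas τ I₀(Γr) is strictly increasing, so the two cannot agree at
  -- both b/2 and b.
  have hne : f (b / 2) ≠ 0 ∨ f b ≠ 0 := by
    by_contra! hcon
    have h1 : besselI 0 (W.Gam β * (b / 2)) < besselI 0 (W.Gam β * b) :=
      strictMonoOn_besselI_zero (Set.mem_Ici.2 (by positivity)) (Set.mem_Ici.2 (by positivity))
        (by gcongr; linarith)
    have h2 : besselJ 0 (W.Lam β * b) ≤ besselJ 0 (W.Lam β * (b / 2)) :=
      antitoneOn_besselJ_zero h.besselJ_pos ⟨by positivity, by gcongr; linarith⟩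
        ⟨by positivity, by gcongr⟩ (by gcongr; linarith)
    have h3 := hcon.1
    have h4 := hcon.2
    simp only [hf] at h3 h4
    nlinarith
  have hPpos : 0 < ∫ r in 0..b, r * (f r * f r) := by
    have hnn : ∀ r ∈ Set.Ioc 0 b, 0 ≤ r * (f r * f r) := fun r hr =>
      mul_nonneg hr.1.le (mul_self_nonneg _)
    refine intervalIntegral.integral_pos hb (by fun_prop) hnn ?_
    rcases hne with hne | hne
    · exact ⟨b / 2, ⟨by positivity, by linarith⟩, by have := mul_self_pos.2 hne; positivity⟩
    · exact ⟨b, ⟨hb.le, le_rfl⟩, by have := mul_self_pos.2 hne; positivity⟩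
  set ψ : ℝ → ℝ := (Set.Iic b).indicator f with hψ
  have hψm : Measurable ψ := hfc.measurable.indicator measurableSet_Iic
  have hψ0 : ∀ r, b < r → ψ r = 0 := fun r hr => Set.indicator_of_notMem (by simpa using hr) _
  have hψf : ∀ r, r ≤ b → ψ r = f r := fun r hr => Set.indicator_of_mem (Set.mem_Iic.2 hr) _
  obtain ⟨M, hM⟩ := isCompact_Icc.exists_bound_of_continuousOn (hfc.continuousOn (s := Set.Icc 0 b))
  have hM0 : 0 ≤ M := (norm_nonneg _).trans (hM 0 ⟨le_rfl, hb.le⟩)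
  have hfar : ∀ d, W.D ≤ d → ∀ p : ℝ × ℝ, √(p.1 ^ 2 + p.2 ^ 2) ≤ b →
      W.a < √((p.1 - d) ^ 2 + p.2 ^ 2) ∧ b < √((p.1 - d) ^ 2 + p.2 ^ 2) := fun d hd p hp => by
    have h1 := abs_sub_le_radius_add d 0 p
    rw [sub_zero, sub_zero, abs_of_pos (by linarith)] at h1
    constructor <;> linarith
  refine ⟨ψ, M * Real.exp (W.Gam β * b), 2 * Real.pi * ∫ r in 0..b, r * (f r * f r), hψm,
    fun r hr => ?_, by have := Real.pi_pos; positivity, ?_, ?_, fun d hd => ⟨?_, ?_⟩⟩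
  · rcases le_or_gt r b with hrb | hrb
    · rw [hψf r hrb, mul_assoc, ← Real.exp_add]
      refine (hM r ⟨hr, hrb⟩).trans (le_mul_of_one_le_right hM0 (Real.one_le_exp ?_))
      nlinarith
    · rw [hψ0 r hrb, abs_zero]
      positivity
  · rw [← hfJ, ← (integrable_indicator_radial (h := fun r => f r * besselJ 0 (W.Lam β * r))
      (by fun_prop) hb).2]
    congr 1; ext p
    rcases le_or_gt (√(p.1 ^ 2 + p.2 ^ 2)) b with hp | hp
    · rw [hψf _ hp, rawProfile, if_pos (hp.trans hba.le), Set.indicator_of_mem (Set.mem_Iic.2 hp)]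
    · rw [hψ0 _ hp, Set.indicator_of_notMem (by simpa using hp), zero_mul]
  · rw [← (integrable_indicator_radial (h := fun r => f r * f r) (by fun_prop) hb).2]
    congr 1; ext p
    rcases le_or_gt (√(p.1 ^ 2 + p.2 ^ 2)) b with hp | hp
    · rw [hψf _ hp, Set.indicator_of_mem (Set.mem_Iic.2 hp)]
    · rw [hψ0 _ hp, Set.indicator_of_notMem (by simpa using hp), zero_mul]
  · have hi : IntegrableOn (fun r => r * f r * besselI 0 (W.Gam β * r)) (Set.Ioc 0 b) :=
      (Continuous.integrableOn_Icc (by fun_prop)).mono_set Set.Ioc_subset_Icc_self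
    have h1 := (integral_indicator_radial_mul_besselK hfc.measurable hg hb
      (by linarith : b ≤ d) hi).2
    rw [← intervalIntegral.integral_of_le hb.le] at h1
    simp_rw [mul_assoc _ (f _)] at h1
    rw [hfI, mul_zero] at h1
    rw [← mul_zero (besselJ 0 (W.Lam β * W.a) / besselK 0 (W.Gam β * W.a)), ← h1,
      ← integral_const_mul]
    congr 1; ext p
    rcases le_or_gt (√(p.1 ^ 2 + p.2 ^ 2)) b with hp | hp
    · rw [rawProfile, if_neg (hfar d hd p hp).1.not_ge]
      ring
    · rw [hψ0 _ hp, zero_mul, ← hψ, hψ0 _ hp, zero_mul, mul_zero]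
  · rw [← integral_zero (ℝ × ℝ) ℝ]
    congr 1; ext p
    rcases le_or_gt (√(p.1 ^ 2 + p.2 ^ 2)) b with hp | hp
    · rw [hψ0 _ (hfar d hd p hp).2, mul_zero]
    · rw [hψ0 _ hp, zero_mul]

theorem natAbs_mul_D_ge (W : WaveguideArray) {n m : ℤ} (hnm : n ≠ m) : W.D ≤ |n * W.D - m * W.D| := by
  have hD : 0 < W.D := W.a_pos.trans W.a_lt_D
  rw [← sub_mul, abs_mul, abs_of_pos hD]
  have h1 : (1 : ℤ) ≤ |n - m| := Int.one_le_abs (sub_ne_zero.2 hnm)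
  have h2 : (1 : ℝ) ≤ |(n : ℝ) - m| := by exact_mod_cast h1
  nlinarith

/-- Take uₙ = A(φₙ - ψₙ). All three pairings involving ψ equal P δₙₘ, so subtracting ψ changes the
Gram matrix by A²(P - P - P)δₙₘ = -A²P δₙₘ. -/
theorem IsFundamental.exists_gram (h : W.IsFundamental β) :
    ∃ (u : ℤ → ℝ × ℝ → ℝ) (δ : ℝ), 0 < δ ∧ (∀ n m, Integrable fun p => u n p * u m p) ∧
      ∀ n m, ∫ p, u n p * u m p = W.S β (n - m).natAbs - if n = m then δ else 0 := by
  obtain ⟨ψ, C, P, hψm, hψC, hP, h1, h2, h3⟩ := h.exists_dual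
  obtain ⟨C', -, hC'⟩ := h.exists_rawProfile_le
  have hg := h.Gam_pos
  have hA := h.amplitude_pos
  have hrm := W.measurable_rawProfile β
  set φ := W.rawProfile β
  set rad : ℤ → ℝ × ℝ → ℝ := fun n p => √((p.1 - n * W.D) ^ 2 + p.2 ^ 2) with hrad
  have iφψ : ∀ n m, Integrable fun p => φ (rad n p) * ψ (rad m p) := fun n m => integrable_mul_of_exp_decay hg hrm hψm hC' hψC (n * W.D) (m * W.D)
  have iψφ : ∀ n m, Integrable fun p => ψ (rad n p) * φ (rad m p) := fun n m => integrable_mul_of_exp_decay hg hψm hrm hψC hC' (n * W.D) (m * W.D)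
  have iψψ : ∀ n m, Integrable fun p => ψ (rad n p) * ψ (rad m p) := fun n m => integrable_mul_of_exp_decay hg hψm hψm hψC hψC (n * W.D) (m * W.D)
  have idiff : ∀ n m, Integrable fun p => ψ (rad n p) * ψ (rad m p) - φ (rad n p) * ψ (rad m p) :=
    fun n m => (iψψ n m).sub (iφψ n m)
  have vψφ : ∀ n m : ℤ, ∫ p, ψ (rad n p) * φ (rad m p) = if n = m then P else 0 := fun n m => by
    simp only [hrad]
    rw [integral_radial_mul_translate]
    split_ifs with hnm
    · simp only [hnm, sub_self, abs_zero, sub_zero]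
      exact h1
    · exact (h3 _ (W.natAbs_mul_D_ge hnm)).1
  have vφψ : ∀ n m : ℤ, ∫ p, φ (rad n p) * ψ (rad m p) = if n = m then P else 0 := fun n m => by
    simp_rw [mul_comm (φ _), vψφ m n, eq_comm]
  have vψψ : ∀ n m : ℤ, ∫ p, ψ (rad n p) * ψ (rad m p) = if n = m then P else 0 := fun n m => by
    simp only [hrad]
    rw [integral_radial_mul_translate]
    split_ifs with hnm
    · simp only [hnm, sub_self, abs_zero, sub_zero]
      exact h2
    · exact (h3 _ (W.natAbs_mul_D_ge hnm)).2
  have expand : ∀ (n m : ℤ) (p : ℝ × ℝ),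
      W.amplitude β * (φ (rad n p) - ψ (rad n p)) * (W.amplitude β * (φ (rad m p) - ψ (rad m p))) =
      W.mode β n p * W.mode β m p + W.amplitude β ^ 2 * (ψ (rad n p) * ψ (rad m p)
        - φ (rad n p) * ψ (rad m p) - ψ (rad n p) * φ (rad m p)) := fun n m p => by
    simp only [mode, hrad, φ]
    ring
  have i3 : ∀ n m, Integrable fun p => W.amplitude β ^ 2 * (ψ (rad n p) * ψ (rad m p)
        - φ (rad n p) * ψ (rad m p) - ψ (rad n p) * φ (rad m p)) := fun n m =>
    (((iψψ n m).sub (iφψ n m)).sub (iψφ n m)).const_mul _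
  refine ⟨fun n p => W.amplitude β * (φ (rad n p) - ψ (rad n p)), W.amplitude β ^ 2 * P,
    by positivity, fun n m => ?_, fun n m => ?_⟩
  · simp_rw [expand]
    exact (h.integrable_mode_mul n m).add (i3 n m)
  · simp_rw [expand]
    rw [integral_add (h.integrable_mode_mul n m) (i3 n m), integral_mode_mul_eq_S,
      integral_const_mul, integral_sub (idiff n m) (iψφ n m),
      integral_sub (iψψ n m) (iφψ n m), vψψ, vφψ, vψφ]
    split_ifs <;> ring

/-- Expand 0 ≤ ‖∑ xₙ uₙ‖² with the Gram matrix of the family from `exists_gram`. -/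
theorem IsFundamental.exists_quadratic_lower_bound (h : W.IsFundamental β) :
    ∃ δ : ℝ, 0 < δ ∧ ∀ (F : Finset ℤ) (x : ℤ → ℝ),
      δ * ∑ n ∈ F, x n ^ 2 ≤ ∑ n ∈ F, ∑ m ∈ F, W.S β (n - m).natAbs * x m * x n := by
  obtain ⟨u, δ, hδ, hi, hu⟩ := h.exists_gram
  refine ⟨δ, hδ, fun F x => ?_⟩
  have h0 : 0 ≤ ∫ p, (∑ n ∈ F, x n * u n p) * (∑ m ∈ F, x m * u m p) :=
    integral_nonneg fun p => mul_self_nonneg _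
  have h1 : ∀ p, (∑ n ∈ F, x n * u n p) * (∑ m ∈ F, x m * u m p) =
      ∑ n ∈ F, ∑ m ∈ F, x n * x m * (u n p * u m p) := fun p => by
    rw [Finset.sum_mul_sum]
    exact Finset.sum_congr rfl fun n _ => Finset.sum_congr rfl fun m _ => by ring
  simp_rw [h1] at h0
  rw [integral_finsetSum _ fun n _ => integrable_finsetSum _ fun m _ => (hi n m).const_mul _] at h0
  simp_rw [integral_finsetSum F fun m _ => (hi _ m).const_mul _, integral_const_mul, hu, mul_sub,
    Finset.sum_sub_distrib] at h0
  have h2 : ∑ n ∈ F, ∑ m ∈ F, x n * x m * (if n = m then δ else 0) = δ * ∑ n ∈ F, x n ^ 2 := by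
    rw [Finset.mul_sum]
    refine Finset.sum_congr rfl fun n hn => ?_
    rw [Finset.sum_eq_single n (fun m _ hm => by simp [hm.symm]) (fun h => absurd hn h)]
    simp; ring
  have h3 : ∑ n ∈ F, ∑ m ∈ F, W.S β (n - m).natAbs * x m * x n =
      ∑ n ∈ F, ∑ m ∈ F, x n * x m * W.S β (n - m).natAbs :=
    Finset.sum_congr rfl fun n _ => Finset.sum_congr rfl fun m _ => by ring
  rw [h3]
  linarith

end WaveguideArray

/-! ### Convolution operators on `ℓ²(ℤ; ℂ)` -/

theorem memℓp_shift (c : EllTwo) (k : ℤ) : Memℓp (fun n => c (n - k)) 2 := by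
  have h := (lp.memℓp c).summable (by norm_num)
  exact memℓp_gen ((Equiv.subRight k).summable_iff.2 h)

/-- The shift by `k` on `ℓ²(ℤ; ℂ)`. -/
noncomputable def shift (k : ℤ) : EllTwo →L[ℂ] EllTwo :=
  LinearMap.mkContinuous
    { toFun := fun c => ⟨fun n => c (n - k), memℓp_shift c k⟩
      map_add' := fun c d => by ext n; rfl
      map_smul' := fun a c => by ext n; rfl } 1 fun c => by
    have hp : 0 < (2 : ENNReal).toReal := by norm_num
    rw [one_mul, lp.norm_eq_tsum_rpow hp, lp.norm_eq_tsum_rpow hp]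
    exact le_of_eq (congrArg (· ^ (1 / (2 : ENNReal).toReal))
      ((Equiv.subRight k).tsum_eq fun n => ‖c n‖ ^ (2 : ENNReal).toReal))

theorem norm_shift_le (k : ℤ) : ‖shift k‖ ≤ 1 := LinearMap.mkContinuous_norm_le _ zero_le_one _

/-- The operator is ∑ aₖ · shift k. The shifts are contractions, so the series converges absolutely
in operator norm with sum of norm at most ∑ aₖ. -/
theorem exists_convolution {a : ℤ → ℝ} (ha : Summable a) (ha0 : ∀ k, 0 ≤ a k) :
    ∃ R : EllTwo →L[ℂ] EllTwo,
      (∀ (c : EllTwo) (n : ℤ), HasSum (fun m : ℤ => (a (n - m) : ℂ) * c m) (R c n)) ∧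
      ‖R‖ ≤ ∑' k, a k := by
  have hb : ∀ k, ‖(a k : ℂ) • shift k‖ ≤ a k := fun k => by
    rw [norm_smul, Complex.norm_real, Real.norm_of_nonneg (ha0 k)]
    exact mul_le_of_le_one_right (ha0 k) (norm_shift_le k)
  have hs : Summable fun k => (a k : ℂ) • shift k := Summable.of_norm_bounded ha hb
  refine ⟨∑' k, (a k : ℂ) • shift k, fun c n => ?_, tsum_of_norm_bounded ha.hasSum hb⟩
  have h1 := (hs.hasSum.mapL (ContinuousLinearMap.apply ℂ EllTwo c)).mapL
    (lp.evalCLM ℂ (fun _ : ℤ => ℂ) 2 n)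
  refine ((Equiv.subLeft n).hasSum_iff (f := fun m : ℤ => (a (n - m) : ℂ) * c m)).1 ?_
  have e : ((fun m : ℤ => (a (n - m) : ℂ) * c m) ∘ Equiv.subLeft n) =
      fun k => lp.evalCLM ℂ (fun _ : ℤ => ℂ) 2 n
        (ContinuousLinearMap.apply ℂ EllTwo c ((a k : ℂ) • shift k)) := by
    ext k
    change (a (n - (n - k)) : ℂ) * c (n - k) = (a k : ℂ) * c (n - k)
    rw [sub_sub_cancel]
  rw [e]
  exact h1

theorem re_inner_sum_eq (z w : ℂ) : (inner ℂ z w).re = z.re * w.re + z.im * w.im := by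
  rw [RCLike.inner_apply]
  simp [Complex.mul_re]
  ring

/-- For a finitely supported vector the real quadratic bound is applied separately to real and
imaginary parts, since the matrix entries are real. Truncations converge in ℓ², so the bound passes
to all vectors by continuity, and coercivity gives invertibility. -/
theorem isUnit_of_quadratic_lower_bound {s : ℤ → ℝ} {T : EllTwo →L[ℂ] EllTwo}
    (hT : ∀ (c : EllTwo) (n : ℤ), HasSum (fun m : ℤ => (s (n - m) : ℂ) * c m) (T c n)) {δ : ℝ}
    (hδ : 0 < δ) (hs : ∀ (F : Finset ℤ) (x : ℤ → ℝ),
      δ * ∑ n ∈ F, x n ^ 2 ≤ ∑ n ∈ F, ∑ m ∈ F, s (n - m) * x m * x n) : IsUnit T := by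
  have hfin : ∀ (c : EllTwo) (F : Finset ℤ), δ * ‖∑ i ∈ F, lp.single 2 i (c i)‖ ^ 2 ≤
      (inner ℂ (T (∑ i ∈ F, lp.single 2 i (c i))) (∑ i ∈ F, lp.single 2 i (c i))).re := fun c F => by
    set v : EllTwo := ∑ i ∈ F, lp.single 2 i (c i) with hv
    have hvapp : ∀ m, v m = if m ∈ F then c m else 0 := fun m => by
      simp only [hv, lp.coeFn_sum, lp.coeFn_single, Finset.sum_apply, Finset.sum_pi_single]
    have hTv : ∀ n, T v n = ∑ m ∈ F, (s (n - m) : ℂ) * c m := fun n => by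
      refine (hT v n).unique ?_
      have : HasSum (fun m : ℤ => (s (n - m) : ℂ) * v m) (∑ m ∈ F, (s (n - m) : ℂ) * v m) :=
        hasSum_sum_of_ne_finset_zero (f := fun m : ℤ => (s (n - m) : ℂ) * v m) (s := F)
          (fun m hm => by rw [hvapp, if_neg hm, mul_zero])
      convert this using 1
      exact Finset.sum_congr rfl fun m hm => by rw [hvapp, if_pos hm]
    have hnorm : ‖v‖ ^ 2 = ∑ n ∈ F, (c n).re ^ 2 + ∑ n ∈ F, (c n).im ^ 2 := by
      have := lp.norm_sum_single (p := 2) (by norm_num) (fun i => c i) F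
      simp only [ENNReal.toReal_ofNat, Real.rpow_two] at this
      rw [hv, this, ← Finset.sum_add_distrib]
      exact Finset.sum_congr rfl fun n _ => by
        rw [← Complex.normSq_eq_norm_sq, Complex.normSq_apply]; ring
    have hinner : (inner ℂ (T v) v).re =
        ∑ n ∈ F, ∑ m ∈ F, s (n - m) * (c m).re * (c n).re +
        ∑ n ∈ F, ∑ m ∈ F, s (n - m) * (c m).im * (c n).im := by
      nth_rewrite 2 [hv]
      rw [inner_sum, Complex.re_sum, ← Finset.sum_add_distrib]
      refine Finset.sum_congr rfl fun n _ => ?_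
      rw [lp.inner_single_right, re_inner_sum_eq, hTv, Complex.re_sum, Complex.im_sum,
        Finset.sum_mul, Finset.sum_mul]
      simp [Complex.mul_re, Complex.mul_im]
    rw [hnorm, hinner, mul_add]
    exact add_le_add (hs F _) (hs F _)
  have hall : ∀ c : EllTwo, δ * ‖c‖ ^ 2 ≤ (inner ℂ (T c) c).re := fun c => by
    have hlim := lp.hasSum_single (p := 2) (by norm_num) c
    have h1 : Continuous fun c : EllTwo => δ * ‖c‖ ^ 2 := by fun_prop
    have h2 : Continuous fun c : EllTwo => (inner ℂ (T c) c).re :=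
      Complex.continuous_re.comp (T.continuous.inner continuous_id)
    exact le_of_tendsto_of_tendsto' ((h1.tendsto c).comp hlim) ((h2.tendsto c).comp hlim) (hfin c)
  refine ContinuousLinearMap.isUnit_of_forall_le_norm_inner_map T (c := ⟨δ, hδ.le⟩) hδ fun c => ?_
  rw [mul_comm]
  exact (hall c).trans (Complex.re_le_norm _)

theorem hasSum_int_natAbs {f : ℕ → ℝ} (hf : Summable f) :
    HasSum (fun k : ℤ => if k = 0 then 0 else f k.natAbs) (2 * ∑' ξ : ℕ, f (ξ + 1)) := by
  set g : ℤ → ℝ := fun k => if k = 0 then 0 else f k.natAbs with hg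
  have hg1 : ∀ n : ℕ, g ((n : ℤ) + 1) = f (n + 1) := fun n => by
    simp only [hg]
    rw [if_neg (by omega)]
    congr 1
  have hg2 : ∀ n : ℕ, g (-((n : ℤ) + 1)) = f (n + 1) := fun n => by
    simp only [hg]
    rw [if_neg (by omega)]
    congr 1
  have h1 : HasSum (fun ξ : ℕ => f (ξ + 1)) (∑' ξ : ℕ, f (ξ + 1)) :=
    ((summable_nat_add_iff 1).2 hf).hasSum
  have h2 : HasSum (fun n : ℕ => g n) (∑' ξ : ℕ, f (ξ + 1)) := by
    have h0 : HasSum (fun n : ℕ => g ((n + 1 : ℕ) : ℤ)) (∑' ξ : ℕ, f (ξ + 1)) := by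
      simpa only [Nat.cast_add, Nat.cast_one, hg1] using h1
    have := (hasSum_nat_add_iff (f := fun n : ℕ => g n) 1).1 h0
    simpa [hg] using this
  have h3 : HasSum (fun n : ℕ => g (-((n : ℤ) + 1))) (∑' ξ : ℕ, f (ξ + 1)) := by
    simpa only [hg2] using h1
  rw [two_mul]
  exact HasSum.of_nat_of_neg_add_one h2 h3

namespace WaveguideArray

theorem exists_gram_operator {W : WaveguideArray} {β : ℝ} (h : W.IsFundamental β) :
    ∃ 𝒮 ℛ : EllTwo →L[ℂ] EllTwo,
      (∀ (c : EllTwo) (n : ℤ),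
        HasSum (fun m : ℤ => (W.S β (n - m).natAbs : ℂ) * c m) (𝒮 c n)) ∧
      (∀ (c : EllTwo) (n : ℤ),
        HasSum (fun m : ℤ => if m = n then 0 else (W.S β (n - m).natAbs : ℂ) * c m) (ℛ c n)) ∧
      𝒮 = 1 + ℛ ∧
      ‖ℛ‖ ≤ 2 * ∑' ξ : ℕ, W.S β (ξ + 1) ∧
      IsUnit 𝒮 := by
  have hsum := hasSum_int_natAbs h.summable_S
  obtain ⟨R, hR, hRn⟩ := exists_convolution hsum.summable fun k => by
    split_ifs
    exacts [le_rfl, h.S_nonneg _]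
  have hR' : ∀ (c : EllTwo) (n : ℤ),
      HasSum (fun m : ℤ => if m = n then 0 else (W.S β (n - m).natAbs : ℂ) * c m) (R c n) := by
    intro c n
    convert hR c n using 2 with m
    by_cases hmn : m = n
    · simp [hmn]
    · rw [if_neg hmn, if_neg (by omega)]
  have hS : ∀ (c : EllTwo) (n : ℤ),
      HasSum (fun m : ℤ => (W.S β (n - m).natAbs : ℂ) * c m) ((1 + R) c n) := by
    intro c n
    -- The missing diagonal term is S₀ cₙ, and S₀ = 1 by the normalization of the mode.
    have := (hasSum_ite_eq n (c n)).add (hR' c n)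
    change HasSum _ (c n + R c n)
    convert this using 1
    ext m
    by_cases hmn : m = n
    · simp [hmn, h.S_zero]
    · simp [hmn]
  obtain ⟨δ, hδ, hq⟩ := h.exists_quadratic_lower_bound
  exact ⟨1 + R, R, hS, hR', rfl, hsum.tsum_eq ▸ hRn,
    isUnit_of_quadratic_lower_bound (s := fun k => W.S β k.natAbs) hS hδ hq⟩

end WaveguideArray

/-! ### Closed form of the overlap integrals -/

namespace WaveguideArray

variable {W : WaveguideArray} {β : ℝ}

/-- The ratio of the amplitudes in the cladding and in the core. -/
noncomputable def claddingRatio (W : WaveguideArray) (β : ℝ) : ℝ :=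
  besselJ 0 (W.Lam β * W.a) / besselK 0 (W.Gam β * W.a)

namespace IsFundamental

theorem claddingRatio_pos (h : W.IsFundamental β) : 0 < W.claddingRatio β :=
  div_pos h.besselJ_edge_pos h.besselK_edge_pos

theorem claddingRatio_mul (h : W.IsFundamental β) :
    W.claddingRatio β * besselK 0 (W.Gam β * W.a) = besselJ 0 (W.Lam β * W.a) :=
  div_mul_cancel₀ _ h.besselK_edge_pos.ne'

/-- The characteristic equation is the matching of radial derivatives at r = a. Together with the
matching of values in `claddingRatio_mul` it trades J at the edge for K. -/
theorem Lam_mul_besselJ_one (h : W.IsFundamental β) :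
    W.Lam β * besselJ 1 (W.Lam β * W.a) =
      W.claddingRatio β * (W.Gam β * besselK 1 (W.Gam β * W.a)) := by
  have h1 := h.characteristic
  have h2 := h.besselJ_edge_pos
  have h3 := h.besselK_edge_pos
  rw [div_eq_div_iff h2.ne' h3.ne'] at h1
  rw [claddingRatio, div_mul_eq_mul_div, eq_div_iff h3.ne', h1]
  ring

/-- Matching of values cancels J₀² against c²K₀², leaving πa²(J₁² + c²K₁²); matching of derivatives
then expresses J₁ through K₁. -/
theorem normSq_eq (h : W.IsFundamental β) :
    W.normSq β = Real.pi * W.a ^ 2 * W.claddingRatio β ^ 2 * besselK 1 (W.Gam β * W.a) ^ 2 *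
      (W.Lam β ^ 2 + W.Gam β ^ 2) / W.Lam β ^ 2 := by
  have ha := W.a_pos
  have hg := h.Gam_pos
  have hL := h.Lam_pos
  have hJc := continuous_besselJ 0
  obtain ⟨k1, k2⟩ := integral_besselK_sq hg ha
  set f : ℝ → ℝ := fun r => r * W.rawProfile β r ^ 2 with hf
  have e1 : Set.EqOn (fun r => r * besselJ 0 (W.Lam β * r) ^ 2) f (Set.Ioc 0 W.a) := fun r hr => by
    simp only [hf]
    rw [rawProfile, if_pos hr.2]
  have e2 : Set.EqOn (fun r => W.claddingRatio β ^ 2 * (r * besselK 0 (W.Gam β * r) ^ 2)) f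
      (Set.Ioi W.a) := fun r hr => by
    simp only [hf]
    rw [rawProfile, if_neg (not_le.2 hr), claddingRatio]
    ring
  have i1 : IntegrableOn f (Set.Ioc 0 W.a) := IntegrableOn.congr_fun
    ((Continuous.integrableOn_Icc (by fun_prop)).mono_set Set.Ioc_subset_Icc_self) e1 measurableSet_Ioc
  have i2 : IntegrableOn f (Set.Ioi W.a) :=
    IntegrableOn.congr_fun (k1.const_mul _) e2 measurableSet_Ioi
  have hu : Set.Ioi (0 : ℝ) = Set.Ioc 0 W.a ∪ Set.Ioi W.a := (Set.Ioc_union_Ioi_eq_Ioi ha.le).symm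
  have i3 : IntegrableOn f (Set.Ioi 0) := by
    rw [hu]
    exact i1.union i2
  rw [normSq, (integrable_radial (h := fun r => W.rawProfile β r ^ 2)
    ((W.measurable_rawProfile β).pow_const 2) i3).2]
  change 2 * Real.pi * ∫ r in Set.Ioi 0, f r = _
  rw [hu, setIntegral_union (Set.Ioc_disjoint_Ioi le_rfl) measurableSet_Ioi i1 i2,
    ← setIntegral_congr_fun measurableSet_Ioc e1, ← setIntegral_congr_fun measurableSet_Ioi e2,
    integral_const_mul, k2, ← intervalIntegral.integral_of_le ha.le, integral_besselJ_sq hL,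
    ← h.claddingRatio_mul, eq_div_iff (by positivity)]
  linear_combination (Real.pi * W.a ^ 2 * (W.Lam β * besselJ 1 (W.Lam β * W.a) +
      W.claddingRatio β * (W.Gam β * besselK 1 (W.Gam β * W.a)))) * h.Lam_mul_besselJ_one

/-- The difference between the profile and its singular extension from the cladding. -/
noncomputable def _root_.WaveguideArray.coreDefect (W : WaveguideArray) (β : ℝ) : ℝ → ℝ :=
  (Set.Iic W.a).indicator fun r =>
    besselJ 0 (W.Lam β * r) - W.claddingRatio β * besselK 0 (W.Gam β * r)

theorem _root_.WaveguideArray.rawProfile_eq (W : WaveguideArray) (β r : ℝ) :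
    W.rawProfile β r = W.claddingRatio β * besselK 0 (W.Gam β * r) + W.coreDefect β r := by
  unfold rawProfile coreDefect
  split_ifs with hr
  · rw [Set.indicator_of_mem (Set.mem_Iic.2 hr)]; ring
  · rw [Set.indicator_of_notMem (by simpa using hr), claddingRatio, add_zero]

/-- Only the I₀-moment of the defect matters. In its J₀ part the two matching conditions produce the
Wronskian of I₀ and K₀ at Γa, so the boundary term collapses to the cladding ratio. -/
theorem integral_coreDefect_mul (h : W.IsFundamental β) {d : ℝ} (hd : W.a ≤ d) :
    Integrable (fun p : ℝ × ℝ => W.coreDefect β (√(p.1 ^ 2 + p.2 ^ 2)) *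
      besselK 0 (W.Gam β * √((p.1 - d) ^ 2 + p.2 ^ 2))) ∧
    ∫ p : ℝ × ℝ, W.coreDefect β (√(p.1 ^ 2 + p.2 ^ 2)) *
      besselK 0 (W.Gam β * √((p.1 - d) ^ 2 + p.2 ^ 2)) =
      2 * Real.pi * W.claddingRatio β * besselK 0 (W.Gam β * d) * (1 / (W.Lam β ^ 2 + W.Gam β ^ 2)
        - W.a ^ 2 / 2 * (besselI 0 (W.Gam β * W.a) * besselK 0 (W.Gam β * W.a)
          + besselI 1 (W.Gam β * W.a) * besselK 1 (W.Gam β * W.a))) := by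
  have ha := W.a_pos
  have hg := h.Gam_pos
  have hL := h.Lam_pos
  have hJc := continuous_besselJ 0
  have hIc := continuous_besselI 0
  have hKm := measurable_besselK 0
  obtain ⟨k1, k2⟩ := integral_besselK_mul_besselI hg ha
  have hj : IntegrableOn (fun r => r * besselJ 0 (W.Lam β * r) * besselI 0 (W.Gam β * r))
      (Set.Ioc 0 W.a) :=
    (Continuous.integrableOn_Icc (by fun_prop)).mono_set Set.Ioc_subset_Icc_self
  have e : ∀ r, r * (besselJ 0 (W.Lam β * r) - W.claddingRatio β * besselK 0 (W.Gam β * r))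
      * besselI 0 (W.Gam β * r) = r * besselJ 0 (W.Lam β * r) * besselI 0 (W.Gam β * r)
      - W.claddingRatio β * (r * besselK 0 (W.Gam β * r) * besselI 0 (W.Gam β * r)) :=
    fun r => by ring
  have hm : Measurable fun r =>
      besselJ 0 (W.Lam β * r) - W.claddingRatio β * besselK 0 (W.Gam β * r) := by
    have := hJc.measurable
    fun_prop
  have key := integral_indicator_radial_mul_besselK hm hg ha hd (by
    simp_rw [e]
    exact hj.sub (k1.const_mul _))
  refine ⟨key.1, key.2.trans ?_⟩
  simp_rw [e]
  rw [integral_sub hj (k1.const_mul _), integral_const_mul, k2,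
    ← intervalIntegral.integral_of_le ha.le, integral_besselJ_mul_besselI hL hg]
  have hW := besselI_mul_besselK_add (mul_pos hg ha)
  have e2 : W.Lam β * W.a * besselJ 1 (W.Lam β * W.a) * besselI 0 (W.Gam β * W.a)
      + W.Gam β * W.a * besselI 1 (W.Gam β * W.a) * besselJ 0 (W.Lam β * W.a) =
      W.claddingRatio β := by
    rw [eq_div_iff (by positivity)] at hW
    rw [← h.claddingRatio_mul]
    linear_combination (W.a * besselI 0 (W.Gam β * W.a)) * h.Lam_mul_besselJ_one
      + W.claddingRatio β * hW
  rw [e2]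
  ring

/-- With φ = cK₀(Γr) + χ, the product of two shifted modes has four terms. The condition 2a < D
separates the supports of the two copies of χ and kills χχ; the two cross terms are equal by
reflection; the K₀K₀ term is `integral_besselK_mul_besselK`. -/
theorem S_eq (h : W.IsFundamental β) (haD : 2 * W.a < W.D) {ξ : ℕ} (hξ : 1 ≤ ξ) :
    W.S β ξ = W.Lam β ^ 2 / (W.a ^ 2 * besselK 1 (W.Gam β * W.a) ^ 2 *
        (W.Lam β ^ 2 + W.Gam β ^ 2)) *
      (ξ * W.D / W.Gam β * besselK 1 (W.Gam β * (ξ * W.D)) +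
        4 * besselK 0 (W.Gam β * (ξ * W.D)) * (1 / (W.Lam β ^ 2 + W.Gam β ^ 2)
        - W.a ^ 2 / 2 * (besselI 0 (W.Gam β * W.a) * besselK 0 (W.Gam β * W.a)
          + besselI 1 (W.Gam β * W.a) * besselK 1 (W.Gam β * W.a)))) := by
  have ha := W.a_pos
  have hg := h.Gam_pos
  have hL := h.Lam_pos
  have hD : 0 < W.D := by linarith
  set d : ℝ := ξ * W.D with hd
  have hξ' : (1 : ℝ) ≤ ξ := by exact_mod_cast hξ
  have hDd : W.D ≤ d := by nlinarith
  obtain ⟨i1, v1⟩ := integral_besselK_mul_besselK hg (hD.trans_le hDd)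
  obtain ⟨i2, v2⟩ := h.integral_coreDefect_mul (by linarith : W.a ≤ d)
  set K : ℝ → ℝ := fun r => besselK 0 (W.Gam β * r)
  set χ : ℝ → ℝ := W.coreDefect β
  set c : ℝ := W.claddingRatio β
  set H : ℝ × ℝ → ℝ := fun p => χ (√(p.1 ^ 2 + p.2 ^ 2)) * K (√((p.1 - d) ^ 2 + p.2 ^ 2)) with hH
  -- The map p ↦ (d, 0) - p exchanges the two centres.
  have e3 : ∀ p : ℝ × ℝ, K (√(p.1 ^ 2 + p.2 ^ 2)) * χ (√((p.1 - d) ^ 2 + p.2 ^ 2)) =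
      H ((d, 0) - p) := fun p => by
    simp only [hH, Prod.fst_sub, Prod.snd_sub]
    rw [mul_comm]
    congr 3 <;> ring
  have i3 : Integrable fun p : ℝ × ℝ =>
      K (√(p.1 ^ 2 + p.2 ^ 2)) * χ (√((p.1 - d) ^ 2 + p.2 ^ 2)) := by
    simp_rw [e3]
    exact i2.comp_sub_left (d, 0)
  have v3 : ∫ p : ℝ × ℝ, K (√(p.1 ^ 2 + p.2 ^ 2)) * χ (√((p.1 - d) ^ 2 + p.2 ^ 2)) =
      ∫ p, H p := by
    simp_rw [e3]
    exact integral_sub_left_eq_self H volume (d, 0)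
  have expand : ∀ p : ℝ × ℝ, W.rawProfile β (√(p.1 ^ 2 + p.2 ^ 2)) *
      W.rawProfile β (√((p.1 - d) ^ 2 + p.2 ^ 2)) =
      c ^ 2 * (K (√(p.1 ^ 2 + p.2 ^ 2)) * K (√((p.1 - d) ^ 2 + p.2 ^ 2))) +
      c * (H p + K (√(p.1 ^ 2 + p.2 ^ 2)) * χ (√((p.1 - d) ^ 2 + p.2 ^ 2))) := fun p => by
    have hz : χ (√(p.1 ^ 2 + p.2 ^ 2)) * χ (√((p.1 - d) ^ 2 + p.2 ^ 2)) = 0 := by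
      have h1 := abs_sub_le_radius_add 0 d p
      rw [sub_zero, zero_sub, abs_neg, abs_of_pos (by linarith)] at h1
      rcases le_or_gt (√(p.1 ^ 2 + p.2 ^ 2)) W.a with hp | hp
      · have : χ (√((p.1 - d) ^ 2 + p.2 ^ 2)) = 0 :=
          Set.indicator_of_notMem (by simp only [Set.mem_Iic, not_le]; linarith) _
        rw [this, mul_zero]
      · have : χ (√(p.1 ^ 2 + p.2 ^ 2)) = 0 := Set.indicator_of_notMem (by simpa using hp) _
        rw [this, zero_mul]
    rw [rawProfile_eq, rawProfile_eq]
    simp only [hH]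
    linear_combination hz
  have hS := W.integral_mode_mul β 0 ξ
  rw [integral_mode_mul_eq_S] at hS
  simp only [zero_sub, Int.natAbs_neg, Int.natAbs_natCast] at hS
  rw [← hd] at hS
  simp_rw [expand] at hS
  have i23 : Integrable fun p : ℝ × ℝ =>
      H p + K (√(p.1 ^ 2 + p.2 ^ 2)) * χ (√((p.1 - d) ^ 2 + p.2 ^ 2)) := i2.add i3
  rw [integral_add (i1.const_mul _) (i23.const_mul _), integral_const_mul, integral_const_mul,
    integral_add i2 i3, v3, v1, v2, h.amplitude_sq, h.normSq_eq,
    show W.claddingRatio β = c from rfl] at hS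
  rw [hS]
  have hc : c ≠ 0 := h.claddingRatio_pos.ne'
  have hK1 := (besselK_one_pos (mul_pos hg ha)).ne'
  have hpi := Real.pi_ne_zero
  have hLG : W.Lam β ^ 2 + W.Gam β ^ 2 ≠ 0 := by positivity
  field_simp
  ring

end IsFundamental

end WaveguideArray

/-! ### Numerical enclosures -/

/-- From index N on, consecutive terms have ratio at most |z|/(N+1)² ≤ 1/2, so the tail is at most
twice the first omitted term. -/
theorem abs_besselE_sub_le (n N : ℕ) {z : ℝ} (hz : 2 * |z| ≤ (N + 1) ^ 2) :
    |besselE n z - ∑ j ∈ Finset.range N, z ^ j / ((j.factorial : ℝ) * ((j + n).factorial : ℝ))| ≤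
      2 * |z| ^ N / ((N.factorial : ℝ) * ((N + n).factorial : ℝ)) := by
  set t : ℕ → ℝ := fun j => 1 / ((j.factorial : ℝ) * ((j + n).factorial : ℝ)) * z ^ j with ht
  have hs : Summable t := summable_besselE n z
  have hsum : ∑ j ∈ Finset.range N, z ^ j / ((j.factorial : ℝ) * ((j + n).factorial : ℝ)) =
      ∑ j ∈ Finset.range N, t j := Finset.sum_congr rfl fun j _ => by simp only [ht]; ring
  have hE : besselE n z = ∑ j ∈ Finset.range N, t j + ∑' j, t (j + N) :=
    (hs.sum_add_tsum_nat_add N).symm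
  rw [hsum, hE, add_sub_cancel_left, ← Real.norm_eq_abs]
  refine (tsum_of_norm_bounded (((hasSum_geometric_of_lt_one (r := (1 / 2 : ℝ)) (by norm_num)
    (by norm_num))).mul_left (|z| ^ N / ((N.factorial : ℝ) * ((N + n).factorial : ℝ))))
    fun j => ?_).trans_eq (by norm_num; ring)
  have h1 : ((N.factorial : ℝ) * (N + 1) ^ j) ≤ ((j + N).factorial : ℝ) := by
    rw [add_comm j]
    exact_mod_cast Nat.factorial_mul_pow_le_factorial
  have h2 : (((N + n).factorial : ℝ) * (N + 1) ^ j) ≤ ((j + N + n).factorial : ℝ) := by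
    have : (((N + n).factorial : ℝ) * ((N + n : ℕ) + 1) ^ j) ≤ ((N + n + j).factorial : ℝ) := by
      exact_mod_cast Nat.factorial_mul_pow_le_factorial
    rw [show j + N + n = N + n + j by ring]
    refine le_trans ?_ this
    gcongr
    linarith [Nat.cast_nonneg (α := ℝ) n]
  have h3 : |z| ^ j ≤ (1 / 2) ^ j * (((N : ℝ) + 1) ^ j * (N + 1) ^ j) := by
    rw [← mul_pow, ← mul_pow]
    gcongr
    linarith
  simp only [ht]
  rw [norm_mul, norm_pow, Real.norm_eq_abs, Real.norm_eq_abs, abs_of_nonneg (by positivity)]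
  calc 1 / (((j + N).factorial : ℝ) * ((j + N + n).factorial : ℝ)) * |z| ^ (j + N)
      ≤ 1 / (((N.factorial : ℝ) * (N + 1) ^ j) * (((N + n).factorial : ℝ) * (N + 1) ^ j)) *
        ((1 / 2) ^ j * (((N : ℝ) + 1) ^ j * (N + 1) ^ j) * |z| ^ N) := by
        rw [pow_add]
        gcongr
    _ = _ := by
        field_simp

theorem besselE_mem_Icc (n N : ℕ) {z lo hi : ℝ} (hz : 2 * |z| ≤ (N + 1) ^ 2)
    (hlo : lo ≤ ∑ j ∈ Finset.range N, z ^ j / ((j.factorial : ℝ) * ((j + n).factorial : ℝ)) -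
      2 * |z| ^ N / ((N.factorial : ℝ) * ((N + n).factorial : ℝ)))
    (hhi : ∑ j ∈ Finset.range N, z ^ j / ((j.factorial : ℝ) * ((j + n).factorial : ℝ)) +
      2 * |z| ^ N / ((N.factorial : ℝ) * ((N + n).factorial : ℝ)) ≤ hi) :
    besselE n z ∈ Set.Icc lo hi := by
  have := abs_le.1 (abs_besselE_sub_le n N hz)
  constructor <;> linarith

/-- Since H_j ≤ j, the tail of P from index N + 1 is at most z times the tail of E₁ from index N;
hence the off-by-one between the two ranges. -/
theorem besselP_mem_Icc (N : ℕ) {z lo hi : ℝ} (hz0 : 0 ≤ z) (hz : 2 * z ≤ (N + 1) ^ 2)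
    (hlo : lo ≤ ∑ j ∈ Finset.range (N + 1), (∑ i ∈ Finset.range j, 1 / ((i : ℝ) + 1)) /
      ((j.factorial : ℝ) * (j.factorial : ℝ)) * z ^ j)
    (hhi : ∑ j ∈ Finset.range (N + 1), (∑ i ∈ Finset.range j, 1 / ((i : ℝ) + 1)) /
      ((j.factorial : ℝ) * (j.factorial : ℝ)) * z ^ j +
      z * (2 * z ^ N / ((N.factorial : ℝ) * ((N + 1).factorial : ℝ))) ≤ hi) :
    besselP z ∈ Set.Icc lo hi := by
  have hH : ∀ j : ℕ, ∑ i ∈ Finset.range j, 1 / ((i : ℝ) + 1) = (harmonic j : ℝ) := fun j => by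
    simp [harmonic]
  simp_rw [hH] at hlo hhi
  have hP := (summable_besselP z).sum_add_tsum_nat_add (N + 1)
  have hE := (summable_besselE 1 z).sum_add_tsum_nat_add N
  have hEs := (summable_nat_add_iff N).2 (summable_besselE 1 z)
  have hPs := (summable_nat_add_iff (N + 1)).2 (summable_besselP z)
  have htail : ∑' j : ℕ, (harmonic (j + (N + 1)) : ℝ) /
      (((j + (N + 1)).factorial : ℝ) * ((j + (N + 1)).factorial : ℝ)) * z ^ (j + (N + 1)) ≤
      z * ∑' j : ℕ, 1 / (((j + N).factorial : ℝ) * ((j + N + 1).factorial : ℝ)) * z ^ (j + N) := by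
    rw [← tsum_mul_left]
    refine hPs.tsum_le_tsum (fun j => ?_) (hEs.mul_left z)
    have h1 := harmonic_le_self (j + (N + 1))
    calc _ ≤ ((j + (N + 1) : ℕ) : ℝ) /
          (((j + (N + 1)).factorial : ℝ) * ((j + (N + 1)).factorial : ℝ)) * z ^ (j + (N + 1)) := by
          gcongr
      _ = _ := by
          rw [show j + (N + 1) = j + N + 1 by ring, Nat.factorial_succ (j + N)]
          push_cast
          field_simp
          ring
  have hnn : 0 ≤ ∑' j : ℕ, (harmonic (j + (N + 1)) : ℝ) /
      (((j + (N + 1)).factorial : ℝ) * ((j + (N + 1)).factorial : ℝ)) * z ^ (j + (N + 1)) :=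
    tsum_nonneg fun j => by
      have := harmonic_nonneg' (j + (N + 1))
      positivity
  have h2 := (abs_le.1 (abs_besselE_sub_le 1 N (z := z) (by rwa [abs_of_nonneg hz0]))).2
  rw [abs_of_nonneg hz0] at h2
  have h3 : ∑ j ∈ Finset.range N, z ^ j / ((j.factorial : ℝ) * ((j + 1).factorial : ℝ)) =
      ∑ j ∈ Finset.range N, 1 / ((j.factorial : ℝ) * ((j + 1).factorial : ℝ)) * z ^ j :=
    Finset.sum_congr rfl fun j _ => by ring
  rw [h3] at h2
  change _ = besselE 1 z at hE
  change _ = besselP z at hP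
  have h4 : ∑' j : ℕ, 1 / (((j + N).factorial : ℝ) * ((j + N + 1).factorial : ℝ)) * z ^ (j + N) ≤
      2 * z ^ N / ((N.factorial : ℝ) * ((N + 1).factorial : ℝ)) := by linarith
  have h5 := mul_le_mul_of_nonneg_left h4 hz0
  constructor <;> linarith

/-! ### The additive constant of K₀ and enclosures of K₀ and K₁ -/

/-- The constant `log 2 - γ` in the expansion of `K₀` at the origin. -/
noncomputable def besselKConst : ℝ := exists_besselK_zero_eq.choose

theorem besselK_zero_expansion {x : ℝ} (hx : 0 < x) :
    besselK 0 x = (besselKConst - Real.log x) * besselI 0 x + besselP (x ^ 2 / 4) :=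
  exists_besselK_zero_eq.choose_spec x hx

/-- The value log 2 - γ is never used. The constant is read off from K₀ = (c - log x)I₀ + P with the
bounds 0 < K₀ ≤ 1/(x(I₀ + I₁)), the upper one from the Wronskian and K₀ < K₁. -/
theorem besselKConst_sub_log_mem_Icc {x a₀ a₁ b₀ p₀ p₁ lo hi : ℝ} (hx : 0 < x)
    (hI : besselE 0 (x ^ 2 / 4) ∈ Set.Icc a₀ a₁) (hI' : b₀ ≤ besselE 1 (x ^ 2 / 4))
    (hP : besselP (x ^ 2 / 4) ∈ Set.Icc p₀ p₁) (ha : 0 < a₀) (hb : 0 < b₀)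
    (hlo : lo * a₀ ≤ -p₁) (hlo' : lo ≤ 0)
    (hhi : (hi * a₁ + p₀) * (x * (a₀ + x / 2 * b₀)) ≥ 1) (hhi' : hi ≤ 0) :
    besselKConst - Real.log x ∈ Set.Icc lo hi := by
  have hK := besselK_zero_expansion hx
  have hpos := besselK_zero_pos hx
  have hlt := besselK_zero_lt_one hx
  have hW := besselI_mul_besselK_add hx
  have hi0 : besselI 0 x = besselE 0 (x ^ 2 / 4) := by simp [besselI]
  have hi1 : besselI 1 x = x / 2 * besselE 1 (x ^ 2 / 4) := by simp [besselI]
  rw [hi0] at hK hW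
  rw [hi1] at hW
  set I := besselE 0 (x ^ 2 / 4)
  set I' := besselE 1 (x ^ 2 / 4)
  set P := besselP (x ^ 2 / 4)
  set m := besselKConst - Real.log x
  have hIpos : 0 < I := ha.trans_le hI.1
  have hWx : x * (I * besselK 1 x + x / 2 * I' * besselK 0 x) = 1 := by rw [hW]; field_simp
  have hsmall : besselK 0 x * (x * (a₀ + x / 2 * b₀)) ≤ 1 := by
    rw [← hWx]
    have h1 : a₀ * besselK 0 x ≤ I * besselK 1 x :=
      mul_le_mul hI.1 hlt.le hpos.le hIpos.le
    have h2 : x / 2 * b₀ * besselK 0 x ≤ x / 2 * I' * besselK 0 x := by gcongr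
    nlinarith
  constructor
  · by_contra! hcon
    have h1 : m * I < lo * I := mul_lt_mul_of_pos_right hcon hIpos
    have h2 : lo * I ≤ lo * a₀ := mul_le_mul_of_nonpos_left hI.1 hlo'
    linarith [hP.2]
  · by_contra! hcon
    have h1 : hi * I < m * I := mul_lt_mul_of_pos_right hcon hIpos
    have h2 : hi * a₁ ≤ hi * I := mul_le_mul_of_nonpos_left hI.2 hhi'
    have h3 : hi * a₁ + p₀ < besselK 0 x := by linarith [hP.1]
    have h4 : 0 < x * (a₀ + x / 2 * b₀) := by positivity
    nlinarith

/-- K₀ comes from its expansion; both endpoints for I₀ are tested because c - log x may have either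
sign. K₁ is then obtained by solving the Wronskian identity. -/
theorem besselK_mem_Icc {x a₀ a₁ b₀ b₁ p₀ p₁ m₀ m₁ k₀ k₁ l₀ l₁ : ℝ} (hx : 0 < x)
    (hI : besselE 0 (x ^ 2 / 4) ∈ Set.Icc a₀ a₁) (hI' : besselE 1 (x ^ 2 / 4) ∈ Set.Icc b₀ b₁)
    (hP : besselP (x ^ 2 / 4) ∈ Set.Icc p₀ p₁)
    (hm : besselKConst - Real.log x ∈ Set.Icc m₀ m₁)
    (h : 0 < a₀ ∧ 0 < b₀ ∧ 0 < k₀ ∧ 0 < l₀ ∧ k₀ ≤ m₀ * a₀ + p₀ ∧ k₀ ≤ m₀ * a₁ + p₀ ∧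
      m₁ * a₀ + p₁ ≤ k₁ ∧ m₁ * a₁ + p₁ ≤ k₁ ∧
      x * (l₀ * a₁ + x / 2 * b₁ * k₁) ≤ 1 ∧ 1 ≤ x * (l₁ * a₀ + x / 2 * b₀ * k₀)) :
    besselK 0 x ∈ Set.Icc k₀ k₁ ∧ besselK 1 x ∈ Set.Icc l₀ l₁ := by
  obtain ⟨ha, hb, hk, hl, h1, h2, h3, h4, h5, h6⟩ := h
  have hK := besselK_zero_expansion hx
  have hW := besselI_mul_besselK_add hx
  have hi0 : besselI 0 x = besselE 0 (x ^ 2 / 4) := by simp [besselI]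
  have hi1 : besselI 1 x = x / 2 * besselE 1 (x ^ 2 / 4) := by simp [besselI]
  rw [hi0] at hK hW
  rw [hi1] at hW
  set I := besselE 0 (x ^ 2 / 4)
  set I' := besselE 1 (x ^ 2 / 4)
  set P := besselP (x ^ 2 / 4)
  set m := besselKConst - Real.log x
  have hIpos : 0 < I := ha.trans_le hI.1
  have hI'pos : 0 < I' := hb.trans_le hI'.1
  have hWx : x * (I * besselK 1 x + x / 2 * I' * besselK 0 x) = 1 := by rw [hW]; field_simp
  have hK0 : besselK 0 x ∈ Set.Icc k₀ k₁ := by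
    constructor
    · have e : m₀ * I ≤ m * I := mul_le_mul_of_nonneg_right hm.1 hIpos.le
      rcases le_total 0 m₀ with hs | hs
      · linarith [hP.1, mul_le_mul_of_nonneg_left hI.1 hs]
      · linarith [hP.1, mul_le_mul_of_nonpos_left hI.2 hs]
    · have e : m * I ≤ m₁ * I := mul_le_mul_of_nonneg_right hm.2 hIpos.le
      rcases le_total 0 m₁ with hs | hs
      · linarith [hP.2, mul_le_mul_of_nonneg_left hI.2 hs]
      · linarith [hP.2, mul_le_mul_of_nonpos_left hI.1 hs]
  refine ⟨hK0, ?_, ?_⟩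
  · by_contra! hcon
    have e1 : I * besselK 1 x < a₁ * l₀ :=
      (mul_lt_mul_of_pos_left hcon hIpos).trans_le (mul_le_mul_of_nonneg_right hI.2 hl.le)
    have e2 : x / 2 * I' * besselK 0 x ≤ x / 2 * b₁ * k₁ := by
      have h7 := hI'.2
      have h8 := hK0.2
      have h9 := hI'pos.trans_le h7
      have h10 := besselK_zero_pos hx
      gcongr
    have e3 := mul_lt_mul_of_pos_left (add_lt_add_of_lt_of_le e1 e2) hx
    rw [hWx] at e3
    linarith
  · by_contra! hcon
    have hl1 : 0 < besselK 1 x := besselK_one_pos hx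
    have e1 : a₀ * l₁ < I * besselK 1 x :=
      (mul_lt_mul_of_pos_left hcon ha).trans_le (mul_le_mul_of_nonneg_right hI.1 hl1.le)
    have e2 : x / 2 * b₀ * k₀ ≤ x / 2 * I' * besselK 0 x := by
      have := hI'.1
      have := hK0.1
      gcongr
    have e3 := mul_lt_mul_of_pos_left (add_lt_add_of_lt_of_le e1 e2) hx
    rw [hWx] at e3
    linarith

/-- The series log r = 2 artanh y with y = (r - 1)/(r + 1), and a geometric bound on its remainder.
-/
theorem log_mem_Icc (N : ℕ) {r lo hi : ℝ} (hr : 1 ≤ r)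
    (hlo : lo ≤ 2 * ∑ i ∈ Finset.range N, ((r - 1) / (r + 1)) ^ (2 * i + 1) / (2 * i + 1))
    (hhi : 2 * (∑ i ∈ Finset.range N, ((r - 1) / (r + 1)) ^ (2 * i + 1) / (2 * i + 1) +
      ((r - 1) / (r + 1)) ^ (2 * N + 1) / (1 - ((r - 1) / (r + 1)) ^ 2)) ≤ hi) :
    Real.log r ∈ Set.Icc lo hi := by
  set y := (r - 1) / (r + 1) with hy
  have hr1 : 0 < r + 1 := by linarith
  have hy0 : 0 ≤ y := div_nonneg (by linarith) hr1.le
  have hy1 : y < 1 := by rw [hy, div_lt_one hr1]; linarith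
  have e : (1 + y) / (1 - y) = r := by
    rw [hy]
    field_simp
    ring
  have h1 := Real.sum_range_le_log_div hy0 hy1 N
  have h2 := Real.log_div_le_sum_range_add hy0 hy1 N
  rw [e] at h1 h2
  constructor <;> linarith

/-- At x = 14 one has I₀ ≈ 1.3·10⁵, so the uncertainty 1/(x I₀(I₀ + I₁)) is only about 2·10⁻¹². At a
smaller argument it is magnified by I₀ there, to about 1.5·10⁻⁸ at the largest one used, 4·2.71331.
-/
theorem besselKConst_sub_log_fourteen_mem_Icc :
    besselKConst - Real.log 14 ∈ Set.Icc (-2.523125813959 : ℝ) (-2.52312581395679) := by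
  refine besselKConst_sub_log_mem_Icc
    (a₀ := 129418.562700648) (a₁ := 129418.562700649) (b₀ := 17815.322735581)
    (p₀ := 326539.316355475) (p₁ := 326539.316355476) (by norm_num)
    (besselE_mem_Icc 0 28 ?_ ?_ ?_) (besselE_mem_Icc 1 28 (hi := 17815.322735582) ?_ ?_ ?_).1
    (besselP_mem_Icc 28 ?_ ?_ ?_ ?_) ?_ ?_ ?_ ?_ ?_ ?_
  all_goals norm_num [Finset.sum_range_succ, Nat.factorial]

theorem besselKConst_sub_log_mem_Icc_of_mul {x y r m₀ m₁ l₀ l₁ : ℝ} (hx : 0 < x) (hr : 0 < r)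
    (hxr : x * r = y) (hm : besselKConst - Real.log y ∈ Set.Icc m₀ m₁)
    (hl : Real.log r ∈ Set.Icc l₀ l₁) :
    besselKConst - Real.log x ∈ Set.Icc (m₀ + l₀) (m₁ + l₁) := by
  rw [← hxr, Real.log_mul hx.ne' hr.ne'] at hm
  constructor
  · linarith [hm.1, hl.1]
  · linarith [hm.2, hl.2]

/-- 2.71329 and 2.71331 bracket ΓD. Their multiples by 1, 2, 3, 4 are the arguments in the first
four overlaps, and the factor 0.166 = a/D converts them into a bracket for Γa. -/
theorem besselKConst_sub_log_one_lo :
    besselKConst - Real.log (2.71329) ∈ Set.Icc (-0.8822304050466 : ℝ) (-0.88223040504429) := by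
  convert besselKConst_sub_log_mem_Icc_of_mul (x := 2.71329) (r := 14 / 2.71329) (by norm_num) (by norm_num)
    (by norm_num) besselKConst_sub_log_fourteen_mem_Icc
    (log_mem_Icc 43 (lo := 1.6408954089124) (hi := 1.6408954089125) ?_ ?_ ?_) using 2 <;>
    norm_num [Finset.sum_range_succ]

theorem besselK_one_lo :
    besselK 0 (2.71329) ∈ Set.Icc (0.04849426019 : ℝ) 0.04849426021 ∧
      besselK 1 (2.71329) ∈ Set.Icc (0.05680765184 : ℝ) 0.05680765186 := by
  refine besselK_mem_Icc
    (a₀ := 3.881976610561) (a₁ := 3.881976610562) (b₀ := 2.25005948727) (b₁ := 2.250059487271)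
    (p₀ := 3.47329205771) (p₁ := 3.473292057711) (by norm_num)
    (besselE_mem_Icc 0 12 ?_ ?_ ?_) (besselE_mem_Icc 1 12 ?_ ?_ ?_)
    (besselP_mem_Icc 12 ?_ ?_ ?_ ?_)
    besselKConst_sub_log_one_lo ?_
  all_goals norm_num [Finset.sum_range_succ, Nat.factorial]

theorem besselK_two_lo :
    besselK 0 (2 * 2.71329) ∈ Set.Icc (0.00231654896 : ℝ) 0.00231654907 ∧
      besselK 1 (2 * 2.71329) ∈ Set.Icc (0.0025215888 : ℝ) 0.00252158891 := by
  refine besselK_mem_Icc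
    (a₀ := 39.955500857692) (a₁ := 39.955500857693) (b₀ := 13.288869602129) (b₁ := 13.28886960213)
    (p₀ := 62.947317021862) (p₁ := 62.947317021863) (by norm_num)
    (besselE_mem_Icc 0 17 ?_ ?_ ?_) (besselE_mem_Icc 1 17 ?_ ?_ ?_)
    (besselP_mem_Icc 17 ?_ ?_ ?_ ?_)
    (besselKConst_sub_log_mem_Icc_of_mul (r := 14 / (2 * 2.71329)) (by norm_num) (by norm_num)
      (by norm_num) besselKConst_sub_log_fourteen_mem_Icc
      (log_mem_Icc 20 (lo := 0.9477482283524) (hi := 0.9477482283525) ?_ ?_ ?_)) ?_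
  all_goals norm_num [Finset.sum_range_succ, Nat.factorial]

theorem besselK_three_lo :
    besselK 0 (3 * 2.71329) ∈ Set.Icc (0.00012628245 : ℝ) 0.00012628359 ∧
      besselK 1 (3 * 2.71329) ∈ Set.Icc (0.00013382704 : ℝ) 0.00013382812 := by
  refine besselK_mem_Icc
    (a₀ := 487.357096550843) (a₁ := 487.357096550844) (b₀ := 112.129055828265) (b₁ := 112.129055828266)
    (p₀ := 965.377870215208) (p₁ := 965.37787021521) (by norm_num)
    (besselE_mem_Icc 0 21 ?_ ?_ ?_) (besselE_mem_Icc 1 21 ?_ ?_ ?_)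
    (besselP_mem_Icc 21 ?_ ?_ ?_ ?_)
    (besselKConst_sub_log_mem_Icc_of_mul (r := 14 / (3 * 2.71329)) (by norm_num) (by norm_num)
      (by norm_num) besselKConst_sub_log_fourteen_mem_Icc
      (log_mem_Icc 12 (lo := 0.5422831202443) (hi := 0.5422831202444) ?_ ?_ ?_)) ?_
  all_goals norm_num [Finset.sum_range_succ, Nat.factorial]

theorem besselK_four_lo :
    besselK 0 (4 * 2.71329) ∈ Set.Icc (0.00000726435 : ℝ) 0.000007279 ∧
      besselK 1 (4 * 2.71329) ∈ Set.Icc (0.00000760562 : ℝ) 0.00000761959 := by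
  refine besselK_mem_Icc
    (a₀ := 6336.62403396836) (a₁ := 6336.624033968361) (b₀ := 1112.531754464683) (b₁ := 1112.531754464684)
    (p₀ := 14374.788562207456) (p₁ := 14374.788562207457) (by norm_num)
    (besselE_mem_Icc 0 25 ?_ ?_ ?_) (besselE_mem_Icc 1 25 ?_ ?_ ?_)
    (besselP_mem_Icc 25 ?_ ?_ ?_ ?_)
    (besselKConst_sub_log_mem_Icc_of_mul (r := 14 / (4 * 2.71329)) (by norm_num) (by norm_num)
      (by norm_num) besselKConst_sub_log_fourteen_mem_Icc
      (log_mem_Icc 8 (lo := 0.2546010477925) (hi := 0.2546010477926) ?_ ?_ ?_)) ?_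
  all_goals norm_num [Finset.sum_range_succ, Nat.factorial]

theorem besselK_core_lo :
    besselK 0 (0.166 * 2.71329) ∈ Set.Icc (1.01214682765 : ℝ) 1.01214682766 ∧
      besselK 1 (0.166 * 2.71329) ∈ Set.Icc (1.88940495918 : ℝ) 1.88940495919 := by
  refine besselK_mem_Icc
    (a₀ := 1.051363096756) (a₁ := 1.051363096757) (b₀ := 1.02557346587) (b₁ := 1.025573465871)
    (p₀ := 0.051687648359) (p₁ := 0.05168764836) (by norm_num)
    (besselE_mem_Icc 0 6 ?_ ?_ ?_) (besselE_mem_Icc 1 6 ?_ ?_ ?_)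
    (besselP_mem_Icc 6 ?_ ?_ ?_ ?_)
    -- The passage goes through 2.71329, since the logarithm series for the full ratio to 14
    -- converges much more slowly.
    (besselKConst_sub_log_mem_Icc_of_mul (r := 1000 / 166) (by norm_num) (by norm_num)
      (by norm_num) besselKConst_sub_log_one_lo
      (log_mem_Icc 50 (lo := 1.7957674906255) (hi := 1.7957674906257) ?_ ?_ ?_)) ?_
  all_goals norm_num [Finset.sum_range_succ, Nat.factorial]

theorem besselKConst_sub_log_one_hi :
    besselKConst - Real.log (2.71331) ∈ Set.Icc (-0.8822377761446 : ℝ) (-0.88223777614219) := by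
  convert besselKConst_sub_log_mem_Icc_of_mul (x := 2.71331) (r := 14 / 2.71331) (by norm_num) (by norm_num)
    (by norm_num) besselKConst_sub_log_fourteen_mem_Icc
    (log_mem_Icc 43 (lo := 1.6408880378144) (hi := 1.6408880378146) ?_ ?_ ?_) using 2 <;>
    norm_num [Finset.sum_range_succ]

theorem besselK_one_hi :
    besselK 0 (2.71331) ∈ Set.Icc (0.04849312405 : ℝ) 0.04849312407 ∧
      besselK 1 (2.71331) ∈ Set.Icc (0.05680626323 : ℝ) 0.05680626326 := by
  refine besselK_mem_Icc
    (a₀ := 3.882037661752) (a₁ := 3.882037661753) (b₀ := 2.250083545584) (b₁ := 2.250083545585)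
    (p₀ := 3.473373397667) (p₁ := 3.473373397668) (by norm_num)
    (besselE_mem_Icc 0 12 ?_ ?_ ?_) (besselE_mem_Icc 1 12 ?_ ?_ ?_)
    (besselP_mem_Icc 12 ?_ ?_ ?_ ?_)
    besselKConst_sub_log_one_hi ?_
  all_goals norm_num [Finset.sum_range_succ, Nat.factorial]

theorem besselK_two_hi :
    besselK 0 (2 * 2.71331) ∈ Set.Icc (0.0023164481 : ℝ) 0.00231644821 ∧
      besselK 1 (2 * 2.71331) ∈ Set.Icc (0.00252147755 : ℝ) 0.00252147766 := by
  refine besselK_mem_Icc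
    (a₀ := 39.956943146621) (a₁ := 39.956943146622) (b₀ := 13.289262734563) (b₁ := 13.289262734564)
    (p₀ := 62.949883597193) (p₁ := 62.949883597194) (by norm_num)
    (besselE_mem_Icc 0 17 ?_ ?_ ?_) (besselE_mem_Icc 1 17 ?_ ?_ ?_)
    (besselP_mem_Icc 17 ?_ ?_ ?_ ?_)
    (besselKConst_sub_log_mem_Icc_of_mul (r := 14 / (2 * 2.71331)) (by norm_num) (by norm_num)
      (by norm_num) besselKConst_sub_log_fourteen_mem_Icc
      (log_mem_Icc 20 (lo := 0.9477408572545) (hi := 0.9477408572546) ?_ ?_ ?_)) ?_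
  all_goals norm_num [Finset.sum_range_succ, Nat.factorial]

theorem besselK_three_hi :
    besselK 0 (3 * 2.71331) ∈ Set.Icc (0.00012627439 : ℝ) 0.00012627553 ∧
      besselK 1 (3 * 2.71331) ∈ Set.Icc (0.00013381851 : ℝ) 0.00013381959 := by
  refine besselK_mem_Icc
    (a₀ := 487.384478805315) (a₁ := 487.384478805316) (b₀ := 112.134587674589) (b₁ := 112.13458767459)
    (p₀ := 965.435702704606) (p₁ := 965.435702704608) (by norm_num)
    (besselE_mem_Icc 0 21 ?_ ?_ ?_) (besselE_mem_Icc 1 21 ?_ ?_ ?_)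
    (besselP_mem_Icc 21 ?_ ?_ ?_ ?_)
    (besselKConst_sub_log_mem_Icc_of_mul (r := 14 / (3 * 2.71331)) (by norm_num) (by norm_num)
      (by norm_num) besselKConst_sub_log_fourteen_mem_Icc
      (log_mem_Icc 12 (lo := 0.5422757491463) (hi := 0.5422757491464) ?_ ?_ ?_)) ?_
  all_goals norm_num [Finset.sum_range_succ, Nat.factorial]

theorem besselK_four_hi :
    besselK 0 (4 * 2.71331) ∈ Set.Icc (0.0000072639 : ℝ) 0.00000727855 ∧
      besselK 1 (4 * 2.71331) ∈ Set.Icc (0.00000760483 : ℝ) 0.0000076188 := by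
  refine besselK_mem_Icc
    (a₀ := 6337.107031871432) (a₁ := 6337.107031871433) (b₀ := 1112.608772048685) (b₁ := 1112.608772048686)
    (p₀ := 14375.930966348464) (p₁ := 14375.930966348465) (by norm_num)
    (besselE_mem_Icc 0 25 ?_ ?_ ?_) (besselE_mem_Icc 1 25 ?_ ?_ ?_)
    (besselP_mem_Icc 25 ?_ ?_ ?_ ?_)
    (besselKConst_sub_log_mem_Icc_of_mul (r := 14 / (4 * 2.71331)) (by norm_num) (by norm_num)
      (by norm_num) besselKConst_sub_log_fourteen_mem_Icc
      (log_mem_Icc 8 (lo := 0.2545936766946) (hi := 0.2545936766947) ?_ ?_ ?_)) ?_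
  all_goals norm_num [Finset.sum_range_succ, Nat.factorial]

theorem besselK_core_hi :
    besselK 0 (0.166 * 2.71331) ∈ Set.Icc (1.01214055485 : ℝ) 1.01214055487 ∧
      besselK 1 (0.166 * 2.71331) ∈ Set.Icc (1.88938767193 : ℝ) 1.88938767195 := by
  refine besselK_mem_Icc
    (a₀ := 1.051363863554) (a₁ := 1.051363863555) (b₀ := 1.025573846069) (b₁ := 1.02557384607)
    (p₀ := 0.051688424771) (p₁ := 0.051688424772) (by norm_num)
    (besselE_mem_Icc 0 6 ?_ ?_ ?_) (besselE_mem_Icc 1 6 ?_ ?_ ?_)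
    (besselP_mem_Icc 6 ?_ ?_ ?_ ?_)
    (besselKConst_sub_log_mem_Icc_of_mul (r := 1000 / 166) (by norm_num) (by norm_num)
      (by norm_num) besselKConst_sub_log_one_hi
      (log_mem_Icc 50 (lo := 1.7957674906255) (hi := 1.7957674906257) ?_ ?_ ?_)) ?_
  all_goals norm_num [Finset.sum_range_succ, Nat.factorial]

/-! ### Location of the fundamental mode of the experiment -/

/-- The derivative is x(K₁² - K₀²)/K₀², nonnegative because K₀ < K₁. -/
theorem monotoneOn_mul_besselK_one_div : MonotoneOn (fun x => x * besselK 1 x / besselK 0 x)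
    (Set.Ioi 0) := by
  have hd : ∀ x : ℝ, 0 < x → HasDerivAt (fun x => x * besselK 1 x / besselK 0 x)
      (x * (besselK 1 x ^ 2 - besselK 0 x ^ 2) / besselK 0 x ^ 2) x := fun x hx =>
    ((hasDerivAt_mul_besselK_one hx).div (hasDerivAt_besselK_zero hx)
      (besselK_zero_pos hx).ne').congr_deriv (by ring)
  refine monotoneOn_of_deriv_nonneg (convex_Ioi 0)
    (fun x hx => (hd x hx).continuousAt.continuousWithinAt)
    (fun x hx => (hd x (interior_subset hx)).differentiableAt.differentiableWithinAt) fun x hx => ?_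
  have hx : 0 < x := interior_subset hx
  rw [(hd x hx).deriv]
  have := besselK_zero_pos hx
  have h1 : besselK 0 x ^ 2 ≤ besselK 1 x ^ 2 :=
    pow_le_pow_left₀ this.le (besselK_zero_lt_one hx).le 2
  exact div_nonneg (mul_nonneg hx.le (sub_nonneg.2 h1)) (by positivity)

/-- Where J₀ > 0, the numerator x J₁ increases from 0 and the denominator J₀ decreases. -/
theorem mul_besselJ_one_div_le {b : ℝ} (hb : ∀ x, 0 ≤ x → x ≤ b → 0 < besselJ 0 x) {x : ℝ}
    (hx : 0 ≤ x) (hxb : x ≤ b) :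
    x * besselJ 1 x / besselJ 0 x ≤ b * besselJ 1 b / besselJ 0 b := by
  have hb0 := hx.trans hxb
  have h : MonotoneOn (fun x => x * besselJ 1 x) (Set.Icc 0 b) :=
    monotoneOn_of_deriv_nonneg (convex_Icc 0 b)
      (continuous_id.mul (continuous_besselJ 1)).continuousOn
      (fun y _ => (hasDerivAt_mul_besselJ_one y).differentiableAt.differentiableWithinAt)
      fun y hy => by
        rw [interior_Icc] at hy
        rw [(hasDerivAt_mul_besselJ_one y).deriv]
        exact mul_nonneg hy.1.le (hb y hy.1.le hy.2.le).le
  have h0 := h ⟨le_rfl, hb0⟩ ⟨hb0, le_rfl⟩ hb0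
  simp only [zero_mul] at h0
  exact div_le_div₀ h0 (h ⟨hx, hxb⟩ ⟨hb0, le_rfl⟩ hxb) (hb b hb0 le_rfl)
    (antitoneOn_besselJ_zero hb ⟨hx, hxb⟩ ⟨hb0, le_rfl⟩ hxb)

/-- In the variable q = x²/4 the quotient involves only E₀ and E₁ at -q, so a rational q can be
evaluated without enclosing a square root. -/
theorem mul_besselJ_one_div_sqrt {q : ℝ} (hq : 0 ≤ q) :
    2 * √q * besselJ 1 (2 * √q) / besselJ 0 (2 * √q) = 2 * q * besselE 1 (-q) / besselE 0 (-q) := by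
  have h : (2 * √q) ^ 2 / 4 = q := by
    rw [mul_pow, Real.sq_sqrt hq]
    ring
  rw [besselJ_eq, besselJ_eq, h]
  congr 1
  · rw [pow_one, mul_div_cancel_left₀ _ (by norm_num : (2 : ℝ) ≠ 0),
      show 2 * √q * (√q * besselE 1 (-q)) = 2 * (√q * √q) * besselE 1 (-q) by ring,
      Real.mul_self_sqrt hq]
  · simp

theorem besselE_zero_neg_pos {q : ℝ} (hq : 0 ≤ q) (hq' : q ≤ 1 / 2) : 0 < besselE 0 (-q) := by
  have h := (abs_le.1 (abs_besselE_sub_le 0 2 (z := -q) (by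
    rw [abs_neg, abs_of_nonneg hq]
    norm_num
    linarith))).1
  rw [abs_neg, abs_of_nonneg hq] at h
  norm_num [Finset.sum_range_succ] at h
  nlinarith

theorem besselJ_zero_pos_of_sq_le {x : ℝ} (hx : x ^ 2 ≤ 2) : 0 < besselJ 0 x := by
  rw [besselJ_eq, pow_zero, one_mul]
  exact besselE_zero_neg_pos (by positivity) (by linarith)

namespace WaveguideArray

theorem IsFundamental.characteristic_mul {W : WaveguideArray} {β : ℝ} (h : W.IsFundamental β) :
    W.Lam β * W.a * besselJ 1 (W.Lam β * W.a) / besselJ 0 (W.Lam β * W.a) =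
      W.Gam β * W.a * besselK 1 (W.Gam β * W.a) / besselK 0 (W.Gam β * W.a) := by
  have := congrArg (W.a * ·) h.characteristic
  calc _ = W.a * (W.Lam β * besselJ 1 (W.Lam β * W.a) / besselJ 0 (W.Lam β * W.a)) := by ring
    _ = _ := this
    _ = _ := by ring

/-- The square of the normalized frequency `V` of the waveguides of the experiment. -/
noncomputable def experimentFrequencySq : ℝ := 0.1598248 * Real.pi ^ 2

theorem experimentFrequencySq_mem_Icc :
    experimentFrequencySq ∈ Set.Icc (1.57740754935 : ℝ) 1.57740754950 := by
  have h1 := Real.pi_gt_d20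
  have h2 := Real.pi_lt_d20
  unfold experimentFrequencySq
  constructor <;> nlinarith

namespace IsFundamental

variable {β : ℝ}

theorem experiment_sq_add_sq (h : experiment.IsFundamental β) :
    (experiment.Lam β * experiment.a) ^ 2 + (experiment.Gam β * experiment.a) ^ 2 =
      experimentFrequencySq := by
  rw [mul_pow, mul_pow, ← add_mul, h.Lam_sq_add_Gam_sq, k, experimentFrequencySq]
  simp only [experiment]
  ring

/-- With u = Λa and w = Γa, u² + w² is fixed. If w were too small, u would be large: the J side of
the characteristic equation would exceed its value at the test point and the K side would fall below
its own, while the numerics order those two values the other way. -/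
theorem experiment_Gam_gt (h : experiment.IsFundamental β) :
    0.166 * 2.71329 < experiment.Gam β * experiment.a := by
  by_contra! hcon
  have hw : 0 < experiment.Gam β * experiment.a := mul_pos h.Gam_pos experiment.a_pos
  have hu : 0 < experiment.Lam β * experiment.a := mul_pos h.Lam_pos experiment.a_pos
  have hV := experimentFrequencySq_mem_Icc.1
  have hs := h.experiment_sq_add_sq
  -- 0.3436354 is (V² - w²)/4 at w = 0.166·2.71329, rounded down; the companion bound uses the other
  -- endpoint, rounded up.
  have hq : 2 * √0.3436354 ≤ experiment.Lam β * experiment.a := by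
    refine le_of_sq_le_sq ?_ hu.le
    rw [mul_pow, Real.sq_sqrt (by norm_num)]
    have := pow_le_pow_left₀ hw.le hcon 2
    norm_num at this hV ⊢
    linarith
  have h1 := (mul_besselJ_one_div_le h.besselJ_pos (by positivity) hq).trans
    (h.characteristic_mul.trans_le (monotoneOn_mul_besselK_one_div hw
      (show (0 : ℝ) < 0.166 * 2.71329 by norm_num) hcon))
  rw [mul_besselJ_one_div_sqrt (by norm_num)] at h1
  obtain ⟨hK0, hK1⟩ := besselK_core_lo
  have hE0 : besselE 0 (-0.3436354) ∈ Set.Icc (0.684782626 : ℝ) 0.684782627 := by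
    refine besselE_mem_Icc 0 8 ?_ ?_ ?_ <;> norm_num [Finset.sum_range_succ, Nat.factorial]
  have hE1 : besselE 1 (-0.3436354) ∈ Set.Icc (0.837745733 : ℝ) 0.837745734 := by
    refine besselE_mem_Icc 1 8 ?_ ?_ ?_ <;> norm_num [Finset.sum_range_succ, Nat.factorial]
  have hE0' := besselE_zero_neg_pos (q := 0.3436354) (by norm_num) (by norm_num)
  refine absurd h1 (not_le.2 ((div_lt_div_iff₀ (besselK_zero_pos (by norm_num)) hE0').2 ?_))
  calc 0.166 * 2.71329 * besselK 1 (0.166 * 2.71329) * besselE 0 (-0.3436354)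
      ≤ 0.166 * 2.71329 * 1.88940495919 * 0.684782627 :=
        mul_le_mul (mul_le_mul_of_nonneg_left hK1.2 (by norm_num)) hE0.2 hE0'.le (by norm_num)
    _ < 2 * 0.3436354 * 0.837745733 * 1.01214682765 := by norm_num
    _ ≤ 2 * 0.3436354 * besselE 1 (-0.3436354) * besselK 0 (0.166 * 2.71329) :=
        mul_le_mul (mul_le_mul_of_nonneg_left hE1.1 (by norm_num)) hK0.1 (by norm_num)
          (mul_nonneg (by norm_num) (le_trans (by norm_num) hE1.1))

theorem experiment_Gam_lt (h : experiment.IsFundamental β) :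
    experiment.Gam β * experiment.a < 0.166 * 2.71331 := by
  by_contra! hcon
  have hu : 0 < experiment.Lam β * experiment.a := mul_pos h.Lam_pos experiment.a_pos
  have hV := experimentFrequencySq_mem_Icc.2
  have hs := h.experiment_sq_add_sq
  have hq : experiment.Lam β * experiment.a ≤ 2 * √0.3436348 := by
    refine le_of_sq_le_sq ?_ (by positivity)
    rw [mul_pow 2, Real.sq_sqrt (by norm_num)]
    have := pow_le_pow_left₀ (by norm_num) hcon 2
    norm_num at this hV ⊢
    linarith
  have hJ : ∀ x : ℝ, 0 ≤ x → x ≤ 2 * √0.3436348 → 0 < besselJ 0 x := fun x hx hxb => by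
    refine besselJ_zero_pos_of_sq_le ((pow_le_pow_left₀ hx hxb 2).trans ?_)
    rw [mul_pow, Real.sq_sqrt (by norm_num)]
    norm_num
  have h1 := (monotoneOn_mul_besselK_one_div (show (0 : ℝ) < 0.166 * 2.71331 by norm_num)
    (mul_pos h.Gam_pos experiment.a_pos) hcon).trans (h.characteristic_mul.ge.trans
      (mul_besselJ_one_div_le hJ hu.le hq))
  rw [mul_besselJ_one_div_sqrt (by norm_num)] at h1
  obtain ⟨hK0, hK1⟩ := besselK_core_hi
  have hE0 : besselE 0 (-0.3436348) ∈ Set.Icc (0.684783129 : ℝ) 0.68478313 := by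
    refine besselE_mem_Icc 0 8 ?_ ?_ ?_ <;> norm_num [Finset.sum_range_succ, Nat.factorial]
  have hE1 : besselE 1 (-0.3436348) ∈ Set.Icc (0.837746 : ℝ) 0.837746001 := by
    refine besselE_mem_Icc 1 8 ?_ ?_ ?_ <;> norm_num [Finset.sum_range_succ, Nat.factorial]
  have hE0' := besselE_zero_neg_pos (q := 0.3436348) (by norm_num) (by norm_num)
  have hK0' : 0 < besselK 0 (0.166 * 2.71331) := besselK_zero_pos (by norm_num)
  refine absurd h1 (not_le.2 ((div_lt_div_iff₀ hE0' hK0').2 ?_))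
  calc 2 * 0.3436348 * besselE 1 (-0.3436348) * besselK 0 (0.166 * 2.71331)
      ≤ 2 * 0.3436348 * 0.837746001 * 1.01214055487 :=
        mul_le_mul (mul_le_mul_of_nonneg_left hE1.2 (by norm_num)) hK0.2 hK0'.le (by norm_num)
    _ < 0.166 * 2.71331 * 1.88938767193 * 0.684783129 := by norm_num
    _ ≤ 0.166 * 2.71331 * besselK 1 (0.166 * 2.71331) * besselE 0 (-0.3436348) :=
        mul_le_mul (mul_le_mul_of_nonneg_left hK1.1 (by norm_num)) hE0.1 (by norm_num)
          (mul_nonneg (by norm_num) (besselK_one_pos (by norm_num)).le)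

end IsFundamental

end WaveguideArray

/-! ### The overlap integrals of the experiment -/

theorem besselE_mono (n : ℕ) {y z : ℝ} (hy : 0 ≤ y) (hyz : y ≤ z) : besselE n y ≤ besselE n z :=
  (summable_besselE n y).tsum_le_tsum (fun j => by gcongr) (summable_besselE n z)

theorem besselI_mono (n : ℕ) {x y : ℝ} (hx : 0 ≤ x) (hxy : x ≤ y) : besselI n x ≤ besselI n y := by
  have h := besselE_mono n (by positivity : 0 ≤ x ^ 2 / 4) (by gcongr : x ^ 2 / 4 ≤ y ^ 2 / 4)
  have h0 := (besselE_pos n (by positivity : 0 ≤ x ^ 2 / 4)).le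
  have hy : 0 ≤ y := hx.trans hxy
  unfold besselI
  gcongr

theorem besselI_core_lo : (1.0513630 : ℝ) ≤ besselI 0 (0.166 * 2.71329) ∧
    (0.2309622 : ℝ) ≤ besselI 1 (0.166 * 2.71329) := by
  have h0 : besselE 0 ((0.166 * 2.71329) ^ 2 / 4) ∈ Set.Icc (1.0513630 : ℝ) 2 := by
    refine besselE_mem_Icc 0 6 ?_ ?_ ?_ <;> norm_num [Finset.sum_range_succ, Nat.factorial]
  have h1 : besselE 1 ((0.166 * 2.71329) ^ 2 / 4) ∈ Set.Icc (1.0255734 : ℝ) 2 := by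
    refine besselE_mem_Icc 1 6 ?_ ?_ ?_ <;> norm_num [Finset.sum_range_succ, Nat.factorial]
  simp only [besselI, pow_zero, one_mul, pow_one]
  exact ⟨h0.1, by linarith [h1.1]⟩

theorem besselI_core_hi : besselI 0 (0.166 * 2.71331) ≤ (1.0513640 : ℝ) ∧
    besselI 1 (0.166 * 2.71331) ≤ (0.2309641 : ℝ) := by
  have h0 : besselE 0 ((0.166 * 2.71331) ^ 2 / 4) ∈ Set.Icc (0 : ℝ) 1.0513640 := by
    refine besselE_mem_Icc 0 6 ?_ ?_ ?_ <;> norm_num [Finset.sum_range_succ, Nat.factorial]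
  have h1 : besselE 1 ((0.166 * 2.71331) ^ 2 / 4) ∈ Set.Icc (0 : ℝ) 1.0255739 := by
    refine besselE_mem_Icc 1 6 ?_ ?_ ?_ <;> norm_num [Finset.sum_range_succ, Nat.factorial]
  simp only [besselI, pow_zero, one_mul, pow_one]
  exact ⟨h0.2, by linarith [h1.2]⟩

namespace WaveguideArray.IsFundamental

variable {β : ℝ}

/-- The closed form in dimensionless quantities: x = ΓD, p = Λ²/((Λ² + Γ²) K₁(Γa)²), g the negated
bracket of `S_eq` divided by a², and 500/83 = D/a. All dependence on the unknown β sits in three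
short intervals. -/
theorem exists_experiment_S_eq (h : experiment.IsFundamental β) :
    ∃ x ∈ Set.Icc (2.71329 : ℝ) 2.71331, ∃ p ∈ Set.Icc (0.2440970 : ℝ) 0.2441026,
      ∃ g ∈ Set.Icc (0.1163 : ℝ) 0.1163088, ∀ ξ : ℕ, 1 ≤ ξ → experiment.S β ξ =
        p * (ξ * (500 / 83) ^ 2 / x * besselK 1 (ξ * x) - 4 * g * besselK 0 (ξ * x)) := by
  have h1 := h.experiment_Gam_gt
  have h2 := h.experiment_Gam_lt
  have hg := h.Gam_pos
  have hL := h.Lam_pos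
  obtain ⟨hV0, hV1⟩ := experimentFrequencySq_mem_Icc
  have hs := h.experiment_sq_add_sq
  have hS := fun (ξ : ℕ) hξ => h.S_eq (by norm_num [experiment]) (ξ := ξ) hξ
  have ha : experiment.a = 3.32 := rfl
  have hD : experiment.D = 20 := rfl
  rw [ha] at h1 h2 hs
  rw [ha, hD] at hS
  set γ := experiment.Gam β
  set v := experiment.Lam β
  set V := experimentFrequencySq
  set w := γ * 3.32
  have hw : 0 < w := by positivity
  obtain ⟨a0, a1⟩ := besselI_core_lo
  obtain ⟨b0, b1⟩ := besselI_core_hi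
  obtain ⟨⟨c0, -⟩, c1, -⟩ := besselK_core_hi
  obtain ⟨⟨-, d0⟩, -, d1⟩ := besselK_core_lo
  have hK0 : besselK 0 w ∈ Set.Icc (1.01214055485 : ℝ) 1.01214682766 :=
    ⟨c0.trans (besselK_zero_antitone hw h2.le), (besselK_zero_antitone (by norm_num) h1.le).trans d0⟩
  have hK1 : besselK 1 w ∈ Set.Icc (1.88938767193 : ℝ) 1.88940495919 :=
    ⟨c1.trans (besselK_one_antitone hw h2.le), (besselK_one_antitone (by norm_num) h1.le).trans d1⟩
  have hI0 : besselI 0 w ∈ Set.Icc (1.0513630 : ℝ) 1.0513640 :=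
    ⟨a0.trans (besselI_mono 0 (by norm_num) h1.le), (besselI_mono 0 hw.le h2.le).trans b0⟩
  have hI1 : besselI 1 w ∈ Set.Icc (0.2309622 : ℝ) 0.2309641 :=
    ⟨a1.trans (besselI_mono 1 (by norm_num) h1.le), (besselI_mono 1 hw.le h2.le).trans b1⟩
  have hk : 0 < besselK 1 w := besselK_one_pos hw
  have hVpos : 0 < V := by linarith
  have hw2 : w ^ 2 ∈ Set.Icc (0.2028656 : ℝ) 0.2028687 := by
    constructor <;> nlinarith
  have hiV : 1 / V ∈ Set.Icc (0.633951574 : ℝ) 0.633951575 := by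
    constructor
    · rw [le_div_iff₀ hVpos]; linarith
    · rw [div_le_iff₀ hVpos]; linarith
  refine ⟨γ * 20, ⟨by simp only [w] at h1; linarith, by simp only [w] at h2; linarith⟩,
    (1 - w ^ 2 * (1 / V)) / besselK 1 w ^ 2, ⟨?_, ?_⟩,
    (besselI 0 w * besselK 0 w + besselI 1 w * besselK 1 w) / 2 - 1 / V, ⟨?_, ?_⟩, fun ξ hξ => ?_⟩
  · rw [le_div_iff₀ (by positivity)]
    have e1 : besselK 1 w ^ 2 ≤ 1.88940495919 ^ 2 :=
      pow_le_pow_left₀ (by linarith [hK1.1]) hK1.2 2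
    have e2 : w ^ 2 * (1 / V) ≤ 0.2028687 * 0.633951575 :=
      mul_le_mul hw2.2 hiV.2 (by positivity) (by norm_num)
    norm_num at e1 e2 ⊢
    linarith
  · rw [div_le_iff₀ (by positivity)]
    have e1 : 1.88938767193 ^ 2 ≤ besselK 1 w ^ 2 := pow_le_pow_left₀ (by norm_num) hK1.1 2
    have e2 : 0.2028656 * 0.633951574 ≤ w ^ 2 * (1 / V) :=
      mul_le_mul hw2.1 hiV.1 (by norm_num) (by positivity)
    norm_num at e1 e2 ⊢
    linarith
  · have e1 : 1.0513630 * 1.01214055485 ≤ besselI 0 w * besselK 0 w :=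
      mul_le_mul hI0.1 hK0.1 (by norm_num) (by linarith [hI0.1])
    have e2 : 0.2309622 * 1.88938767193 ≤ besselI 1 w * besselK 1 w :=
      mul_le_mul hI1.1 hK1.1 (by norm_num) (by linarith [hI1.1])
    linarith [hiV.2]
  · have e1 : besselI 0 w * besselK 0 w ≤ 1.0513640 * 1.01214682766 :=
      mul_le_mul hI0.2 hK0.2 (by linarith [hK0.1]) (by norm_num)
    have e2 : besselI 1 w * besselK 1 w ≤ 0.2309641 * 1.88940495919 :=
      mul_le_mul hI1.2 hK1.2 (by linarith [hK1.1]) (by norm_num)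
    linarith [hiV.1]
  · have hv : (v ^ 2 + γ ^ 2) * 3.32 ^ 2 = V := by rw [← hs]; ring
    rw [hS ξ hξ, ← hv, show γ * (ξ * 20) = ξ * (γ * 20) by ring]
    simp only [w]
    field_simp
    ring

/-- Each step in j gains exp(-2.71329) ≤ 1/15 from the decay of K₁ and loses at most 5/4 from the
linear factor, by Bernoulli's inequality; 5/4 · 1/15 = 1/12. -/
theorem experiment_tail_le {x : ℝ} (hx : 2.71329 ≤ x) (j : ℕ) :
    (4 + j : ℝ) * besselK 1 ((4 + j) * x) ≤ 4 * besselK 1 (4 * 2.71329) * (1 / 12) ^ j := by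
  have h1 : (15 : ℝ) ≤ Real.exp 2.71329 := by
    refine le_trans ?_ (Real.sum_le_exp_of_nonneg (by norm_num) 10)
    norm_num [Finset.sum_range_succ, Nat.factorial]
  have h2 : Real.exp (-(j * 2.71329)) ≤ (1 / 15) ^ j := by
    rw [Real.exp_neg, Real.exp_nat_mul, one_div, inv_pow]
    gcongr
  have h3 : besselK 1 ((4 + j) * x) ≤ (1 / 15) ^ j * besselK 1 (4 * 2.71329) := by
    have h4 : 0 < besselK 1 (4 * 2.71329) := besselK_one_pos (by norm_num)
    calc besselK 1 ((4 + j) * x) ≤ besselK 1 (4 * 2.71329 + j * 2.71329) :=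
          besselK_one_antitone (by positivity) (by rw [← add_mul]; gcongr)
      _ ≤ Real.exp (-(j * 2.71329)) * besselK 1 (4 * 2.71329) :=
          besselK_one_add_le (by norm_num) (by positivity)
      _ ≤ _ := by gcongr
  have h5 : (4 + j : ℝ) ≤ 4 * (5 / 4) ^ j := by
    have := one_add_mul_le_pow (a := (1 / 4 : ℝ)) (by norm_num) j
    norm_num at this ⊢
    linarith
  calc (4 + j : ℝ) * besselK 1 ((4 + j) * x)
      ≤ 4 * (5 / 4) ^ j * ((1 / 15) ^ j * besselK 1 (4 * 2.71329)) :=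
        mul_le_mul h5 h3 (besselK_one_pos (by nlinarith)).le (by positivity)
    _ = 4 * besselK 1 (4 * 2.71329) * (5 / 4 * (1 / 15)) ^ j := by
        rw [mul_pow]
        ring
    _ = _ := by norm_num

end WaveguideArray.IsFundamental

/-- K₀ and K₁ decrease, so upper bounds come from the left end of the bracket for x and lower bounds
from the right end. The K₀ term is subtracted and takes the opposite bound. -/
theorem overlap_mem_Icc {m x p g k₀ k₁ l₀ l₁ s₀ s₁ : ℝ} (hm : 0 < m)
    (hx : x ∈ Set.Icc (2.71329 : ℝ) 2.71331) (hp : p ∈ Set.Icc (0.2440970 : ℝ) 0.2441026)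
    (hg : g ∈ Set.Icc (0.1163 : ℝ) 0.1163088)
    (hlo : besselK 0 (m * 2.71329) ≤ k₁ ∧ besselK 1 (m * 2.71329) ≤ l₁)
    (hhi : k₀ ≤ besselK 0 (m * 2.71331) ∧ l₀ ≤ besselK 1 (m * 2.71331))
    (hk : 0 ≤ k₀) (hl : 0 ≤ l₀) (hs : 0 ≤ s₀)
    (h₀ : s₀ ≤ 0.2440970 * (m * (500 / 83) ^ 2 / 2.71331 * l₀ - 4 * 0.1163088 * k₁))
    (h₁ : 0.2441026 * (m * (500 / 83) ^ 2 / 2.71329 * l₁ - 4 * 0.1163 * k₀) ≤ s₁) :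
    p * (m * (500 / 83) ^ 2 / x * besselK 1 (m * x) - 4 * g * besselK 0 (m * x)) ∈
      Set.Icc s₀ s₁ := by
  obtain ⟨hx0, hx1⟩ := hx
  obtain ⟨hp0, hp1⟩ := hp
  obtain ⟨hg0, hg1⟩ := hg
  have hxpos : 0 < x := by linarith
  have m0 : m * 2.71329 ≤ m * x := by gcongr
  have m1 : m * x ≤ m * 2.71331 := by gcongr
  have a0 := hhi.1.trans (besselK_zero_antitone (by positivity) m1)
  have a1 := (besselK_zero_antitone (by positivity) m0).trans hlo.1
  have b0 := hhi.2.trans (besselK_one_antitone (by positivity) m1)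
  have b1 := (besselK_one_antitone (by positivity) m0).trans hlo.2
  have c0 := hk.trans a0
  have d0 := hl.trans b0
  have e0 : m * (500 / 83) ^ 2 / 2.71331 * l₀ - 4 * 0.1163088 * k₁ ≤
      m * (500 / 83) ^ 2 / x * besselK 1 (m * x) - 4 * g * besselK 0 (m * x) := by
    gcongr
  have e1 : m * (500 / 83) ^ 2 / x * besselK 1 (m * x) - 4 * g * besselK 0 (m * x) ≤
      m * (500 / 83) ^ 2 / 2.71329 * l₁ - 4 * 0.1163 * k₀ := by
    gcongr
  have e2 : 0 ≤ m * (500 / 83) ^ 2 / 2.71331 * l₀ - 4 * 0.1163088 * k₁ :=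
    nonneg_of_mul_nonneg_right (hs.trans h₀) (by norm_num)
  exact ⟨h₀.trans (mul_le_mul hp0 e0 e2 (by linarith)),
    (mul_le_mul hp1 e1 (e2.trans e0) (by norm_num)).trans h₁⟩

theorem WaveguideArray.IsFundamental.two_mul_tsum_experiment_S_mem_Icc {β : ℝ}
    (h : WaveguideArray.experiment.IsFundamental β) :
    2 * ∑' ξ : ℕ, WaveguideArray.experiment.S β (ξ + 1) ∈ Set.Icc (0.395090 : ℝ) 0.395134 := by
  obtain ⟨x, hx, p, hp, g, hg, hS⟩ := h.exists_experiment_S_eq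
  have hs1 : WaveguideArray.experiment.S β 1 ∈ Set.Icc (0.1799498 : ℝ) 0.1799604 := by
    rw [hS 1 le_rfl, Nat.cast_one]
    obtain ⟨a, b⟩ := besselK_one_lo
    obtain ⟨c, d⟩ := besselK_one_hi
    rw [← one_mul 2.71329] at a b
    rw [← one_mul 2.71331] at c d
    refine overlap_mem_Icc one_pos hx hp hg ⟨a.2, b.2⟩ ⟨c.1, d.1⟩ ?_ ?_ ?_ ?_ ?_ <;> norm_num
  have hs2 : WaveguideArray.experiment.S β 2 ∈ Set.Icc (0.0162007 : ℝ) 0.0162021 := by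
    rw [hS 2 (by norm_num), Nat.cast_ofNat]
    obtain ⟨a, b⟩ := besselK_two_lo
    obtain ⟨c, d⟩ := besselK_two_hi
    refine overlap_mem_Icc two_pos hx hp hg ⟨a.2, b.2⟩ ⟨c.1, d.1⟩ ?_ ?_ ?_ ?_ ?_ <;> norm_num
  have hs3 : WaveguideArray.experiment.S β 3 ∈ Set.Icc (0.0012962 : ℝ) 0.0012965 := by
    rw [hS 3 (by norm_num), Nat.cast_ofNat]
    obtain ⟨a, b⟩ := besselK_three_lo
    obtain ⟨c, d⟩ := besselK_three_hi
    refine overlap_mem_Icc three_pos hx hp hg ⟨a.2, b.2⟩ ⟨c.1, d.1⟩ ?_ ?_ ?_ ?_ ?_ <;> norm_num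
  have hs4 : WaveguideArray.experiment.S β 4 ∈ Set.Icc (0.0000984 : ℝ) 0.0000987 := by
    rw [hS 4 (by norm_num), Nat.cast_ofNat]
    obtain ⟨a, b⟩ := besselK_four_lo
    obtain ⟨c, d⟩ := besselK_four_hi
    refine overlap_mem_Icc four_pos hx hp hg ⟨a.2, b.2⟩ ⟨c.1, d.1⟩ ?_ ?_ ?_ ?_ ?_ <;> norm_num
  have hxpos : 0 < x := by linarith [hx.1]
  -- The subtracted K₀ term is dropped. The constant 0.0000996 rounds up 0.2441026 ·
  -- (500/83)²/2.71329 · 4 · 0.00000761959, and the extra 1/12 appears because ξ = j + 5 is j + 1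
  -- steps past 4.
  have htail : ∀ j : ℕ, WaveguideArray.experiment.S β (j + 5) ≤
      0.0000996 * (1 / 12) * (1 / 12) ^ j := fun j => by
    rw [hS (j + 5) (by omega), show ((j + 5 : ℕ) : ℝ) = 4 + (j + 1 : ℕ) by push_cast; ring]
    have h1 := WaveguideArray.IsFundamental.experiment_tail_le hx.1 (j + 1)
    set m : ℝ := 4 + (j + 1 : ℕ)
    have hm : 0 < m := by positivity
    have h2 := besselK_zero_pos (mul_pos hm hxpos)
    have h3 := besselK_one_pos (mul_pos hm hxpos)
    have h4 : 0 ≤ 4 * g * besselK 0 (m * x) := by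
      have := hg.1
      have : 0 ≤ g := by linarith
      positivity
    have h5 := besselK_four_lo.2.2
    have h6 := hp.1
    have h7 : 0 ≤ p := by linarith
    calc _ ≤ p * ((500 / 83) ^ 2 / x * (m * besselK 1 (m * x))) := by
          refine mul_le_mul_of_nonneg_left ?_ h7
          rw [show (500 / 83) ^ 2 / x * (m * besselK 1 (m * x)) =
            m * (500 / 83) ^ 2 / x * besselK 1 (m * x) by ring]
          linarith
      _ ≤ 0.2441026 * ((500 / 83) ^ 2 / 2.71329 * (4 * 0.00000761959 * (1 / 12) ^ (j + 1))) := by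
          have h8 := hp.2
          have h9 := hx.1
          have h10 := h1.trans (mul_le_mul_of_nonneg_right
            (mul_le_mul_of_nonneg_left h5 zero_le_four) (by positivity))
          gcongr
      _ ≤ _ := by
          rw [pow_succ (1 / 12 : ℝ)]
          have : 0 ≤ (1 / 12 : ℝ) ^ j := by positivity
          generalize (1 / 12 : ℝ) ^ j = t at this
          linarith
  have hgeo : HasSum (fun j : ℕ => 0.0000996 * (1 / 12) * (1 / 12 : ℝ) ^ j)
      (0.0000996 * (1 / 12) * (1 - 1 / 12)⁻¹) :=
    (hasSum_geometric_of_lt_one (by norm_num) (by norm_num)).mul_left _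
  have hsum := (summable_nat_add_iff 5).2 h.summable_S
  have t0 : 0 ≤ ∑' j : ℕ, WaveguideArray.experiment.S β (j + 5) :=
    tsum_nonneg fun j => h.S_nonneg _
  have t1 := (hsum.tsum_le_tsum htail hgeo.summable).trans_eq hgeo.tsum_eq
  have t2 := ((summable_nat_add_iff 1).2 h.summable_S).sum_add_tsum_nat_add 4
  simp only [Finset.sum_range_succ, Finset.sum_range_zero, zero_add, add_assoc] at t2
  norm_num at t1 t2
  rw [← t2]
  constructor <;> linarith [hs1.1, hs1.2, hs2.1, hs2.2, hs3.1, hs3.2, hs4.1, hs4.2]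

theorem mainTheorem7 :
    (∀ (W : WaveguideArray) (β : ℝ), W.IsFundamental β →
      (∀ ξ : ℕ, MeasureTheory.Integrable
        (fun p : ℝ × ℝ => W.mode β 0 p * W.mode β (ξ : ℤ) p)) ∧
      Summable (fun ξ : ℕ => W.S β ξ) ∧
      ∃ 𝒮 ℛ : EllTwo →L[ℂ] EllTwo,
        (∀ (c : EllTwo) (n : ℤ),
          HasSum (fun m : ℤ => (W.S β (n - m).natAbs : ℂ) * c m) (𝒮 c n)) ∧
        (∀ (c : EllTwo) (n : ℤ),
          HasSum (fun m : ℤ => if m = n then 0 else (W.S β (n - m).natAbs : ℂ) * c m) (ℛ c n)) ∧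
        𝒮 = 1 + ℛ ∧
        ‖ℛ‖ ≤ 2 * ∑' ξ : ℕ, W.S β (ξ + 1) ∧
        IsUnit 𝒮) ∧
    (∀ β : ℝ, WaveguideArray.experiment.IsFundamental β →
      2 * (∑' ξ : ℕ, WaveguideArray.experiment.S β (ξ + 1)) < 1 ∧
      |2 * (∑' ξ : ℕ, WaveguideArray.experiment.S β (ξ + 1)) - 0.3951| < 5 / 10 ^ 5) := by
  refine ⟨fun W β h => ⟨fun ξ => h.integrable_mode_mul 0 ξ, h.summable_S,
    WaveguideArray.exists_gram_operator h⟩, fun β h => ?_⟩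
  have h1 := h.two_mul_tsum_experiment_S_mem_Icc
  refine ⟨by linarith [h1.2], abs_lt.2 ⟨?_, ?_⟩⟩
  · linarith [h1.1]
  · linarith [h1.2]
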